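/- **Setting.** Let $T,\beta>0$, $I=(0,T)$, $f:[0,T]\times\mathbb R^n\to\mathbb R^n$, $g:[0,T]\times\mathbb R^n\to\mathbb R^{n\times m}$, $Q_1,Q_2\in\mathbb R^{n\times n}$, $y_d\in L^2(I;\mathbb R^n)$, $y_d^T\in\mathbb R^n$. Let $W_T=\{y\in L^2(I;\mathbb R^n): \dot y\in L^2(I;\mathbb R^n)\}$ (distributional derivative) with $\|y\|_{W_T}^2=\|y\|_{L^2}^2+\|\dot y\|_{L^2}^2$; elements of $W_T$ are identified with their continuous representatives on $[0,T]$. For $t\in[0,T]$ put $$J_t(y,u)=\tfrac12\int_t^T\big(|Q_1(y(s)-y_d(s))|^2+\beta|u(s)|^2\big)\,ds+\tfrac12|Q_2(y(T)-y_d^T)|^2,\qquad J=J_0 .$$ For $y_0\in\mathbb R^n$ let $(P^{y_0})$ be the problem of minimizing $J(y,u)$ over $y\in W_T$, $u\in L^2(I;\mathbb R^m)$ subject to $\dot y=f(t,y)+g(t,y)u$ a.e. in $I$ and $y(0)=y_0$. For $t<T$ the value function $V^*(t,y_0)$ is the infimum of $J_t(y,u)$ over all $y\in H^1(t,T;\mathbb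 R^n)$, $u\in L^2(t,T;\mathbb R^m)$ with $\dot y=f(\cdot,y)+g(\cdot,y)u$ on $(t,T)$ and $y(t)=y_0$, and $V^*(T,y_0)=\frac12|Q_2(y_0-y_d^T)|^2$. For a function $v(t,y)$ the induced feedback is $\mathcal F_v(y)(t)=-\frac1\beta g(t,y(t))^\top\partial_y v(t,y(t))$. **Assumption 1.** $Y_0\subset\mathbb R^n$ is compact and $M>0$ is a constant; $\hat M$ denotes $M$ times the norm of the embedding $W_T\hookrightarrow C([0,T];\mathbb R^n)$, and $\bar B$ is the closed ball of radius $2\hat M$ around $0$. (A.1) $f,g$ are twice continuously differentiable on $[0,T]\times\mathbb R^n$, and $D_yf,D_{yy}f,D_yg,D_{yy}g$ are Lipschitz continuous in $y$ on compact sets, uniformly in $t$. (A.2) On $[0,T]\times\bar B$ the value function $V^*$ is finite and twice continuously differentiable, and its gradient and Hessian in $y$ are Lipschitz continuous in $y$, uniformly in $t$. (A.3) For every $y_0\in Y_0$ there is a unique $y\in W_T$ with $\dot y=f(t,y)+g(t,y)\mathcal F_{V^*}(y)$, $y(0)=y_0$, $\|y\|_{W_T}\le M$, and $(y,\mathcal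 F_{V^*}(y))$ is a minimizing pair of $(P^{y_0})$. **Assumption 2.** For $\varepsilon>0$ let $\mathcal R_\varepsilon$ be a finite-dimensional real Hilbert space and $V^\varepsilon_\theta(t,y)$, $\theta\in\mathcal R_\varepsilon$, a family of functions. There are $\varepsilon_0>0$, $c>0$ and $\theta_\varepsilon\in\mathcal R_\varepsilon$ such that for all $0<\varepsilon\le\varepsilon_0$: $(\theta,t,y)\mapsto V^\varepsilon_\theta(t,y)$ is $C^4$ on $\mathcal R_\varepsilon\times\mathbb R\times\mathbb R^n$; $V^\varepsilon_\theta(T,y)=\frac12|Q_2(y-y_d^T)|^2$ for all $\theta,y$; and for all $(t,y)\in[0,T]\times\bar B$ $$|V^\varepsilon_{\theta_\varepsilon}-V^*|+|\partial_y(V^\varepsilon_{\theta_\varepsilon}-V^*)|+\|\partial_{yy}(V^\varepsilon_{\theta_\varepsilon}-V^*)\|\le c\,\varepsilon .$$ **Learning problem.** Fix $y_0^1,\dots,y_0^N\in Y_0$, weights $\omega_i>0$, constants $\gamma_1,\gamma_2\ge0$ and $\gamma_\varepsilon>0$. Write $\mathcal F^\varepsilon_\theta=\mathcal F_{V^\varepsilon_\theta}$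 and $$J_\varepsilon(y,p,\theta)=J(y,\mathcal F^\varepsilon_\theta(y))+\int_0^T\Big(\tfrac{\gamma_1}2\big|V^\varepsilon_\theta(t,y(t))-J_t(y,\mathcal F^\varepsilon_\theta(y))\big|^2+\tfrac{\gamma_2}2\big|\partial_yV^\varepsilon_\theta(t,y(t))-p(t)\big|^2\Big)dt .$$ Problem $(\mathcal P^N_\varepsilon)$ is to minimize $\sum_{i=1}^N\omega_iJ_\varepsilon(y_i,p_i,\theta)+\frac{\gamma_\varepsilon}2\|\theta\|^2_{\mathcal R_\varepsilon}$ over $(\mathbf y,\mathbf p,\theta)\in W_T^{N}\times W_T^N\times\mathcal R_\varepsilon$ subject to, with $u_i=\mathcal F^\varepsilon_\theta(y_i)$ and for $i=1,\dots,N$, $$\dot y_i=f(t,y_i)+g(t,y_i)u_i,\quad y_i(0)=y_0^i,$$ $$-\dot p_i=D_yf(t,y_i)^\top p_i+[D_yg(t,y_i)^\top u_i]p_i+Q_1^\top Q_1(y_i-y_d),\quad p_i(T)=Q_2^\top Q_2(y_i(T)-y_d^T),$$ where $[D_yg(t,y)^\top u]$ is the transpose of the matrix of $\delta y\mapsto(D_yg(t,y)\delta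 y)u$. **Proposition.** Let Assumptions 1 and 2 hold and let $\gamma_\varepsilon\|\theta_\varepsilon\|^2_{\mathcal R_\varepsilon}=O(\varepsilon)$ as $\varepsilon\to0^+$. Let $\varepsilon_k>0$, $\varepsilon_k\to0$, be such that for each $k$ there is a solution $(\mathbf y^k,\mathbf p^k,\theta_k)$ of $(\mathcal P^N_{\varepsilon_k})$, and suppose that $\max_i\|y_i^k\|_{L^\infty(I;\mathbb R^n)}\le M_\infty$ for all $k$ with some $M_\infty>0$. Then $(\mathbf y^k,\mathbf p^k,\mathcal F^{\varepsilon_k}_{\theta_k}(\mathbf y^k))$ has at least one strong accumulation point in $W_T^{2N}\times L^2(I;\mathbb R^m)^N$. For each such point $(\bar{\mathbf y},\bar{\mathbf p},\bar{\mathbf u})$ and every $i=1,\dots,N$, the pair $(\bar y_i,\bar u_i)$ is a minimizing pair of $(P^{y_0^i})$, and $$\dot{\bar y}_i=f(t,\bar y_i)+g(t,\bar y_i)\bar u_i,\quad \bar y_i(0)=y_0^i,$$ $$-\dot{\bar p}_i=D_yf(t,\bar y_i)^\top\bar p_i+[D_yg(t,\bar y_i)^\top\bar u_i]\bar p_i+Q_1^\top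 Q_1(\bar y_i-y_d),\quad \bar p_i(T)=Q_2^\top Q_2(\bar y_i(T)-y_d^T).$$ -/

import Mathlib

open MeasureTheory Set Filter Topology
open scoped ENNReal ContDiff NNReal

noncomputable section

namespace FeedbackLearning

/-! ### A function with an integrable weak derivative is a primitive of it -/

/-- Integration by parts against a primitive. -/
theorem aux_ibp {a b : ℝ} (hab : a ≤ b) {v φ : ℝ → ℝ} (hv : IntegrableOn v (Ioo a b))
    (hφ : ContDiff ℝ ∞ φ) (ha : φ a = 0) (hb : φ b = 0) :
    ∫ t in Ioo a b, deriv φ t * (∫ s in a..t, v s) = - ∫ t in Ioo a b, φ t * v t := by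
  have hvi : IntervalIntegrable v volume a b := by
    rw [intervalIntegrable_iff_integrableOn_Ioo_of_le hab]; exact hv
  have h1 : AbsolutelyContinuousOnInterval φ a b :=
    ContDiffOn.absolutelyContinuousOnInterval ((hφ.of_le (by exact_mod_cast le_top)).contDiffOn)
  have h2 := hvi.absolutelyContinuousOnInterval_intervalIntegral (c := a) (by simp)
  have h3 := AbsolutelyContinuousOnInterval.integral_mul_deriv_eq_deriv_mul h1 h2
  rw [ha, hb] at h3
  have h4 : ∫ x in a..b, φ x * deriv (fun x => ∫ t in a..x, v t) x = ∫ x in a..b, φ x * v x := by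
    apply intervalIntegral.integral_congr_ae
    filter_upwards [hvi.ae_hasDerivAt_integral] with x hx hx'
    rw [(hx (uIoc_subset_uIcc hx') a (by simp)).deriv]
  rw [h4] at h3
  simp only [intervalIntegral.integral_of_le hab, integral_Ioc_eq_integral_Ioo, zero_mul,
    sub_zero, zero_sub] at h3
  rw [h3, neg_neg]

/-- A test function with integral zero is the derivative of a test function. -/
theorem aux_primitive {a b : ℝ} {η : ℝ → ℝ} (hη : ContDiff ℝ ∞ η)
    (hc : HasCompactSupport η) (hs : tsupport η ⊆ Ioo a b) (h0 : ∫ t in Ioo a b, η t = 0)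
    (hab : a < b) :
    ContDiff ℝ ∞ (fun t => ∫ s in a..t, η s) ∧ HasCompactSupport (fun t => ∫ s in a..t, η s) ∧
      tsupport (fun t => ∫ s in a..t, η s) ⊆ Ioo a b ∧ deriv (fun t => ∫ s in a..t, η s) = η := by
  have hd : ∀ x, HasDerivAt (fun t => ∫ s in a..t, η s) (η x) x := fun x =>
    intervalIntegral.integral_hasDerivAt_right (hη.continuous.intervalIntegrable _ _)
      (hη.continuous.stronglyMeasurableAtFilter _ _) hη.continuous.continuousAt
  have hde : deriv (fun t => ∫ s in a..t, η s) = η := funext fun x => (hd x).deriv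
  have hsm : ContDiff ℝ ∞ (fun t => ∫ s in a..t, η s) := by
    rw [contDiff_infty_iff_deriv, hde]; exact ⟨fun x => (hd x).differentiableAt, hη⟩
  obtain ⟨c, d, hac, hdb, hcd⟩ : ∃ c d, a < c ∧ d < b ∧ tsupport η ⊆ Icc c d := by
    rcases (tsupport η).eq_empty_or_nonempty with he | hne
    · exact ⟨b, a, hab, hab, by simp [he]⟩
    · obtain ⟨c, hc1, hc2⟩ := IsCompact.exists_isLeast hc hne
      obtain ⟨d, hd1, hd2⟩ := IsCompact.exists_isGreatest hc hne
      exact ⟨c, d, (hs hc1).1, (hs hd1).2, fun x hx => ⟨hc2 hx, hd2 hx⟩⟩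
  have hz : ∀ x, x ∉ Icc c d → η x = 0 := fun x hx =>
    image_eq_zero_of_notMem_tsupport (fun h => hx (hcd h))
  have hsub : tsupport (fun t => ∫ s in a..t, η s) ⊆ Icc c d := by
    apply closure_minimal _ isClosed_Icc
    intro t ht
    by_contra hcon
    apply ht
    rw [mem_Icc, not_and_or, not_le, not_le] at hcon
    rcases hcon with h | h
    · apply intervalIntegral.integral_zero_ae
      refine Eventually.of_forall fun x hx => hz x fun hx' => ?_
      have := hx.2
      have : x ≤ max a t := hx.2
      have h5 : max a t < c := max_lt hac h
      linarith [hx'.1]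
    · have h6 : ∫ s in a..b, η s = 0 := by
        rw [intervalIntegral.integral_of_le hab.le, integral_Ioc_eq_integral_Ioo, h0]
      have h7 : ∫ s in b..t, η s = 0 := by
        apply intervalIntegral.integral_zero_ae
        refine Eventually.of_forall fun x hx => hz x fun hx' => ?_
        have : min b t < x := hx.1
        have h5 : d < min b t := lt_min hdb h
        linarith [hx'.2]
      have := intervalIntegral.integral_add_adjacent_intervals
        (hη.continuous.intervalIntegrable (μ := volume) a b)
        (hη.continuous.intervalIntegrable (μ := volume) b t)
      change ∫ s in a..t, η s = 0
      linarith
  refine ⟨hsm, isCompact_Icc.of_isClosed_subset (isClosed_tsupport _) hsub,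
    hsub.trans fun x hx => ⟨hac.trans_le hx.1, hx.2.trans_lt hdb⟩, hde⟩

/-- The lemma of du Bois-Reymond. -/
theorem aux_dbr {a b : ℝ} (hab : a < b) {y v : ℝ → ℝ} (hy : IntegrableOn y (Ioo a b))
    (hv : IntegrableOn v (Ioo a b))
    (h : ∀ φ : ℝ → ℝ, ContDiff ℝ ∞ φ → HasCompactSupport φ → tsupport φ ⊆ Ioo a b →
      ∫ t in Ioo a b, deriv φ t * y t = - ∫ t in Ioo a b, φ t * v t) :
    ∃ c : ℝ, ∀ᵐ t ∂(volume.restrict (Ioo a b)), y t = c + ∫ s in a..t, v s := by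
  set m := (a + b) / 2 with hm
  let ψ : ContDiffBump m := ⟨(b - a) / 8, (b - a) / 4, by linarith, by linarith⟩
  have hψs : tsupport ψ ⊆ Ioo a b := by
    rw [ψ.tsupport_eq, Real.closedBall_eq_Icc]
    intro x hx
    have h1 : m - (b - a) / 4 ≤ x := hx.1
    have h2 : x ≤ m + (b - a) / 4 := hx.2
    constructor <;> linarith
  have hψc : ContDiff ℝ ∞ ψ := ψ.contDiff
  have hψk : HasCompactSupport ψ := ψ.hasCompactSupport
  set I := ∫ t in Ioo a b, ψ t with hI
  have hIpos : I ≠ 0 := by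
    have : I = ∫ t, ψ t := by
      apply setIntegral_eq_integral_of_forall_compl_eq_zero
      intro x hx
      exact image_eq_zero_of_notMem_tsupport fun h' => hx (hψs h')
    rw [this]; exact (ψ.integral_pos).ne'
  have hvi : IntervalIntegrable v volume a b := by
    rw [intervalIntegrable_iff_integrableOn_Ioo_of_le hab.le]; exact hv
  set Wf := fun t => ∫ s in a..t, v s with hW
  have hWc : ContinuousOn Wf (uIcc a b) :=
    (hvi.absolutelyContinuousOnInterval_intervalIntegral (c := a) (by simp)).continuousOn
  have hWi : IntegrableOn Wf (Ioo a b) := by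
    rw [uIcc_of_le hab.le] at hWc
    exact (hWc.integrableOn_compact isCompact_Icc).mono_set Ioo_subset_Icc_self
  have hw : IntegrableOn (fun t => y t - Wf t) (Ioo a b) := hy.sub hWi
  have hmul : ∀ (φ : ℝ → ℝ), ContDiff ℝ ∞ φ → HasCompactSupport φ →
      ∀ z : ℝ → ℝ, IntegrableOn z (Ioo a b) → IntegrableOn (fun t => φ t * z t) (Ioo a b) := by
    intro φ h1 h2 z hz
    obtain ⟨C, hC⟩ := h2.exists_bound_of_continuous h1.continuous
    exact Integrable.bdd_mul hz h1.continuous.aestronglyMeasurable (Eventually.of_forall hC)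
  have key : ∀ η : ℝ → ℝ, ContDiff ℝ ∞ η → HasCompactSupport η → tsupport η ⊆ Ioo a b →
      ∫ t in Ioo a b, η t = 0 → ∫ t in Ioo a b, η t * (y t - Wf t) = 0 := by
    intro η h1 h2 h3 h4
    obtain ⟨p1, p2, p3, p4⟩ := aux_primitive h1 h2 h3 h4 hab
    have e1 := h _ p1 p2 p3
    have pa := image_eq_zero_of_notMem_tsupport fun h' => (lt_irrefl a (p3 h').1)
    have pb := image_eq_zero_of_notMem_tsupport fun h' => (lt_irrefl b (p3 h').2)
    have e2 := aux_ibp hab.le hv p1 pa pb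
    rw [p4] at e1 e2
    simp only [mul_sub]
    rw [integral_sub (hmul η h1 h2 _ hy) (hmul η h1 h2 _ hWi), e1, e2, sub_self]
  set c := (∫ t in Ioo a b, ψ t * (y t - Wf t)) / I with hc
  refine ⟨c, ?_⟩
  have hzero := isOpen_Ioo.ae_eq_zero_of_integral_contDiff_smul_eq_zero (μ := volume)
    (f := fun t => (Ioo a b).indicator (fun t => y t - Wf t - c) t) (U := Ioo a b) ?_ ?_
  · rw [ae_restrict_iff' measurableSet_Ioo]
    filter_upwards [hzero] with t ht hmem
    have := ht hmem
    rw [indicator_of_mem hmem] at this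
    simp only [hW] at this ⊢
    linarith
  · apply IntegrableOn.locallyIntegrableOn
    have : IntegrableOn (fun t => y t - Wf t - c) (Ioo a b) := hw.sub (by simp)
    exact (this.integrable_indicator measurableSet_Ioo).integrableOn
  · intro φ h1 h2 h3
    have e0 : ∫ x, φ x • (Ioo a b).indicator (fun t => y t - Wf t - c) x
        = ∫ x in Ioo a b, φ x * (y x - Wf x - c) := by
      rw [← integral_indicator measurableSet_Ioo]
      congr 1; ext x
      by_cases hx : x ∈ Ioo a b <;> simp [hx]
    rw [e0]
    set K := ∫ t in Ioo a b, φ t with hK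
    have hφi : IntegrableOn φ (Ioo a b) := (h1.continuous.integrable_of_hasCompactSupport h2).integrableOn
    have hψi : IntegrableOn ψ (Ioo a b) := (hψc.continuous.integrable_of_hasCompactSupport hψk).integrableOn
    have e1 := key (fun t => φ t - (K / I) * ψ t) (h1.sub (contDiff_const.mul hψc))
      (h2.sub (hψk.mul_left))
      ((tsupport_sub _ _).trans (union_subset h3 ((tsupport_mul_subset_right).trans hψs)))
      (by rw [integral_sub hφi (hψi.const_mul _), integral_const_mul, ← hI, ← hK]
          field_simp; ring)
    have i1 := hmul φ h1 h2 _ hw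
    have i2 := hmul ψ hψc hψk _ hw
    have e2 : ∫ t in Ioo a b, (φ t - (K / I) * ψ t) * (y t - Wf t)
        = (∫ t in Ioo a b, φ t * (y t - Wf t)) - (K / I) * ∫ t in Ioo a b, ψ t * (y t - Wf t) := by
      rw [← integral_const_mul, ← integral_sub i1 (i2.const_mul _)]
      congr 1; ext t; ring
    rw [e2] at e1
    have e3 : ∫ x in Ioo a b, φ x * (y x - Wf x - c)
        = (∫ t in Ioo a b, φ t * (y t - Wf t)) - K * c := by
      rw [hK, ← integral_mul_const, ← integral_sub i1 (hφi.mul_const _)]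
      congr 1; ext t; ring
    rw [e3, hc, ← e1]
    ring

/-! ### The spaces `L²(a,b;ℝⁿ)` and `H¹(a,b;ℝⁿ)` -/

/-- Euclidean space `ℝⁿ`. -/
abbrev E (n : ℕ) : Type := EuclideanSpace ℝ (Fin n)

/-- Lebesgue measure on the interval `(a,b)`. -/
abbrev intervalMeasure (a b : ℝ) : Measure ℝ := volume.restrict (Ioo a b)

/-- The space `L²(a,b;ℝⁿ)`. -/
abbrev L2 (a b : ℝ) (n : ℕ) : Type := Lp (E n) 2 (intervalMeasure a b)

/-- `v` is the distributional derivative of `y` on `(a,b)`. -/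
def IsWeakDeriv {n : ℕ} (a b : ℝ) (y v : ℝ → E n) : Prop :=
  ∀ φ : ℝ → ℝ, ContDiff ℝ ∞ φ → HasCompactSupport φ → tsupport φ ⊆ Ioo a b →
    ∫ t in Ioo a b, deriv φ t • y t = - ∫ t in Ioo a b, φ t • v t

theorem L2.integrableOn {a b : ℝ} {n : ℕ} (y : L2 a b n) : IntegrableOn y (Ioo a b) :=
  (Lp.memLp y).integrable (by norm_num)

theorem integrableOn_test_smul {a b : ℝ} {n : ℕ} {φ : ℝ → ℝ} (h1 : Continuous φ)
    (h2 : HasCompactSupport φ) {y : ℝ → E n} (hy : IntegrableOn y (Ioo a b)) :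
    IntegrableOn (fun t => φ t • y t) (Ioo a b) := by
  obtain ⟨C, hC⟩ := h2.exists_bound_of_continuous h1
  exact Integrable.bdd_smul hy C h1.aestronglyMeasurable (Eventually.of_forall hC)

/-- The Hilbert space of all `y ∈ L²(a,b;ℝⁿ)` with distributional derivative `ẏ ∈ L²(a,b;ℝⁿ)`.
An element is stored as the pair `(y, ẏ)`, and the inner product inherited from the Hilbert sum is
`(y₁, y₂) + (ẏ₁, ẏ₂)`. The space `W_T` is `W 0 T n`. -/
def W (a b : ℝ) (n : ℕ) : Submodule ℝ (WithLp 2 (L2 a b n × L2 a b n)) where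
  carrier := {w | IsWeakDeriv a b w.fst w.snd}
  zero_mem' := by
    intro φ _ _ _
    have h0 : ((0 : L2 a b n) : ℝ → E n) =ᵐ[intervalMeasure a b] 0 := Lp.coeFn_zero _ _ _
    rw [integral_eq_zero_of_ae, integral_eq_zero_of_ae, neg_zero]
    · filter_upwards [h0] with t ht
      change φ t • ((0 : L2 a b n) : ℝ → E n) t = 0
      rw [ht]; simp
    · filter_upwards [h0] with t ht
      change deriv φ t • ((0 : L2 a b n) : ℝ → E n) t = 0
      rw [ht]; simp
  add_mem' := by
    intro w z hw hz φ h1 h2 h3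
    have key : ∀ (χ : ℝ → ℝ), Continuous χ → HasCompactSupport χ → ∀ p q : L2 a b n,
        ∫ t in Ioo a b, χ t • (p + q : L2 a b n) t
          = (∫ t in Ioo a b, χ t • p t) + ∫ t in Ioo a b, χ t • q t := by
      intro χ c1 c2 p q
      rw [← integral_add (integrableOn_test_smul c1 c2 p.integrableOn)
        (integrableOn_test_smul c1 c2 q.integrableOn)]
      apply integral_congr_ae
      filter_upwards [Lp.coeFn_add p q] with t ht
      rw [ht, Pi.add_apply, smul_add]
    rw [WithLp.add_fst, WithLp.add_snd,
      key _ (h1.continuous_deriv (by simp)) h2.deriv, key _ h1.continuous h2,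
      hw φ h1 h2 h3, hz φ h1 h2 h3]
    abel
  smul_mem' := by
    intro r w hw φ h1 h2 h3
    have key : ∀ (χ : ℝ → ℝ) (p : L2 a b n),
        ∫ t in Ioo a b, χ t • (r • p : L2 a b n) t = r • ∫ t in Ioo a b, χ t • p t := by
      intro χ p
      rw [← integral_smul]
      apply integral_congr_ae
      filter_upwards [Lp.coeFn_smul r p] with t ht
      rw [ht, Pi.smul_apply, smul_comm]
    rw [WithLp.smul_fst, WithLp.smul_snd, key, key, hw φ h1 h2 h3, smul_neg]

section H1

variable {a b : ℝ} {n : ℕ}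

/-- The function `y` of an element of `W a b n`. -/
def valL2 (y : W a b n) : L2 a b n := (y : WithLp 2 (L2 a b n × L2 a b n)).fst

/-- The distributional derivative `ẏ` of an element of `W a b n`. -/
def derivL2 (y : W a b n) : L2 a b n := (y : WithLp 2 (L2 a b n × L2 a b n)).snd

theorem exists_rep (y : W a b n) :
    ∃ c : ℝ → E n, Continuous c ∧ c =ᵐ[intervalMeasure a b] valL2 y := by
  rcases le_or_gt b a with hba | hab
  · refine ⟨0, continuous_const, ?_⟩
    have h0 : intervalMeasure a b = 0 := by simp [hba]
    simp [EventuallyEq, h0]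
  have hcoord : ∀ i : Fin n, ∃ c : ℝ, ∀ᵐ t ∂(intervalMeasure a b),
      valL2 y t i = c + ∫ s in a..t, derivL2 y s i := by
    intro i
    have hi : ∀ z : ℝ → E n, IntegrableOn z (Ioo a b) →
        IntegrableOn (fun t => z t i) (Ioo a b) := fun z hz =>
      (EuclideanSpace.proj (𝕜 := ℝ) i).integrable_comp hz
    have hint : ∀ (χ : ℝ → ℝ), Continuous χ → HasCompactSupport χ → ∀ p : L2 a b n,
        ∫ t in Ioo a b, χ t * p t i = (∫ t in Ioo a b, χ t • p t) i := by
      intro χ c1 c2 p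
      exact (EuclideanSpace.proj (𝕜 := ℝ) i).integral_comp_comm
        (integrableOn_test_smul c1 c2 p.integrableOn)
    refine aux_dbr hab (hi _ (valL2 y).integrableOn) (hi _ (derivL2 y).integrableOn) ?_
    intro φ h1 h2 h3
    rw [hint _ (h1.continuous_deriv (by simp)) h2.deriv, hint _ h1.continuous h2]
    exact congrArg (fun x : E n => x i) (y.2 φ h1 h2 h3)
  choose C hC using hcoord
  let c : ℝ → E n := fun t => WithLp.toLp 2 fun i => C i + ∫ s in a..t, derivL2 y s i
  have hc : ContinuousOn c (Icc a b) := by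
    refine (PiLp.continuous_toLp 2 _).comp_continuousOn (continuousOn_pi.mpr fun i => ?_)
    refine continuousOn_const.add ?_
    have hvi : IntervalIntegrable (fun s => derivL2 y s i) volume a b := by
      rw [intervalIntegrable_iff_integrableOn_Ioo_of_le hab.le]
      exact (EuclideanSpace.proj (𝕜 := ℝ) i).integrable_comp (derivL2 y).integrableOn
    have := (hvi.absolutelyContinuousOnInterval_intervalIntegral (c := a) (by simp)).continuousOn
    rwa [uIcc_of_le hab.le] at this
  refine ⟨IccExtend hab.le ((Icc a b).domRestrict c), hc.domRestrict.Icc_extend', ?_⟩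
  filter_upwards [ae_all_iff.mpr hC, ae_restrict_mem measurableSet_Ioo] with t ht hmem
  rw [IccExtend_of_mem _ _ (Ioo_subset_Icc_self hmem)]
  ext i
  exact (ht i).symm

/-- The continuous representative of an element of `W a b n`. For `a < b` its values on `[a,b]`
are uniquely determined; only these are used below. -/
def rep (y : W a b n) : ℝ → E n := Classical.choose (exists_rep y)

theorem continuous_rep (y : W a b n) : Continuous (rep y) :=
  (Classical.choose_spec (exists_rep y)).1

theorem rep_ae_eq (y : W a b n) : rep y =ᵐ[intervalMeasure a b] valL2 y :=
  (Classical.choose_spec (exists_rep y)).2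

end H1

/-- The operator norm of the embedding of `W a b n` into `C([a,b];ℝⁿ)` with the maximum norm. -/
def embeddingNorm (a b : ℝ) (n : ℕ) : ℝ :=
  sInf {C : ℝ | 0 ≤ C ∧ ∀ y : W a b n, ∀ t ∈ Icc a b, ‖rep y t‖ ≤ C * ‖y‖}

/-! ### The open loop problem and its value function -/

/-- The data of the optimal control problem: horizon `T`, dynamics `ẏ = f(t,y) + g(t,y) u`, weights
`Q₁`, `Q₂`, cost parameter `β`, desired state `yd` and desired terminal state `ydT`. -/
structure ControlProblem (n m : ℕ) where
  T : ℝ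
  T_pos : 0 < T
  f : ℝ → E n → E n
  g : ℝ → E n → (E m →L[ℝ] E n)
  Q₁ : E n →L[ℝ] E n
  Q₂ : E n →L[ℝ] E n
  β : ℝ
  β_pos : 0 < β
  yd : L2 0 T n
  ydT : E n

namespace ControlProblem

variable {n m : ℕ} (P : ControlProblem n m)

/-- The state equation `ẏ = f(y) + g(y) u` in `L²(a,b;ℝⁿ)` with `y(a) = y₀`. -/
def StateEq {a b : ℝ} (y : W a b n) (u : ℝ → E m) (y₀ : E n) : Prop :=
  (∀ᵐ t ∂(intervalMeasure a b), derivL2 y t = P.f t (rep y t) + P.g t (rep y t) (u t)) ∧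
    rep y a = y₀

/-- The adjoint equation
`-ṗ = Df(y)ᵀ p + [Dg(y)ᵀ u] p + Q₁ᵀ Q₁ (y - yd)`, `p(T) = Q₂ᵀ Q₂ (y(T) - ydT)`.
Here `[Dg(y)ᵀ u]` is the transpose of the matrix of `δy ↦ (D_y g(t,y) δy) u`. -/
def AdjointEq (y : W 0 P.T n) (u : ℝ → E m) (p : W 0 P.T n) : Prop :=
  (∀ᵐ t ∂(intervalMeasure 0 P.T),
    -(derivL2 p t) = (fderiv ℝ (P.f t) (rep y t)).adjoint (rep p t)
      + ((fderiv ℝ (P.g t) (rep y t)).flip (u t)).adjoint (rep p t)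
      + P.Q₁.adjoint (P.Q₁ (rep y t - P.yd t))) ∧
    rep p P.T = P.Q₂.adjoint (P.Q₂ (rep y P.T - P.ydT))

/-- The cost `J_t(y,u)` on `[t,T]`; the cost `J` is `J_0`. -/
def cost (t : ℝ) (y : ℝ → E n) (u : ℝ → E m) : ℝ :=
  1 / 2 * (∫ s in Ioo t P.T, (‖P.Q₁ (y s - P.yd s)‖ ^ 2 + P.β * ‖u s‖ ^ 2))
    + 1 / 2 * ‖P.Q₂ (y P.T - P.ydT)‖ ^ 2

/-- `(y,u)` is a minimizing pair of the open loop problem with initial condition `y₀`. -/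
def IsOptimalPair (y₀ : E n) (y : W 0 P.T n) (u : L2 0 P.T m) : Prop :=
  P.StateEq y u y₀ ∧
    ∀ (z : W 0 P.T n) (v : L2 0 P.T m), P.StateEq z v y₀ →
      P.cost 0 (rep y) u ≤ P.cost 0 (rep z) v

/-- All costs `J_t(y,u)` of admissible pairs on `[t,T]` that start at `y₀` at time `t`. -/
def costSet (t : ℝ) (y₀ : E n) : Set ℝ :=
  {c | ∃ (y : W t P.T n) (u : L2 t P.T m), P.StateEq y u y₀ ∧ c = P.cost t (rep y) u}

open Classical in
/-- The value function `V*(t,y₀)`, with its terminal value `½|Q₂(y₀ - ydT)|²` at `t = T`. -/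
def valueFunction (t : ℝ) (y₀ : E n) : ℝ :=
  if t < P.T then sInf (P.costSet t y₀) else 1 / 2 * ‖P.Q₂ (y₀ - P.ydT)‖ ^ 2

/-! ### Feedback laws -/

/-- The feedback law `F(t,y) = -(1/β) g(t,y)ᵀ ∂_y v(t,y)` induced by `v`, along the curve `y`. -/
def feedback (v : ℝ → E n → ℝ) (y : ℝ → E n) (t : ℝ) : E m :=
  -(1 / P.β) • (P.g t (y t)).adjoint (gradient (v t) (y t))

open Classical in
/-- The feedback control `t ↦ F(t,y(t))` as an element of `L²(0,T;ℝᵐ)`. -/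
def feedbackL2 (v : ℝ → E n → ℝ) (y : W 0 P.T n) : L2 0 P.T m :=
  if h : MemLp (P.feedback v (rep y)) 2 (intervalMeasure 0 P.T) then h.toLp else 0

/-- For continuous `g` and continuously differentiable `v` the feedback control is in `L²`, so that
the second case of `feedbackL2` does not occur. -/
theorem memLp_feedback
    (hg : ContinuousOn (fun x : ℝ × E n => P.g x.1 x.2) (Icc 0 P.T ×ˢ univ))
    {v : ℝ → E n → ℝ} (hv : ContDiff ℝ 1 (fun x : ℝ × E n => v x.1 x.2)) (y : W 0 P.T n) :
    MemLp (P.feedback v (rep y)) 2 (intervalMeasure 0 P.T) := by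
  have hcurve : Continuous fun t : ℝ => (t, rep y t) := continuous_id.prodMk (continuous_rep y)
  have hgc : ContinuousOn (fun t => P.g t (rep y t)) (Icc 0 P.T) :=
    hg.comp hcurve.continuousOn fun t ht => ⟨ht, mem_univ _⟩
  have hfd : ∀ t, fderiv ℝ (v t) (rep y t) =
      (fderiv ℝ (fun x : ℝ × E n => v x.1 x.2) (t, rep y t)).comp
        (ContinuousLinearMap.inr ℝ ℝ (E n)) := by
    intro t
    have h1 := ((hv.differentiable (by simp)) (t, rep y t)).hasFDerivAt
    have h2 : HasFDerivAt (fun z : E n => (t, z)) (ContinuousLinearMap.inr ℝ ℝ (E n)) (rep y t) :=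
      hasFDerivAt_prodMk_right t (rep y t)
    exact (h1.comp (rep y t) h2).fderiv
  have hgrad : Continuous fun t => gradient (v t) (rep y t) := by
    have hd : Continuous (InnerProductSpace.toDual ℝ (E n)).symm := LinearIsometryEquiv.continuous _
    have hf : Continuous fun t => fderiv ℝ (v t) (rep y t) := by
      simp only [hfd]
      exact ((hv.continuous_fderiv (by simp)).comp hcurve).clm_comp continuous_const
    exact hd.comp hf
  have hcont : ContinuousOn (P.feedback v (rep y)) (Icc 0 P.T) := by
    have hadj : Continuous (ContinuousLinearMap.adjoint (𝕜 := ℝ) (E := E m) (F := E n)) :=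
      LinearIsometryEquiv.continuous _
    have h3 : ContinuousOn (fun t => (P.g t (rep y t)).adjoint (gradient (v t) (rep y t)))
        (Icc 0 P.T) := (hadj.comp_continuousOn hgc).clm_apply hgrad.continuousOn
    exact h3.const_smul (-(1 / P.β))
  obtain ⟨C, hC⟩ := isCompact_Icc.exists_bound_of_continuousOn hcont
  refine MemLp.of_bound
    ((hcont.mono Ioo_subset_Icc_self).aestronglyMeasurable measurableSet_Ioo) C ?_
  filter_upwards [ae_restrict_mem measurableSet_Ioo] with t ht
  exact hC t (Ioo_subset_Icc_self ht)

/-- The closed loop state equation `ẏ = f(y) + g(y) F(y)`, `y(0) = y₀`, for the feedback law `F`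
induced by `v`. -/
def ClosedLoop (v : ℝ → E n → ℝ) (y : W 0 P.T n) (y₀ : E n) : Prop :=
  P.StateEq y (P.feedback v (rep y)) y₀

/-! ### Standing assumptions -/

/-- The radius `2 M̂`, where `M̂` is `M` times the norm of the embedding of `W_T` into
`C([0,T];ℝⁿ)`. -/
def radius (M : ℝ) : ℝ := 2 * (M * embeddingNorm 0 P.T n)

/-- The gradient of `v` on the closed ball of radius `r` (as a linear form). -/
def ballGrad (r : ℝ) (v : E n → ℝ) : E n → (E n →L[ℝ] ℝ) :=
  fderivWithin ℝ v (Metric.closedBall 0 r)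

/-- The Hessian of `v` on the closed ball of radius `r` (as a bilinear form). -/
def ballHess (r : ℝ) (v : E n → ℝ) : E n → (E n →L[ℝ] E n →L[ℝ] ℝ) :=
  fderivWithin ℝ (ballGrad r v) (Metric.closedBall 0 r)

/-- The first and second derivatives of `h(t,y)` in `y` are Lipschitz continuous on compact sets,
uniformly for `t ∈ [0,T]`. -/
def LipschitzDerivatives {F : Type*} [NormedAddCommGroup F] [NormedSpace ℝ F] (T : ℝ)
    (h : ℝ → E n → F) : Prop :=
  ∀ K : Set (E n), IsCompact K → ∃ L : ℝ≥0, ∀ t ∈ Icc 0 T,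
    LipschitzOnWith L (fderiv ℝ (h t)) K ∧ LipschitzOnWith L (fderiv ℝ (fderiv ℝ (h t))) K

/-- The standing assumption on the dynamics, the value function and the optimal feedback law on the
compact set `Y₀`, with the constant `M`. -/
structure FeedbackAssumption (Y₀ : Set (E n)) (M : ℝ) : Prop where
  isCompact : IsCompact Y₀
  M_pos : 0 < M
  /-- `f` and `g` are twice continuously differentiable. -/
  f_smooth : ContDiffOn ℝ 2 (fun x : ℝ × E n => P.f x.1 x.2) (Icc 0 P.T ×ˢ univ)
  g_smooth : ContDiffOn ℝ 2 (fun x : ℝ × E n => P.g x.1 x.2) (Icc 0 P.T ×ˢ univ)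
  /-- The Jacobians and Hessians in `y` are Lipschitz on compact sets, uniformly in `t`. -/
  f_lipschitz : LipschitzDerivatives P.T P.f
  g_lipschitz : LipschitzDerivatives P.T P.g
  /-- The value function is finite on `[0,T] × B̄(0, 2 M̂)`, twice continuously differentiable
  there, and has a gradient and Hessian in `y` that are Lipschitz, uniformly in `t`. -/
  value_finite : ∀ t ∈ Ico 0 P.T, ∀ y ∈ Metric.closedBall (0 : E n) (P.radius M),
    (P.costSet t y).Nonempty
  value_smooth : ContDiffOn ℝ 2 (fun x : ℝ × E n => P.valueFunction x.1 x.2)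
    (Icc 0 P.T ×ˢ Metric.closedBall 0 (P.radius M))
  value_lipschitz : ∃ L : ℝ≥0, ∀ t ∈ Icc 0 P.T,
    LipschitzOnWith L (ballGrad (P.radius M) (P.valueFunction t))
      (Metric.closedBall 0 (P.radius M)) ∧
    LipschitzOnWith L (ballHess (P.radius M) (P.valueFunction t))
      (Metric.closedBall 0 (P.radius M))
  /-- The closed loop system of the optimal feedback law has a unique solution in the `M`-ball. -/
  closedLoop : ∀ y₀ ∈ Y₀, ∃! y : W 0 P.T n, P.ClosedLoop P.valueFunction y y₀ ∧ ‖y‖ ≤ M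
  /-- This solution, together with its feedback control, is optimal. -/
  optimal : ∀ y₀ ∈ Y₀, ∀ y : W 0 P.T n, P.ClosedLoop P.valueFunction y y₀ → ‖y‖ ≤ M →
    P.IsOptimalPair y₀ y (P.feedbackL2 P.valueFunction y)

/-- The standing assumption on the family `V ε θ`, `θ ∈ R ε`, of approximations to the value
function, for `0 < ε ≤ ε₀`, with the well approximating parameters `θ ε`. -/
structure ApproximationAssumption {R : ℝ → Type*} [∀ ε, NormedAddCommGroup (R ε)]
    [∀ ε, InnerProductSpace ℝ (R ε)] (M ε₀ : ℝ) (V : (ε : ℝ) → R ε → ℝ → E n → ℝ)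
    (θ : (ε : ℝ) → R ε) : Prop where
  ε₀_pos : 0 < ε₀
  smooth : ∀ ε ∈ Ioc 0 ε₀,
    ContDiff ℝ 4 (fun x : R ε × ℝ × E n => V ε x.1 x.2.1 x.2.2)
  terminal : ∀ ε ∈ Ioc 0 ε₀, ∀ (η : R ε) (y : E n),
    V ε η P.T y = 1 / 2 * ‖P.Q₂ (y - P.ydT)‖ ^ 2
  approx : ∃ c > 0, ∀ ε ∈ Ioc 0 ε₀, ∀ t ∈ Icc 0 P.T,
    ∀ y ∈ Metric.closedBall (0 : E n) (P.radius M),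
      |V ε (θ ε) t y - P.valueFunction t y|
        + ‖ballGrad (P.radius M) (fun z => V ε (θ ε) t z - P.valueFunction t z) y‖
        + ‖ballHess (P.radius M) (fun z => V ε (θ ε) t z - P.valueFunction t z) y‖ ≤ c * ε

/-! ### The learning problem with a finite training set -/

/-- The augmented cost `J_ε(y,p,θ)`, where `v = V^ε_θ`. -/
def augmentedCost (γ₁ γ₂ : ℝ) (v : ℝ → E n → ℝ) (y p : W 0 P.T n) : ℝ :=
  P.cost 0 (rep y) (P.feedback v (rep y))
    + ∫ t in Ioo 0 P.T,
      (γ₁ / 2 * |v t (rep y t) - P.cost t (rep y) (P.feedback v (rep y))| ^ 2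
        + γ₂ / 2 * ‖gradient (v t) (rep y t) - rep p t‖ ^ 2)

variable {Θ : Type*} [NormedAddCommGroup Θ] {N : ℕ}

/-- The objective of the learning problem with initial conditions `y₀ i` and weights `w i`,
`i = 1,…,N`, and the parametrized family `v η`, `η ∈ Θ`. -/
def learningObjective (w : Fin N → ℝ) (γ₁ γ₂ γ : ℝ) (v : Θ → ℝ → E n → ℝ)
    (y p : Fin N → W 0 P.T n) (η : Θ) : ℝ :=
  ∑ i, w i * P.augmentedCost γ₁ γ₂ (v η) (y i) (p i) + γ / 2 * ‖η‖ ^ 2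

/-- Admissibility for the learning problem: the closed loop state and adjoint equations hold. -/
def LearningAdmissible (y₀ : Fin N → E n) (v : Θ → ℝ → E n → ℝ)
    (y p : Fin N → W 0 P.T n) (η : Θ) : Prop :=
  ∀ i, P.ClosedLoop (v η) (y i) (y₀ i) ∧ P.AdjointEq (y i) (P.feedback (v η) (rep (y i))) (p i)

/-- `(y,p,η)` solves the learning problem. -/
def IsLearningSolution (y₀ : Fin N → E n) (w : Fin N → ℝ) (γ₁ γ₂ γ : ℝ)
    (v : Θ → ℝ → E n → ℝ) (y p : Fin N → W 0 P.T n) (η : Θ) : Prop :=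
  P.LearningAdmissible y₀ v y p η ∧
    ∀ (z q : Fin N → W 0 P.T n) (ζ : Θ), P.LearningAdmissible y₀ v z q ζ →
      P.learningObjective w γ₁ γ₂ γ v y p η ≤ P.learningObjective w γ₁ γ₂ γ v z q ζ

end ControlProblem

end FeedbackLearning

end

open FeedbackLearning

noncomputable section

namespace FeedbackLearning

/-! ### Representatives of `H¹` functions -/

section Representatives

variable {a b : ℝ} {n : ℕ}

/-! For the exact value function both penalty terms of the learning problem vanish along an optimal
trajectory. The value at `(t, y(t))` is the remaining cost, by the principle of optimality
(`value_eq_cost`), and its gradient in `y` is the adjoint state (`valueGrad_eq_adjoint`). The second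
identity needs no Hamilton–Jacobi–Bellman equation. If the optimal control is kept and the state at
time `t₀` is moved by `h`, the cost of the new trajectory bounds the value function from above, and
it equals the optimal cost plus `⟨p(t₀), h⟩` up to an error `O(|h|²)`. Since equality holds at `h =
0`, a function with a local maximum arises, and its derivative must vanish.

The parameter `θ ε` is therefore a good competitor. Its feedback law is `O(ε)`-close to the optimal
one on the ball. The optimal trajectory lies in the ball of half the radius, so a Gronwall argument
yields a closed loop trajectory that stays in the ball and is `O(ε)`-close to the optimal one
(`exists_closedLoop_near`). The adjoint states are then close as well (`exists_adjoint_stability`),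
and the augmented cost exceeds the optimal cost by at most `O(ε)` (`exists_competitor`). As `γ ε *
‖θ ε‖ ^ 2 = O(ε)`, the minimal learning objective is at most the weighted sum of the optimal costs
plus `O(ε)`. Conversely, each component of a learning solution is admissible for its own open loop
problem, so its cost is at least the optimal one. The weights being positive, every single cost
converges to its optimal value (`tendsto_cost_learningSolution`).

It remains to study minimizing sequences of one open loop problem. Because `β > 0`, bounded costs
bound the controls in `L²`, and the uniform bound on the states then bounds their derivatives in
`L²`. Along a subsequence controls and derivatives converge weakly and states pointwise; the
dynamics being affine in the control, the weak limit satisfies the state equation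
(`stateEq_of_weak`). Its cost is at least the limit of the costs, which forces convergence of the
control norms and hence strong convergence of the controls. States and adjoint states follow
(`exists_strong_subseq`). Optimality and both equations pass to strong limits (`optimal_of_tendsto`,
`adjointEq_of_tendsto`). Convergence of the parameters `η k` plays no role. -/

theorem intervalIntegrable_of_memLp {F : Type*} [NormedAddCommGroup F] (hab : a ≤ b)
    {v : ℝ → F} (hv : MemLp v 2 (intervalMeasure a b)) : IntervalIntegrable v volume a b := by
  rw [intervalIntegrable_iff_integrableOn_Ioo_of_le hab]
  exact hv.integrable (by norm_num)

theorem intervalIntegrable_mono_Icc {F : Type*} [NormedAddCommGroup F]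
    {v : ℝ → F} (hv : IntervalIntegrable v volume a b) {s t : ℝ} (hs : s ∈ Icc a b)
    (ht : t ∈ Icc a b) : IntervalIntegrable v volume s t := by
  refine hv.mono_set ?_
  rw [uIcc_of_le (hs.1.trans hs.2)]
  exact uIcc_subset_Icc hs ht

theorem continuousOn_primitive_Icc {F : Type*} [NormedAddCommGroup F] [NormedSpace ℝ F]
    (hab : a ≤ b) {v : ℝ → F} (hv : IntervalIntegrable v volume a b) :
    ContinuousOn (fun t => ∫ s in a..t, v s) (Icc a b) := by
  have := intervalIntegral.continuousOn_primitive_interval' hv (a := a) (by simp)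
  rwa [uIcc_of_le hab] at this

theorem intervalIntegral_apply {v : ℝ → E n} {s t : ℝ} (hv : IntervalIntegrable v volume s t)
    (i : Fin n) : (∫ r in s..t, v r) i = ∫ r in s..t, v r i :=
  ((EuclideanSpace.proj (𝕜 := ℝ) i).intervalIntegral_comp_comm hv).symm

theorem eqOn_Icc_of_ae_eq_Ioo {F : Type*} [TopologicalSpace F] [T2Space F] (hab : a < b)
    {u v : ℝ → F} (h : u =ᵐ[intervalMeasure a b] v) (hu : ContinuousOn u (Icc a b))
    (hv : ContinuousOn v (Icc a b)) : EqOn u v (Icc a b) := by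
  refine Measure.eqOn_Icc_of_ae_eq (μ := volume) hab.ne ?_ hu hv
  rwa [← Measure.restrict_congr_set Ioo_ae_eq_Icc]

/-- By `aux_dbr` every coordinate agrees a.e. with a primitive of the weak derivative, and two
continuous functions that agree a.e. on `(a,b)` agree on `[a,b]`. This makes the chosen
representative computable and turns differential equations in `W a b n` into integral equations. -/
theorem rep_eq_add_integral (hab : a < b) (y : W a b n) {t : ℝ} (ht : t ∈ Icc a b) :
    rep y t = rep y a + ∫ s in a..t, derivL2 y s := by
  have hd : IntervalIntegrable (derivL2 y) volume a b :=
    intervalIntegrable_of_memLp hab.le (Lp.memLp _)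
  ext i
  have hi : ∀ z : ℝ → E n, IntegrableOn z (Ioo a b) →
      IntegrableOn (fun t => z t i) (Ioo a b) := fun z hz =>
    (EuclideanSpace.proj (𝕜 := ℝ) i).integrable_comp hz
  have hint : ∀ (χ : ℝ → ℝ), Continuous χ → HasCompactSupport χ → ∀ p : L2 a b n,
      ∫ t in Ioo a b, χ t * p t i = (∫ t in Ioo a b, χ t • p t) i := by
    intro χ c1 c2 p
    exact (EuclideanSpace.proj (𝕜 := ℝ) i).integral_comp_comm
      (integrableOn_test_smul c1 c2 p.integrableOn)
  obtain ⟨c, hc⟩ : ∃ c : ℝ, ∀ᵐ t ∂(intervalMeasure a b),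
      valL2 y t i = c + ∫ s in a..t, derivL2 y s i := by
    refine aux_dbr hab (hi _ (valL2 y).integrableOn) (hi _ (derivL2 y).integrableOn) ?_
    intro φ h1 h2 h3
    rw [hint _ (h1.continuous_deriv (by simp)) h2.deriv, hint _ h1.continuous h2]
    exact congrArg (fun x : E n => x i) (y.2 φ h1 h2 h3)
  have hdi : IntervalIntegrable (fun s => derivL2 y s i) volume a b := by
    rw [intervalIntegrable_iff_integrableOn_Ioo_of_le hab.le]
    exact hi _ (derivL2 y).integrableOn
  have heq : EqOn (fun t => rep y t i) (fun t => c + ∫ s in a..t, derivL2 y s i) (Icc a b) := by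
    refine eqOn_Icc_of_ae_eq_Ioo hab ?_ ?_ ?_
    · filter_upwards [hc, rep_ae_eq y] with t h1 h2
      rw [h2, h1]
    · exact ((EuclideanSpace.proj (𝕜 := ℝ) i).continuous.comp (continuous_rep y)).continuousOn
    · exact continuousOn_const.add (continuousOn_primitive_Icc hab.le hdi)
  have h1 := heq ht
  have h2 := heq (left_mem_Icc.mpr hab.le)
  simp only [intervalIntegral.integral_same, add_zero] at h1 h2
  rw [PiLp.add_apply, h1, h2, intervalIntegral_apply
    (intervalIntegrable_mono_Icc hd (left_mem_Icc.mpr hab.le) ht)]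

theorem memLp_of_continuousOn_Icc {F : Type*} [NormedAddCommGroup F] {Y : ℝ → F}
    [SecondCountableTopology F] {p : ℝ≥0∞}
    (hY : ContinuousOn Y (Icc a b)) : MemLp Y p (intervalMeasure a b) := by
  obtain ⟨C, hC⟩ := isCompact_Icc.exists_bound_of_continuousOn hY
  refine MemLp.of_bound
    ((hY.mono Ioo_subset_Icc_self).aestronglyMeasurable measurableSet_Ioo) C ?_
  filter_upwards [ae_restrict_mem measurableSet_Ioo] with t ht
  exact hC t (Ioo_subset_Icc_self ht)

/-- Primitives of square integrable functions are elements of `W a b n`. -/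
theorem exists_W (hab : a < b) (c : E n) {v : ℝ → E n} (hv : MemLp v 2 (intervalMeasure a b)) :
    ∃ y : W a b n, derivL2 y =ᵐ[intervalMeasure a b] v ∧
      ∀ t ∈ Icc a b, rep y t = c + ∫ s in a..t, v s := by
  have hvi := intervalIntegrable_of_memLp hab.le hv
  set Y : ℝ → E n := fun t => c + ∫ s in a..t, v s with hYdef
  have hY : ContinuousOn Y (Icc a b) :=
    continuousOn_const.add (continuousOn_primitive_Icc hab.le hvi)
  have hYL : MemLp Y 2 (intervalMeasure a b) := memLp_of_continuousOn_Icc hY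
  have hweak : IsWeakDeriv a b (hYL.toLp Y) (hv.toLp v) := by
    intro φ h1 h2 h3
    have e1 : ∫ t in Ioo a b, deriv φ t • (hYL.toLp Y) t = ∫ t in Ioo a b, deriv φ t • Y t := by
      apply integral_congr_ae
      filter_upwards [hYL.coeFn_toLp] with t ht
      rw [ht]
    have e2 : ∫ t in Ioo a b, φ t • (hv.toLp v) t = ∫ t in Ioo a b, φ t • v t := by
      apply integral_congr_ae
      filter_upwards [hv.coeFn_toLp] with t ht
      rw [ht]
    have i0 := hYL.integrable (q := 2) (by norm_num)
    have i1 := integrableOn_test_smul (h1.continuous_deriv (by simp)) h2.deriv i0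
    have i2 := integrableOn_test_smul h1.continuous h2 (hv.integrable (q := 2) (by norm_num))
    rw [e1, e2]
    ext i
    have f1 := (EuclideanSpace.proj (𝕜 := ℝ) i).integral_comp_comm i1
    have f2 := (EuclideanSpace.proj (𝕜 := ℝ) i).integral_comp_comm i2
    change ∫ t in Ioo a b, deriv φ t * Y t i = _ at f1
    change ∫ t in Ioo a b, φ t * v t i = _ at f2
    change (EuclideanSpace.proj (𝕜 := ℝ) i) _ = - (EuclideanSpace.proj (𝕜 := ℝ) i) _
    rw [← f1, ← f2]
    have pa := image_eq_zero_of_notMem_tsupport fun h' => (lt_irrefl a (h3 h').1)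
    have pb := image_eq_zero_of_notMem_tsupport fun h' => (lt_irrefl b (h3 h').2)
    have hvi' : IntegrableOn (fun t => v t i) (Ioo a b) :=
      (EuclideanSpace.proj (𝕜 := ℝ) i).integrable_comp (hv.integrable (q := 2) (by norm_num))
    rw [← aux_ibp hab.le hvi' h1 pa pb]
    -- The constant `c` drops out because `deriv φ` has integral zero; what remains is `aux_ibp` in
    -- each coordinate.
    have hderiv : ∫ t in Ioo a b, deriv φ t = 0 := by
      rw [← integral_Ioc_eq_integral_Ioo, ← intervalIntegral.integral_of_le hab.le,
        intervalIntegral.integral_deriv_eq_sub (fun x _ => h1.differentiable (by simp) x)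
          ((h1.continuous_deriv (by simp)).intervalIntegrable _ _), pa, pb, sub_zero]
    have hdi : IntegrableOn (fun t => deriv φ t) (Ioo a b) :=
      ((h1.continuous_deriv (by simp)).integrable_of_hasCompactSupport h2.deriv).integrableOn
    have e3 : ∫ t in Ioo a b, deriv φ t * Y t i
        = ∫ t in Ioo a b, (c i * deriv φ t + deriv φ t * ∫ s in a..t, v s i) := by
      apply setIntegral_congr_fun measurableSet_Ioo
      intro t ht
      simp only [hYdef, PiLp.add_apply]
      rw [intervalIntegral_apply (intervalIntegrable_mono_Icc hvi (left_mem_Icc.mpr hab.le)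
        (Ioo_subset_Icc_self ht))]
      ring
    have hi4 : IntegrableOn (fun t => deriv φ t * ∫ s in a..t, v s i) (Ioo a b) := by
      have : ContinuousOn (fun t => deriv φ t * ∫ s in a..t, v s i) (Icc a b) :=
        (h1.continuous_deriv (by simp)).continuousOn.mul (continuousOn_primitive_Icc hab.le
          ((intervalIntegrable_iff_integrableOn_Ioo_of_le hab.le).mpr hvi'))
      exact (this.integrableOn_compact isCompact_Icc).mono_set Ioo_subset_Icc_self
    rw [e3, integral_add (hdi.const_mul _) hi4, integral_const_mul, hderiv, mul_zero, zero_add]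
  refine ⟨⟨WithLp.toLp 2 (hYL.toLp Y, hv.toLp v), hweak⟩, hv.coeFn_toLp, ?_⟩
  refine eqOn_Icc_of_ae_eq_Ioo hab ?_ (continuous_rep _).continuousOn hY
  filter_upwards [rep_ae_eq (⟨WithLp.toLp 2 (hYL.toLp Y, hv.toLp v), hweak⟩ : W a b n),
    hYL.coeFn_toLp] with t h1 h2
  rw [h1]; exact h2

theorem norm_sq_eq (y : W a b n) : ‖y‖ ^ 2 = ‖valL2 y‖ ^ 2 + ‖derivL2 y‖ ^ 2 :=
  WithLp.prod_norm_sq_eq_of_L2 (y : WithLp 2 (L2 a b n × L2 a b n))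

theorem valL2_sub (y z : W a b n) : valL2 (y - z) = valL2 y - valL2 z := rfl

theorem derivL2_sub (y z : W a b n) : derivL2 (y - z) = derivL2 y - derivL2 z := rfl

theorem norm_valL2_le (y : W a b n) : ‖valL2 y‖ ≤ ‖y‖ := by
  refine abs_le_of_sq_le_sq' ?_ (norm_nonneg y) |>.2
  rw [norm_sq_eq]; nlinarith [sq_nonneg ‖derivL2 y‖]

theorem norm_derivL2_le (y : W a b n) : ‖derivL2 y‖ ≤ ‖y‖ := by
  refine abs_le_of_sq_le_sq' ?_ (norm_nonneg y) |>.2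
  rw [norm_sq_eq]; nlinarith [sq_nonneg ‖valL2 y‖]

theorem norm_W_le (y : W a b n) : ‖y‖ ≤ ‖valL2 y‖ + ‖derivL2 y‖ := by
  refine abs_le_of_sq_le_sq' ?_ (by positivity) |>.2
  rw [norm_sq_eq]; nlinarith [norm_nonneg (valL2 y), norm_nonneg (derivL2 y)]

theorem rep_sub (hab : a < b) (y z : W a b n) {t : ℝ} (ht : t ∈ Icc a b) :
    rep (y - z) t = rep y t - rep z t := by
  refine eqOn_Icc_of_ae_eq_Ioo (v := fun t => rep y t - rep z t) hab ?_
    (continuous_rep _).continuousOn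
    ((continuous_rep _).sub (continuous_rep _)).continuousOn ht
  filter_upwards [rep_ae_eq (y - z), rep_ae_eq y, rep_ae_eq z,
    Lp.coeFn_sub (valL2 y) (valL2 z)] with t h1 h2 h3 h4
  rw [h1, h2, h3, valL2_sub, h4, Pi.sub_apply]

/-- Cauchy–Schwarz for the integral of the norm over a subinterval. -/
theorem integral_norm_le_sqrt_mul {F : Type*} [NormedAddCommGroup F] (hab : a ≤ b)
    (v : Lp F 2 (intervalMeasure a b)) :
    ∫ s in a..b, ‖v s‖ ≤ √(b - a) * ‖v‖ := by
  rw [intervalIntegral.integral_of_le hab, integral_Ioc_eq_integral_Ioo]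
  have h1 : ∫ s in Ioo a b, ‖v s‖ = (eLpNorm v 1 (intervalMeasure a b)).toReal := by
    rw [eLpNorm_one_eq_lintegral_enorm,
      integral_norm_eq_lintegral_enorm (Lp.aestronglyMeasurable v)]
  rw [h1, Lp.norm_def]
  have h2 := eLpNorm_le_eLpNorm_mul_rpow_measure_univ (p := 1) (q := 2) (by norm_num)
    (Lp.aestronglyMeasurable v)
  have h3 : (intervalMeasure a b) univ ^ (1 / (1 : ℝ≥0∞).toReal - 1 / (2 : ℝ≥0∞).toReal)
      = ENNReal.ofReal √(b - a) := by
    rw [Measure.restrict_apply_univ, Real.volume_Ioo, Real.sqrt_eq_rpow,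
      ENNReal.ofReal_rpow_of_nonneg (by linarith) (by norm_num)]
    norm_num
  rw [h3] at h2
  calc _ ≤ (eLpNorm v 2 (intervalMeasure a b) * ENNReal.ofReal √(b - a)).toReal :=
        ENNReal.toReal_mono (ENNReal.mul_ne_top (Lp.eLpNorm_ne_top v) ENNReal.ofReal_ne_top) h2
    _ = _ := by rw [ENNReal.toReal_mul, ENNReal.toReal_ofReal (Real.sqrt_nonneg _), mul_comm]

theorem norm_rep_sub_le (hab : a < b) (y : W a b n) {s t : ℝ} (hs : s ∈ Icc a b)
    (ht : t ∈ Icc a b) : ‖rep y t - rep y s‖ ≤ √(b - a) * ‖derivL2 y‖ := by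
  have hd : IntervalIntegrable (derivL2 y) volume a b :=
    intervalIntegrable_of_memLp hab.le (Lp.memLp _)
  have h0 := left_mem_Icc.mpr hab.le
  have : rep y t - rep y s = ∫ r in s..t, derivL2 y r := by
    rw [rep_eq_add_integral hab y ht, rep_eq_add_integral hab y hs, add_sub_add_left_eq_sub,
      intervalIntegral.integral_interval_sub_left (intervalIntegrable_mono_Icc hd h0 ht)
        (intervalIntegrable_mono_Icc hd h0 hs)]
  rw [this]
  refine (intervalIntegral.norm_integral_le_abs_integral_norm).trans
    (le_trans ?_ (integral_norm_le_sqrt_mul hab.le (derivL2 y)))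
  have hab' : |∫ r in a..b, ‖derivL2 y r‖| = ∫ r in a..b, ‖derivL2 y r‖ :=
    abs_of_nonneg (intervalIntegral.integral_nonneg hab.le fun _ _ => norm_nonneg _)
  rw [← hab']
  refine intervalIntegral.abs_integral_mono_interval ?_
    (Eventually.of_forall fun x => norm_nonneg _) hd.norm
  rw [uIoc_of_le hab.le]
  exact Ioc_subset_Ioc (le_min hs.1 ht.1) (max_le hs.2 ht.2)

theorem norm_Lp_le_of_bound {F : Type*} [NormedAddCommGroup F] (hab : a ≤ b)
    (v : Lp F 2 (intervalMeasure a b)) {C : ℝ} (hC : 0 ≤ C)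
    (h : ∀ᵐ t ∂(intervalMeasure a b), ‖v t‖ ≤ C) : ‖v‖ ≤ √(b - a) * C := by
  have h1 := eLpNorm_le_of_ae_bound (p := 2) h
  have h3 : (intervalMeasure a b) univ ^ ((2 : ℝ≥0∞).toReal)⁻¹ = ENNReal.ofReal √(b - a) := by
    rw [Measure.restrict_apply_univ, Real.volume_Ioo, Real.sqrt_eq_rpow,
      ENNReal.ofReal_rpow_of_nonneg (by linarith) (by norm_num)]
    norm_num
  rw [h3] at h1
  rw [Lp.norm_def]
  calc _ ≤ (ENNReal.ofReal √(b - a) * ENNReal.ofReal C).toReal :=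
        ENNReal.toReal_mono (ENNReal.mul_ne_top ENNReal.ofReal_ne_top ENNReal.ofReal_ne_top) h1
    _ = _ := by rw [ENNReal.toReal_mul, ENNReal.toReal_ofReal (Real.sqrt_nonneg _),
                  ENNReal.toReal_ofReal hC]

/-- The value at one point and the derivative control the `W`-norm. -/
theorem norm_W_le_of_rep (hab : a < b) (y : W a b n) {s : ℝ} (hs : s ∈ Icc a b) :
    ‖y‖ ≤ √(b - a) * ‖rep y s‖ + (b - a + 1) * ‖derivL2 y‖ := by
  have h1 : ‖valL2 y‖ ≤ √(b - a) * (‖rep y s‖ + √(b - a) * ‖derivL2 y‖) := by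
    refine norm_Lp_le_of_bound hab.le _ (by positivity) ?_
    filter_upwards [rep_ae_eq y, ae_restrict_mem measurableSet_Ioo] with t ht hmem
    rw [← ht]
    have := norm_rep_sub_le hab y hs (Ioo_subset_Icc_self hmem)
    have h2 := norm_le_norm_add_norm_sub' (rep y t) (rep y s)
    linarith
  have h2 := norm_W_le y
  have h3 : √(b - a) * √(b - a) = b - a := Real.mul_self_sqrt (by linarith)
  calc ‖y‖ ≤ √(b - a) * (‖rep y s‖ + √(b - a) * ‖derivL2 y‖) + ‖derivL2 y‖ := by linarith
    _ = √(b - a) * ‖rep y s‖ + (√(b - a) * √(b - a) + 1) * ‖derivL2 y‖ := by ring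
    _ = _ := by rw [h3]

/-- Integrating `‖rep y t‖ - √(b - a) * ‖y‖ ≤ ‖rep y s‖` over `s` bounds the point value by the `L²`
norm. The result shows that the infimum in `embeddingNorm` is taken over a nonempty set, so that it
is not the default value `0`. -/
theorem exists_norm_rep_le (hab : a < b) (n : ℕ) :
    ∃ C : ℝ, 0 ≤ C ∧ ∀ y : W a b n, ∀ t ∈ Icc a b, ‖rep y t‖ ≤ C * ‖y‖ := by
  have hs : 0 < √(b - a) := Real.sqrt_pos.mpr (by linarith)
  refine ⟨(√(b - a))⁻¹ + √(b - a), by positivity, fun y t ht => ?_⟩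
  have hint : ∀ s ∈ Icc a b, ‖rep y t‖ - √(b - a) * ‖y‖ ≤ ‖rep y s‖ := by
    intro s hs'
    have h1 := norm_rep_sub_le hab y hs' ht
    have h2 := norm_le_norm_add_norm_sub' (rep y t) (rep y s)
    have h3 := mul_le_mul_of_nonneg_left (norm_derivL2_le y) hs.le
    linarith
  have h1 : ∫ s in a..b, (‖rep y t‖ - √(b - a) * ‖y‖) ≤ ∫ s in a..b, ‖rep y s‖ :=
    intervalIntegral.integral_mono_on hab.le (by simp)
      ((continuous_rep y).norm.intervalIntegrable _ _) hint
  have h2 : ∫ s in a..b, ‖rep y s‖ = ∫ s in a..b, ‖valL2 y s‖ := by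
    rw [intervalIntegral.integral_of_le hab.le, intervalIntegral.integral_of_le hab.le,
      integral_Ioc_eq_integral_Ioo, integral_Ioc_eq_integral_Ioo]
    apply integral_congr_ae
    filter_upwards [rep_ae_eq y] with t ht
    rw [ht]
  have h3 := integral_norm_le_sqrt_mul hab.le (valL2 y)
  have h4 := norm_valL2_le y
  rw [intervalIntegral.integral_const, smul_eq_mul, h2] at h1
  have h5 : √(b - a) * √(b - a) = b - a := Real.mul_self_sqrt (by linarith)
  have h6 : √(b - a) * (‖rep y t‖ - √(b - a) * ‖y‖) ≤ ‖y‖ := by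
    have : √(b - a) * (√(b - a) * (‖rep y t‖ - √(b - a) * ‖y‖)) ≤ √(b - a) * ‖y‖ := by
      rw [← mul_assoc, h5]
      exact (h1.trans h3).trans (mul_le_mul_of_nonneg_left h4 hs.le)
    exact le_of_mul_le_mul_left this hs
  rw [add_mul]
  have h7 : ‖rep y t‖ - √(b - a) * ‖y‖ ≤ (√(b - a))⁻¹ * ‖y‖ := by
    rw [inv_mul_eq_div, le_div_iff₀ hs]; linarith
  linarith

theorem embeddingNorm_nonneg (a b : ℝ) (n : ℕ) : 0 ≤ embeddingNorm a b n :=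
  Real.sInf_nonneg fun _ h => h.1

theorem norm_rep_le (hab : a < b) (y : W a b n) {t : ℝ} (ht : t ∈ Icc a b) :
    ‖rep y t‖ ≤ embeddingNorm a b n * ‖y‖ := by
  obtain ⟨C, hC⟩ := exists_norm_rep_le hab n
  rcases (norm_nonneg y).eq_or_lt with h0 | hpos
  · have := hC.2 y t ht
    rw [← h0] at this ⊢
    simpa using this
  · rw [← div_le_iff₀ hpos]
    refine le_csInf ⟨C, hC⟩ fun D hD => ?_
    rw [div_le_iff₀ hpos]
    exact hD.2 y t ht

/-- A nonzero constant function is a witness. Consequently the radius in the standing assumption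
vanishes at most for `n = 0`. -/
theorem embeddingNorm_pos (hab : a < b) [Nonempty (Fin n)] : 0 < embeddingNorm a b n := by
  obtain ⟨c, hc⟩ := exists_ne (0 : E n)
  obtain ⟨y, -, hy⟩ := exists_W hab c (v := 0) MemLp.zero'
  have h0 := left_mem_Icc.mpr hab.le
  have h1 := norm_rep_le hab y h0
  rw [hy a h0] at h1
  simp only [Pi.zero_apply, intervalIntegral.integral_zero, add_zero] at h1
  by_contra hcon
  have := le_antisymm (not_lt.mp hcon) (embeddingNorm_nonneg a b n)
  rw [this, zero_mul] at h1
  exact hc (norm_le_zero_iff.mp h1)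

theorem norm_rep_sub_rep_le (hab : a < b) (y z : W a b n) {t : ℝ} (ht : t ∈ Icc a b) :
    ‖rep y t - rep z t‖ ≤ embeddingNorm a b n * ‖y - z‖ := by
  rw [← rep_sub hab y z ht]
  exact norm_rep_le hab _ ht

end Representatives

/-! ### Integral inequalities and integral equations -/

section IntegralEquations

variable {a b : ℝ}

theorem hasDerivAt_primitive_of_continuousOn {k : ℝ → ℝ} (hk : ContinuousOn k (Icc a b)) {t : ℝ}
    (ht : t ∈ Ioo a b) : HasDerivAt (fun t => ∫ s in a..t, k s) (k t) t := by
  have hab : a ≤ b := (ht.1.trans ht.2).le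
  have hi : IntervalIntegrable k volume a b := hk.intervalIntegrable_of_Icc hab
  refine intervalIntegral.integral_hasDerivAt_right
    (intervalIntegrable_mono_Icc hi (left_mem_Icc.mpr hab) (Ioo_subset_Icc_self ht)) ?_
    (hk.continuousAt (Icc_mem_nhds ht.1 ht.2))
  exact (hk.mono Ioo_subset_Icc_self).stronglyMeasurableAtFilter isOpen_Ioo t ht

/-- Gronwall's inequality in integral form with a continuous coefficient. -/
theorem gronwall_integral {δ : ℝ} {k φ : ℝ → ℝ} (hk : ContinuousOn k (Icc a b))
    (hφ : ContinuousOn φ (Icc a b)) (hk0 : ∀ t ∈ Icc a b, 0 ≤ k t)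
    (h : ∀ t ∈ Icc a b, φ t ≤ δ + ∫ s in a..t, k s * φ s) {t : ℝ} (ht : t ∈ Icc a b) :
    φ t ≤ δ * Real.exp (∫ s in a..t, k s) := by
  have hab : a ≤ b := ht.1.trans ht.2
  set H : ℝ → ℝ := fun t => δ + ∫ s in a..t, k s * φ s with hH
  set K : ℝ → ℝ := fun t => ∫ s in a..t, k s with hK
  have hkφ : ContinuousOn (fun s => k s * φ s) (Icc a b) := hk.mul hφ
  have hHc : ContinuousOn H (Icc a b) :=
    continuousOn_const.add (continuousOn_primitive_Icc hab (hkφ.intervalIntegrable_of_Icc hab))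
  have hKc : ContinuousOn K (Icc a b) :=
    continuousOn_primitive_Icc hab (hk.intervalIntegrable_of_Icc hab)
  have hd : ∀ x ∈ Ioo a b, HasDerivAt (fun t => H t * Real.exp (-K t))
      (k x * φ x * Real.exp (-K x) + H x * (Real.exp (-K x) * (-k x))) x := by
    intro x hx
    have h1 : HasDerivAt H (k x * φ x) x :=
      (hasDerivAt_primitive_of_continuousOn hkφ hx).const_add δ
    have h2 : HasDerivAt K (k x) x := hasDerivAt_primitive_of_continuousOn hk hx
    exact h1.mul h2.neg.exp
  -- Integrating factor: the derivative of `H * exp (-K)` is `k * exp (-K) * (φ - H)`, which is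
  -- nonpositive by the hypothesis `φ ≤ H`.
  have hanti : AntitoneOn (fun t => H t * Real.exp (-K t)) (Icc a b) := by
    refine antitoneOn_of_deriv_nonpos (convex_Icc a b) (hHc.mul hKc.neg.rexp) ?_ ?_
    · rw [interior_Icc]
      exact fun x hx => (hd x hx).differentiableAt.differentiableWithinAt
    · rw [interior_Icc]
      intro x hx
      have hx' := Ioo_subset_Icc_self hx
      rw [(hd x hx).deriv]
      have h1 : k x * φ x * Real.exp (-K x) + H x * (Real.exp (-K x) * -k x)
          = k x * Real.exp (-K x) * (φ x - H x) := by ring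
      rw [h1]
      exact mul_nonpos_of_nonneg_of_nonpos (mul_nonneg (hk0 x hx') (Real.exp_pos _).le)
        (sub_nonpos.mpr (h x hx'))
  have h1 := hanti (left_mem_Icc.mpr hab) ht ht.1
  simp only [hH, hK, intervalIntegral.integral_same, add_zero, neg_zero, Real.exp_zero,
    mul_one] at h1
  have h2 := h t ht
  rw [Real.exp_neg, ← div_eq_mul_inv, div_le_iff₀ (Real.exp_pos _)] at h1
  exact h2.trans h1

theorem reflect_mem_Icc {t : ℝ} (ht : t ∈ Icc a b) : a + b - t ∈ Icc a b :=
  ⟨by linarith [ht.2], by linarith [ht.1]⟩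

/-- Gronwall's inequality, backward in time. -/
theorem gronwall_integral_backward {δ : ℝ} {k φ : ℝ → ℝ} (hk : ContinuousOn k (Icc a b))
    (hφ : ContinuousOn φ (Icc a b)) (hk0 : ∀ t ∈ Icc a b, 0 ≤ k t)
    (h : ∀ t ∈ Icc a b, φ t ≤ δ + ∫ s in t..b, k s * φ s) {t : ℝ} (ht : t ∈ Icc a b) :
    φ t ≤ δ * Real.exp (∫ s in t..b, k s) := by
  have hr : ContinuousOn (fun t => a + b - t) (Icc a b) := by fun_prop
  have hm : MapsTo (fun t => a + b - t) (Icc a b) (Icc a b) := fun t ht => reflect_mem_Icc ht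
  have h1 := gronwall_integral (δ := δ) (hk.comp hr hm) (hφ.comp hr hm)
    (fun t ht => hk0 _ (hm ht)) (fun t ht => ?_) (hm ht)
  · simp only [Function.comp_apply] at h1
    rw [intervalIntegral.integral_comp_sub_left] at h1
    simpa using h1
  · have := h _ (hm ht)
    simp only [Function.comp_apply]
    rw [intervalIntegral.integral_comp_sub_left (fun s => k s * φ s)]
    simpa using this

/-- Global existence for Carathéodory integral equations with a Lipschitz right-hand side. -/
theorem exists_integral_solution {F : Type*} [NormedAddCommGroup F] [NormedSpace ℝ F]
    [CompleteSpace F] (hab : a ≤ b) {G : ℝ → F → F} {K : ℝ} (hK : 0 ≤ K)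
    (hLip : ∀ t ∈ Icc a b, ∀ x x', ‖G t x - G t x'‖ ≤ K * ‖x - x'‖)
    (hint : ∀ Y : ℝ → F, Continuous Y → IntervalIntegrable (fun s => G s (Y s)) volume a b)
    (x₀ : F) : ∃ Y : ℝ → F, Continuous Y ∧
      ∀ t ∈ Icc a b, Y t = x₀ + ∫ s in a..t, G s (Y s) := by
  set κ := K + 1 with hκ
  have hκ0 : 0 < κ := by linarith
  -- The unknown is rescaled by `exp (-2κt)`, which amounts to a weighted maximum norm. In it the
  -- Picard operator contracts by `1/2` on the whole interval, so no continuation from short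
  -- intervals is needed.
  let ext : C(Icc a b, F) → ℝ → F := fun x t => Real.exp (2 * κ * t) • IccExtend hab x t
  have hext : ∀ x, Continuous (ext x) := fun x => by
    have := x.continuous.Icc_extend' (h := hab)
    fun_prop
  have hdist : ∀ x x' t, ‖ext x t - ext x' t‖ ≤ Real.exp (2 * κ * t) * dist x x' := by
    intro x x' t
    simp only [ext]
    rw [← smul_sub, norm_smul, Real.norm_of_nonneg (Real.exp_pos _).le, ← dist_eq_norm]
    exact mul_le_mul_of_nonneg_left (ContinuousMap.dist_apply_le_dist _) (Real.exp_pos _).le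
  have hprim : ∀ x, ContinuousOn (fun t => ∫ s in a..t, G s (ext x s)) (Icc a b) := fun x =>
    continuousOn_primitive_Icc hab (hint _ (hext x))
  let Ψ : C(Icc a b, F) → C(Icc a b, F) := fun x =>
    ⟨fun t => Real.exp (-(2 * κ * t)) • (x₀ + ∫ s in a..(t : ℝ), G s (ext x s)), by
      have h1 : Continuous fun t : Icc a b => ∫ s in a..(t : ℝ), G s (ext x s) :=
        continuousOn_iff_continuous_domRestrict.mp (hprim x)
      fun_prop⟩
  have hΨ : ContractingWith (1 / 2) Ψ := by
    refine ⟨by norm_num, LipschitzWith.of_dist_le_mul fun x x' => ?_⟩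
    rw [ContinuousMap.dist_le (by positivity)]
    rintro ⟨t, ht⟩
    have ha := left_mem_Icc.mpr hab
    have i1 := intervalIntegrable_mono_Icc (hint _ (hext x)) ha ht
    have i2 := intervalIntegrable_mono_Icc (hint _ (hext x')) ha ht
    have e1 : Ψ x ⟨t, ht⟩ - Ψ x' ⟨t, ht⟩
        = Real.exp (-(2 * κ * t)) • ∫ s in a..t, (G s (ext x s) - G s (ext x' s)) := by
      simp only [Ψ, ContinuousMap.coe_mk]
      rw [← smul_sub, add_sub_add_left_eq_sub, intervalIntegral.integral_sub i1 i2]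
    have e2 : ‖∫ s in a..t, (G s (ext x s) - G s (ext x' s))‖
        ≤ ∫ s in a..t, κ * (Real.exp (2 * κ * s) * dist x x') := by
      refine intervalIntegral.norm_integral_le_of_norm_le ht.1 ?_
        (Continuous.intervalIntegrable (by fun_prop) _ _)
      refine Eventually.of_forall fun s hs => ?_
      refine (hLip s ⟨hs.1.le, hs.2.trans ht.2⟩ _ _).trans ?_
      exact mul_le_mul (by linarith) (hdist x x' s) (norm_nonneg _) hκ0.le
    have e3 : ∫ s in a..t, κ * (Real.exp (2 * κ * s) * dist x x')
        = (Real.exp (2 * κ * t) - Real.exp (2 * κ * a)) / 2 * dist x x' := by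
      have hd : ∀ s ∈ uIcc a t, HasDerivAt (fun s => Real.exp (2 * κ * s) / 2 * dist x x')
          (κ * (Real.exp (2 * κ * s) * dist x x')) s := by
        intro s _
        have h1 : HasDerivAt (fun s : ℝ => 2 * κ * s) (2 * κ) s := by
          simpa using (hasDerivAt_id s).const_mul (2 * κ)
        have h2 := (h1.exp.div_const 2).mul_const (dist x x')
        exact h2.congr_deriv (by ring)
      rw [intervalIntegral.integral_eq_sub_of_hasDerivAt hd
        (Continuous.intervalIntegrable (by fun_prop) _ _)]
      ring
    rw [dist_eq_norm, e1, norm_smul, Real.norm_of_nonneg (Real.exp_pos _).le]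
    have e4 : ‖∫ s in a..t, (G s (ext x s) - G s (ext x' s))‖
        ≤ Real.exp (2 * κ * t) * (1 / 2 * dist x x') := by
      refine e2.trans ?_
      rw [e3]
      have := Real.exp_pos (2 * κ * a)
      have := dist_nonneg (x := x) (y := x')
      nlinarith
    calc _ ≤ Real.exp (-(2 * κ * t)) * (Real.exp (2 * κ * t) * (1 / 2 * dist x x')) :=
          mul_le_mul_of_nonneg_left e4 (Real.exp_pos _).le
      _ = 1 / 2 * dist x x' := by
          rw [← mul_assoc, ← Real.exp_add, neg_add_cancel, Real.exp_zero, one_mul]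
      _ = _ := by simp
  have hne : Nonempty C(Icc a b, F) := ⟨ContinuousMap.const _ 0⟩
  refine ⟨ext (hΨ.fixedPoint Ψ), hext _, fun t ht => ?_⟩
  have hfix : Ψ (hΨ.fixedPoint Ψ) = hΨ.fixedPoint Ψ := hΨ.fixedPoint_isFixedPt
  have h1 : ext (hΨ.fixedPoint Ψ) t = Real.exp (2 * κ * t) • (Ψ (hΨ.fixedPoint Ψ)) ⟨t, ht⟩ := by
    rw [hfix]
    simp only [ext]
    rw [IccExtend_of_mem hab _ ht]
  rw [h1]
  simp only [Ψ, ContinuousMap.coe_mk]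
  rw [smul_smul, ← Real.exp_add, add_neg_cancel, Real.exp_zero, one_smul]

theorem exists_integral_solution_backward {F : Type*} [NormedAddCommGroup F] [NormedSpace ℝ F]
    [CompleteSpace F] (hab : a ≤ b) {G : ℝ → F → F} {K : ℝ} (hK : 0 ≤ K)
    (hLip : ∀ t ∈ Icc a b, ∀ x x', ‖G t x - G t x'‖ ≤ K * ‖x - x'‖)
    (hint : ∀ Y : ℝ → F, Continuous Y → IntervalIntegrable (fun s => G s (Y s)) volume a b)
    (x₁ : F) : ∃ Y : ℝ → F, Continuous Y ∧
      ∀ t ∈ Icc a b, Y t = x₁ + ∫ s in t..b, G s (Y s) := by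
  have hint' : ∀ Y : ℝ → F, Continuous Y →
      IntervalIntegrable (fun s => G (a + b - s) (Y s)) volume a b := by
    intro Y hY
    have h1 := (hint (fun t => Y (a + b - t)) (by fun_prop)).comp_sub_left (a + b)
    simp only [sub_sub_cancel, add_sub_cancel_left, add_sub_cancel_right] at h1
    exact h1.symm
  obtain ⟨Z, hZ, hZe⟩ := exists_integral_solution hab (G := fun s => G (a + b - s)) hK
    (fun t ht => hLip _ (reflect_mem_Icc ht)) hint' x₁
  refine ⟨fun t => Z (a + b - t), by fun_prop, fun t ht => ?_⟩
  have := intervalIntegral.integral_comp_sub_left (a := t) (b := b)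
    (fun s => G (a + b - s) (Z s)) (a + b)
  simp only [sub_sub_cancel, add_sub_cancel_right] at this
  simp only [hZe _ (reflect_mem_Icc ht)]
  rw [← this]

/-- The radial retraction onto the closed ball of radius `r`. -/
def ballRetract {F : Type*} [NormedAddCommGroup F] [NormedSpace ℝ F] (r : ℝ) (x : F) : F :=
  (r / max r ‖x‖) • x

section Retract

variable {F : Type*} [NormedAddCommGroup F] [NormedSpace ℝ F] {r : ℝ}

theorem ballRetract_mem (hr : 0 ≤ r) (x : F) : ballRetract r x ∈ Metric.closedBall (0 : F) r := by
  rw [mem_closedBall_zero_iff, ballRetract, norm_smul, Real.norm_of_nonneg (by positivity)]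
  rcases hr.eq_or_lt with h | h
  · simp [← h]
  · have h1 : 0 < max r ‖x‖ := lt_max_of_lt_left h
    rw [div_mul_eq_mul_div, div_le_iff₀ h1]
    exact mul_le_mul_of_nonneg_left (le_max_right _ _) hr

theorem ballRetract_eq_self {x : F} (hx : ‖x‖ ≤ r) : ballRetract r x = x := by
  rcases ((norm_nonneg x).trans hx).eq_or_lt with h | h
  · have : x = 0 := norm_le_zero_iff.mp (h ▸ hx)
    simp [ballRetract, this]
  · rw [ballRetract, max_eq_left hx, div_self h.ne', one_smul]

/-- The difference is `(r / max r ‖x‖) • (x - y)` plus the change of the scaling factor times `y`,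
and each summand is bounded by `‖x - y‖`. The constant `2` is valid in every normed space. -/
theorem norm_ballRetract_sub_le (hr : 0 ≤ r) (x y : F) :
    ‖ballRetract r x - ballRetract r y‖ ≤ 2 * ‖x - y‖ := by
  rcases hr.eq_or_lt with h | h
  · simp [ballRetract, ← h]
  have hA : 0 < max r ‖x‖ := lt_max_of_lt_left h
  have hB : 0 < max r ‖y‖ := lt_max_of_lt_left h
  have e : ballRetract r x - ballRetract r y
      = (r / max r ‖x‖) • (x - y) + (r / max r ‖x‖ - r / max r ‖y‖) • y := by
    simp only [ballRetract]; rw [smul_sub, sub_smul]; abel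
  have h1 : r / max r ‖x‖ ≤ 1 := (div_le_one hA).mpr (le_max_left _ _)
  have h2 : |r / max r ‖x‖ - r / max r ‖y‖| * ‖y‖ ≤ ‖x - y‖ := by
    have e2 : r / max r ‖x‖ - r / max r ‖y‖
        = r / max r ‖x‖ * (max r ‖y‖ - max r ‖x‖) / max r ‖y‖ := by field_simp
    rw [e2, abs_div, abs_mul, abs_of_pos hB, abs_of_nonneg (by positivity : 0 ≤ r / max r ‖x‖),
      div_mul_eq_mul_div, div_le_iff₀ hB]
    have h3 : |max r ‖y‖ - max r ‖x‖| ≤ ‖x - y‖ := by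
      have h4 := abs_max_sub_max_le_abs ‖y‖ ‖x‖ r
      rw [max_comm r, max_comm r]
      exact h4.trans ((abs_norm_sub_norm_le y x).trans_eq (norm_sub_rev _ _))
    calc _ ≤ 1 * ‖x - y‖ * ‖y‖ := by gcongr
      _ ≤ ‖x - y‖ * max r ‖y‖ := by
        rw [one_mul]; exact mul_le_mul_of_nonneg_left (le_max_right _ _) (norm_nonneg _)
  rw [e]
  refine (norm_add_le _ _).trans ?_
  rw [norm_smul, norm_smul, Real.norm_of_nonneg (by positivity), Real.norm_eq_abs]
  have h5 := mul_le_mul_of_nonneg_right h1 (norm_nonneg (x - y))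
  linarith

theorem continuous_ballRetract (hr : 0 ≤ r) : Continuous (ballRetract r : F → F) := by
  refine (LipschitzWith.of_dist_le_mul (K := 2) fun x y => ?_).continuous
  rw [dist_eq_norm, dist_eq_norm]
  exact norm_ballRetract_sub_le hr x y

end Retract

/-- An integral equation whose right-hand side is close to that of a given curve in a ball has a
solution close to this curve. -/
theorem exists_tracking_solution {F : Type*} [NormedAddCommGroup F] [NormedSpace ℝ F]
    [CompleteSpace F] (hab : a ≤ b) {r η η' K : ℝ} (hr : 0 ≤ r) (hη : 0 ≤ η)
    (hK : 0 ≤ K) {H : ℝ → F → F}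
    (hHc : ContinuousOn (fun x : ℝ × F => H x.1 x.2) (Icc a b ×ˢ Metric.closedBall 0 r))
    {K' : ℝ} (hHL : ∀ t ∈ Icc a b, ∀ x ∈ Metric.closedBall (0 : F) r,
      ∀ x' ∈ Metric.closedBall (0 : F) r, ‖H t x - H t x'‖ ≤ K' * ‖x - x'‖)
    {Y₀ : ℝ → F} (hY₀ : ContinuousOn Y₀ (Icc a b)) {H₀ : ℝ → F}
    (hH₀ : IntervalIntegrable H₀ volume a b)
    (hY₀e : ∀ t ∈ Icc a b, Y₀ t = Y₀ a + ∫ s in a..t, H₀ s) (hY₀r : ∀ t ∈ Icc a b, ‖Y₀ t‖ ≤ r)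
    (hclose : ∀ t ∈ Icc a b, ∀ x ∈ Metric.closedBall (0 : F) r,
      ‖H t x - H₀ t‖ ≤ η + K * ‖x - Y₀ t‖)
    {x₀ : F} (hx₀ : ‖x₀ - Y₀ a‖ ≤ η')
    (hsmall : ∀ t ∈ Icc a b, ∀ x : F,
      ‖x - Y₀ t‖ ≤ (η' + η * (b - a)) * Real.exp (2 * K * (b - a)) → ‖x‖ ≤ r) :
    ∃ Y : ℝ → F, Continuous Y ∧ ∀ t ∈ Icc a b, ‖Y t‖ ≤ r ∧
      ‖Y t - Y₀ t‖ ≤ (η' + η * (b - a)) * Real.exp (2 * K * (b - a)) ∧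
      Y t = x₀ + ∫ s in a..t, H s (Y s) := by
  have hη' : 0 ≤ η' := (norm_nonneg _).trans hx₀
  have hcomp : ∀ Y : ℝ → F, Continuous Y →
      ContinuousOn (fun s => H s (ballRetract r (Y s))) (Icc a b) := by
    intro Y hY
    have h1 : Continuous fun s => (s, ballRetract r (Y s)) :=
      continuous_id.prodMk ((continuous_ballRetract hr).comp hY)
    exact hHc.comp h1.continuousOn fun s hs => ⟨hs, ballRetract_mem hr _⟩
  -- The right-hand side composed with the retraction is globally Lipschitz, so a solution exists on
  -- all of `[a,b]`. The constant `K'` serves only this purpose and does not enter the final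
  -- estimate.
  obtain ⟨Y, hY, hYe⟩ := exists_integral_solution hab (G := fun s x => H s (ballRetract r x))
    (K := |K'| * 2) (by positivity) (fun t ht x x' => by
      refine (hHL t ht _ (ballRetract_mem hr x) _ (ballRetract_mem hr x')).trans ?_
      rw [mul_assoc]
      exact mul_le_mul (le_abs_self _) (norm_ballRetract_sub_le hr x x') (norm_nonneg _)
        (abs_nonneg _))
    (fun Y hY => (hcomp Y hY).intervalIntegrable_of_Icc hab) x₀
  have ha := left_mem_Icc.mpr hab
  have hiY := (hcomp Y hY).intervalIntegrable_of_Icc (μ := volume) hab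
  have hφc : ContinuousOn (fun t => ‖Y t - Y₀ t‖) (Icc a b) := (hY.continuousOn.sub hY₀).norm
  have hgr : ∀ t ∈ Icc a b,
      ‖Y t - Y₀ t‖ ≤ (η' + η * (b - a)) + ∫ s in a..t, 2 * K * ‖Y s - Y₀ s‖ := by
    intro t ht
    have i1 := intervalIntegrable_mono_Icc hiY ha ht
    have i2 := intervalIntegrable_mono_Icc hH₀ ha ht
    have i3 : IntervalIntegrable (fun s => 2 * K * ‖Y s - Y₀ s‖) volume a t :=
      intervalIntegrable_mono_Icc
        ((continuousOn_const.mul hφc).intervalIntegrable_of_Icc hab) ha ht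
    have e1 : Y t - Y₀ t = (x₀ - Y₀ a) + ∫ s in a..t, (H s (ballRetract r (Y s)) - H₀ s) := by
      rw [intervalIntegral.integral_sub i1 i2, hYe t ht, hY₀e t ht]; abel
    have e2 : ‖∫ s in a..t, (H s (ballRetract r (Y s)) - H₀ s)‖
        ≤ ∫ s in a..t, (η + 2 * K * ‖Y s - Y₀ s‖) := by
      refine intervalIntegral.norm_integral_le_of_norm_le ht.1 ?_ (by simp [i3])
      refine Eventually.of_forall fun s hs => ?_
      have hs' : s ∈ Icc a b := ⟨hs.1.le, hs.2.trans ht.2⟩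
      refine (hclose s hs' _ (ballRetract_mem hr _)).trans ?_
      -- The curve `Y₀` is fixed by the retraction, whose Lipschitz constant produces the factor `2
      -- * K` in the exponent.
      have h1 := norm_ballRetract_sub_le hr (Y s) (Y₀ s)
      rw [ballRetract_eq_self (hY₀r s hs')] at h1
      have := mul_le_mul_of_nonneg_left h1 hK
      linarith
    rw [intervalIntegral.integral_add (by simp) i3, intervalIntegral.integral_const,
      smul_eq_mul] at e2
    rw [e1]
    refine (norm_add_le _ _).trans ?_
    have h3 : (t - a) * η ≤ η * (b - a) := by nlinarith [ht.2]
    linarith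
  have hb : ∀ t ∈ Icc a b,
      ‖Y t - Y₀ t‖ ≤ (η' + η * (b - a)) * Real.exp (2 * K * (b - a)) := by
    intro t ht
    refine (gronwall_integral continuousOn_const hφc (fun _ _ => by positivity) hgr ht).trans ?_
    rw [intervalIntegral.integral_const, smul_eq_mul]
    have h1 : 0 ≤ η' + η * (b - a) := by
      have := mul_nonneg hη (sub_nonneg.mpr hab); linarith
    refine mul_le_mul_of_nonneg_left (Real.exp_le_exp.mpr ?_) h1
    nlinarith [ht.2]
  -- The Gronwall bound and `hsmall` show that the solution never leaves the ball, so the retraction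
  -- acts as the identity along it and the original equation holds.
  refine ⟨Y, hY, fun t ht => ⟨hsmall t ht _ (hb t ht), hb t ht, ?_⟩⟩
  rw [hYe t ht]
  congr 1
  apply intervalIntegral.integral_congr
  intro s hs
  rw [uIcc_of_le ht.1] at hs
  have hs' : s ∈ Icc a b := ⟨hs.1, hs.2.trans ht.2⟩
  simp only [ballRetract_eq_self (hsmall s hs' _ (hb s hs'))]

theorem mul_sub_mul_eq_integral (hab : a ≤ b) {p d w v : ℝ → ℝ}
    (hw : IntervalIntegrable w volume a b) (hv : IntervalIntegrable v volume a b)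
    (hp : ∀ t ∈ Icc a b, p t = p a + ∫ s in a..t, w s)
    (hd : ∀ t ∈ Icc a b, d t = d a + ∫ s in a..t, v s) :
    p b * d b - p a * d a = ∫ s in a..b, (w s * d s + p s * v s) := by
  set p' : ℝ → ℝ := fun t => p a + ∫ s in a..t, w s
  set d' : ℝ → ℝ := fun t => d a + ∫ s in a..t, v s
  have hconst : ∀ c : ℝ, AbsolutelyContinuousOnInterval (fun _ : ℝ => c) a b := fun c =>
    ContDiffOn.absolutelyContinuousOnInterval contDiffOn_const
  have h1 : AbsolutelyContinuousOnInterval p' a b := (hconst (p a)).add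
    (hw.absolutelyContinuousOnInterval_intervalIntegral (c := a) (by simp))
  have h2 : AbsolutelyContinuousOnInterval d' a b := (hconst (d a)).add
    (hv.absolutelyContinuousOnInterval_intervalIntegral (c := a) (by simp))
  have h3 := AbsolutelyContinuousOnInterval.integral_deriv_mul_eq_sub h1 h2
  rw [hp b (right_mem_Icc.mpr hab), hd b (right_mem_Icc.mpr hab)]
  have e1 : p' a = p a := by simp [p']
  have e2 : d' a = d a := by simp [d']
  rw [e1, e2] at h3
  rw [← h3]
  apply intervalIntegral.integral_congr_ae
  filter_upwards [hw.ae_hasDerivAt_integral, hv.ae_hasDerivAt_integral] with x hx1 hx2 hx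
  have hx' : x ∈ Icc a b := by rw [uIoc_of_le hab] at hx; exact Ioc_subset_Icc_self hx
  have hxu := uIoc_subset_uIcc hx
  have d1 : deriv p' x = w x := ((hx1 hxu a (by simp)).const_add (p a)).deriv
  have d2 : deriv d' x = v x := ((hx2 hxu a (by simp)).const_add (d a)).deriv
  rw [d1, d2, hp x hx', hd x hx']

/-- Integration by parts for absolutely continuous curves, coordinate by coordinate. It pairs an
adjoint state with the difference of two trajectories. -/
theorem inner_sub_inner_eq_integral {n : ℕ} (hab : a ≤ b) {p d w v : ℝ → E n}
    (hw : IntervalIntegrable w volume a b) (hv : IntervalIntegrable v volume a b)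
    (hp : ∀ t ∈ Icc a b, p t = p a + ∫ s in a..t, w s)
    (hd : ∀ t ∈ Icc a b, d t = d a + ∫ s in a..t, v s) :
    inner ℝ (p b) (d b) - inner ℝ (p a) (d a)
      = ∫ s in a..b, (inner ℝ (w s) (d s) + inner ℝ (p s) (v s)) := by
  have ha := left_mem_Icc.mpr hab
  have hcoord : ∀ {z : ℝ → E n}, IntervalIntegrable z volume a b → ∀ i,
      IntervalIntegrable (fun s => z s i) volume a b := fun hz i =>
    ⟨(EuclideanSpace.proj (𝕜 := ℝ) i).integrable_comp hz.1,
      (EuclideanSpace.proj (𝕜 := ℝ) i).integrable_comp hz.2⟩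
  have hcont : ∀ {q z : ℝ → E n}, IntervalIntegrable z volume a b →
      (∀ t ∈ Icc a b, q t = q a + ∫ s in a..t, z s) → ∀ i,
      (∀ t ∈ Icc a b, q t i = q a i + ∫ s in a..t, z s i) ∧
        ContinuousOn (fun t => q t i) (uIcc a b) := by
    intro q z hz hq i
    have h1 : ∀ t ∈ Icc a b, q t i = q a i + ∫ s in a..t, z s i := by
      intro t ht
      rw [hq t ht, PiLp.add_apply, intervalIntegral_apply (intervalIntegrable_mono_Icc hz ha ht)]
    refine ⟨h1, ?_⟩
    rw [uIcc_of_le hab]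
    exact (continuousOn_const.add (continuousOn_primitive_Icc hab (hcoord hz i))).congr h1
  simp only [PiLp.inner_apply, RCLike.inner_apply, conj_trivial]
  rw [← Finset.sum_sub_distrib]
  have e : ∀ s, (∑ i, d s i * w s i + ∑ i, v s i * p s i)
      = ∑ i, (w s i * d s i + p s i * v s i) := fun s => by
    rw [← Finset.sum_add_distrib]
    exact Finset.sum_congr rfl fun i _ => by ring
  simp only [e]
  rw [intervalIntegral.integral_finsetSum]
  · refine Finset.sum_congr rfl fun i _ => ?_
    rw [← mul_sub_mul_eq_integral hab (hcoord hw i) (hcoord hv i) (hcont hw hp i).1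
      (hcont hv hd i).1]
    ring
  · intro i _
    exact ((hcoord hw i).mul_continuousOn (hcont hv hd i).2).add
      ((hcoord hv i).continuousOn_mul (hcont hw hp i).2)

end IntegralEquations

/-! ### Slices of functions of time and state -/

section Slices

variable {n : ℕ} {F : Type*} [NormedAddCommGroup F] [NormedSpace ℝ F]

theorem hasFDerivWithinAt_slice {T : ℝ} {S : Set (E n)} {h : ℝ → E n → F}
    (hh : ContDiffOn ℝ 2 (fun x : ℝ × E n => h x.1 x.2) (Icc 0 T ×ˢ S)) {t : ℝ}
    (ht : t ∈ Icc 0 T) {y : E n} (hy : y ∈ S) :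
    HasFDerivWithinAt (h t) ((fderivWithin ℝ (fun x : ℝ × E n => h x.1 x.2) (Icc 0 T ×ˢ S)
      (t, y)).comp (ContinuousLinearMap.inr ℝ ℝ (E n))) S y := by
  have h1 := (hh.differentiableOn (by norm_num) (t, y) ⟨ht, hy⟩).hasFDerivWithinAt
  have h2 : HasFDerivWithinAt (fun z : E n => (t, z)) (ContinuousLinearMap.inr ℝ ℝ (E n)) S y :=
    (hasFDerivAt_prodMk_right t y).hasFDerivWithinAt
  exact h1.comp y h2 fun z hz => ⟨ht, hz⟩

theorem continuousOn_fderivWithin_slice {T : ℝ} (hT : 0 < T) {S : Set (E n)}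
    (hS : UniqueDiffOn ℝ S) {h : ℝ → E n → F}
    (hh : ContDiffOn ℝ 2 (fun x : ℝ × E n => h x.1 x.2) (Icc 0 T ×ˢ S)) :
    ContinuousOn (fun x : ℝ × E n => fderivWithin ℝ (h x.1) S x.2) (Icc 0 T ×ˢ S) := by
  have h1 := hh.continuousOn_fderivWithin ((uniqueDiffOn_Icc hT).prod hS) (by norm_num)
  have h2 := h1.clm_comp (continuousOn_const (c := ContinuousLinearMap.inr ℝ ℝ (E n)))
  refine h2.congr ?_
  rintro ⟨t, y⟩ ⟨ht, hy⟩
  exact (hasFDerivWithinAt_slice hh ht hy).fderivWithin (hS y hy)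

theorem differentiable_slice {T : ℝ} {h : ℝ → E n → F}
    (hh : ContDiffOn ℝ 2 (fun x : ℝ × E n => h x.1 x.2) (Icc 0 T ×ˢ univ)) {t : ℝ}
    (ht : t ∈ Icc 0 T) : Differentiable ℝ (h t) := fun y =>
  (hasFDerivWithinAt_univ.mp (hasFDerivWithinAt_slice hh ht (mem_univ y))).differentiableAt

theorem continuousOn_fderiv_slice {T : ℝ} (hT : 0 < T) {h : ℝ → E n → F}
    (hh : ContDiffOn ℝ 2 (fun x : ℝ × E n => h x.1 x.2) (Icc 0 T ×ˢ univ)) :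
    ContinuousOn (fun x : ℝ × E n => fderiv ℝ (h x.1) x.2) (Icc 0 T ×ˢ univ) := by
  simpa only [fderivWithin_univ] using continuousOn_fderivWithin_slice hT uniqueDiffOn_univ hh

/-- Uniform bounds for `h`, its derivative in the state, their Lipschitz constants and the first
order Taylor remainder on the closed ball of radius `R`. -/
structure SliceBounds (T R C : ℝ) (h : ℝ → E n → F) : Prop where
  norm_le : ∀ t ∈ Icc 0 T, ∀ x, ‖x‖ ≤ R → ‖h t x‖ ≤ C
  norm_fderiv_le : ∀ t ∈ Icc 0 T, ∀ x, ‖x‖ ≤ R → ‖fderiv ℝ (h t) x‖ ≤ C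
  lip : ∀ t ∈ Icc 0 T, ∀ x x', ‖x‖ ≤ R → ‖x'‖ ≤ R → ‖h t x - h t x'‖ ≤ C * ‖x - x'‖
  fderiv_lip : ∀ t ∈ Icc 0 T, ∀ x x', ‖x‖ ≤ R → ‖x'‖ ≤ R →
    ‖fderiv ℝ (h t) x - fderiv ℝ (h t) x'‖ ≤ C * ‖x - x'‖
  taylor : ∀ t ∈ Icc 0 T, ∀ x x', ‖x‖ ≤ R → ‖x'‖ ≤ R →
    ‖h t x - h t x' - fderiv ℝ (h t) x' (x - x')‖ ≤ C * ‖x - x'‖ ^ 2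

theorem SliceBounds.mono {T R C C' : ℝ} {h : ℝ → E n → F} (H : SliceBounds T R C h)
    (hC : C ≤ C') : SliceBounds T R C' h where
  norm_le t ht x hx := (H.norm_le t ht x hx).trans hC
  norm_fderiv_le t ht x hx := (H.norm_fderiv_le t ht x hx).trans hC
  lip t ht x x' hx hx' := (H.lip t ht x x' hx hx').trans (by gcongr)
  fderiv_lip t ht x x' hx hx' := (H.fderiv_lip t ht x x' hx hx').trans (by gcongr)
  taylor t ht x x' hx hx' := (H.taylor t ht x x' hx hx').trans (by gcongr)

theorem exists_sliceBounds {T : ℝ} (hT : 0 < T) {h : ℝ → E n → F}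
    (hh : ContDiffOn ℝ 2 (fun x : ℝ × E n => h x.1 x.2) (Icc 0 T ×ˢ univ))
    (hL : ControlProblem.LipschitzDerivatives T h) (R : ℝ) : ∃ C, SliceBounds T R C h := by
  have hcpt : IsCompact (Icc 0 T ×ˢ Metric.closedBall (0 : E n) R) :=
    isCompact_Icc.prod (isCompact_closedBall _ _)
  have hsub : Icc 0 T ×ˢ Metric.closedBall (0 : E n) R ⊆ Icc 0 T ×ˢ univ :=
    prod_mono subset_rfl (subset_univ _)
  obtain ⟨C₁, hC₁⟩ := hcpt.exists_bound_of_continuousOn (hh.continuousOn.mono hsub)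
  obtain ⟨C₂, hC₂⟩ :=
    hcpt.exists_bound_of_continuousOn ((continuousOn_fderiv_slice hT hh).mono hsub)
  obtain ⟨L, hL⟩ := hL _ (isCompact_closedBall (0 : E n) R)
  have hfl : ∀ t ∈ Icc 0 T, ∀ x x' : E n, ‖x‖ ≤ R → ‖x'‖ ≤ R →
      ‖fderiv ℝ (h t) x - fderiv ℝ (h t) x'‖ ≤ L * ‖x - x'‖ := by
    intro t ht x x' hx hx'
    have := (hL t ht).1.dist_le_mul x (by simpa using hx) x' (by simpa using hx')
    rwa [dist_eq_norm, dist_eq_norm] at this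
  refine ⟨max C₁ (max C₂ L), ?_, ?_, ?_, ?_, ?_⟩
  · intro t ht x hx
    exact (hC₁ (t, x) ⟨ht, by simpa using hx⟩).trans (le_max_left _ _)
  · intro t ht x hx
    exact (hC₂ (t, x) ⟨ht, by simpa using hx⟩).trans
      ((le_max_left _ _).trans (le_max_right _ _))
  · intro t ht x x' hx hx'
    refine ((convex_closedBall (0 : E n) R).norm_image_sub_le_of_norm_fderiv_le (𝕜 := ℝ) (C := C₂)
      (fun z _ => differentiable_slice hh ht z)
      (fun z hz => hC₂ (t, z) ⟨ht, hz⟩) (by simpa using hx') (by simpa using hx)).trans ?_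
    gcongr
    exact (le_max_left _ _).trans (le_max_right _ _)
  · intro t ht x x' hx hx'
    refine (hfl t ht x x' hx hx').trans ?_
    gcongr
    exact (le_max_right _ _).trans (le_max_right _ _)
  · intro t ht x x' hx hx'
    have hseg : segment ℝ x' x ⊆ Metric.closedBall (0 : E n) R :=
      (convex_closedBall (0 : E n) R).segment_subset (by simpa using hx') (by simpa using hx)
    -- Mean value inequality for `h t` minus its linearization at `x'`: along the segment the
    -- derivative differs from that at `x'` by at most `L * ‖x - x'‖`, which gives the quadratic
    -- remainder.
    have h1 := (convex_segment x' x).norm_image_sub_le_of_norm_hasFDerivWithin_le' (𝕜 := ℝ)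
      (f := h t) (φ := fderiv ℝ (h t) x') (C := L * ‖x - x'‖)
      (fun z _ => (differentiable_slice hh ht z).hasFDerivAt.hasFDerivWithinAt)
      (fun z hz => by
        have hz' : ‖z‖ ≤ R := by simpa using hseg hz
        refine (hfl t ht z x' hz' hx').trans ?_
        gcongr
        obtain ⟨θ, hθ, rfl⟩ := (segment_eq_image' ℝ x' x ▸ hz : z ∈ _ '' Icc (0 : ℝ) 1)
        rw [add_sub_cancel_left, norm_smul, Real.norm_of_nonneg hθ.1]
        exact mul_le_of_le_one_left (norm_nonneg _) hθ.2)
      (left_mem_segment ℝ x' x) (right_mem_segment ℝ x' x)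
    refine h1.trans ?_
    rw [mul_assoc, ← sq]
    gcongr
    exact (le_max_right _ _).trans (le_max_right _ _)

end Slices

/-! ### Uniform bounds for the dynamics and the value function on balls -/

namespace ControlProblem

variable {n m : ℕ} {P : ControlProblem n m} {Y₀ : Set (E n)} {M : ℝ}

/-- Common bounds for the dynamics on the closed ball of radius `R`. -/
structure DynamicsBounds (P : ControlProblem n m) (R C : ℝ) : Prop where
  nonneg : 0 ≤ C
  f : SliceBounds P.T R C P.f
  g : SliceBounds P.T R C P.g

theorem FeedbackAssumption.exists_dynamicsBounds (hP : P.FeedbackAssumption Y₀ M) (R : ℝ) :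
    ∃ C, P.DynamicsBounds R C := by
  obtain ⟨C₁, h₁⟩ := exists_sliceBounds P.T_pos hP.f_smooth hP.f_lipschitz R
  obtain ⟨C₂, h₂⟩ := exists_sliceBounds P.T_pos hP.g_smooth hP.g_lipschitz R
  exact ⟨max 0 (max C₁ C₂), le_max_left _ _,
    h₁.mono ((le_max_left _ _).trans (le_max_right _ _)),
    h₂.mono ((le_max_right _ _).trans (le_max_right _ _))⟩

theorem FeedbackAssumption.radius_nonneg (hP : P.FeedbackAssumption Y₀ M) : 0 ≤ P.radius M := by
  have := embeddingNorm_nonneg 0 P.T n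
  have := hP.M_pos
  unfold radius
  positivity

/-- Derivatives within the ball are unique once its radius is positive. The radius can vanish only
for `n = 0`, where assertions about `E n` are trivial; this explains the case distinctions below. -/
theorem FeedbackAssumption.subsingleton_or_radius_pos (hP : P.FeedbackAssumption Y₀ M) :
    Subsingleton (E n) ∨ 0 < P.radius M := by
  rcases isEmpty_or_nonempty (Fin n) with h | h
  · left
    infer_instance
  · right
    have := embeddingNorm_pos (n := n) P.T_pos
    have := hP.M_pos
    unfold radius
    positivity

theorem uniqueDiffOn_closedBall {r : ℝ} (hr : 0 < r) :
    UniqueDiffOn ℝ (Metric.closedBall (0 : E n) r) :=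
  uniqueDiffOn_convex (convex_closedBall _ _)
    ⟨0, Metric.ball_subset_interior_closedBall (Metric.mem_ball_self hr)⟩

/-- The gradient of the value function on the ball, as a linear form. -/
def valueGrad (P : ControlProblem n m) (M t : ℝ) (y : E n) : E n →L[ℝ] ℝ :=
  ballGrad (P.radius M) (P.valueFunction t) y

theorem FeedbackAssumption.continuousOn_valueGrad (hP : P.FeedbackAssumption Y₀ M) :
    ContinuousOn (fun x : ℝ × E n => P.valueGrad M x.1 x.2)
      (Icc 0 P.T ×ˢ Metric.closedBall 0 (P.radius M)) := by
  rcases hP.subsingleton_or_radius_pos with h | h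
  · exact continuousOn_const.congr (f := fun _ => (0 : E n →L[ℝ] ℝ))
      fun _ _ => Subsingleton.elim _ _
  · exact continuousOn_fderivWithin_slice P.T_pos (uniqueDiffOn_closedBall h) hP.value_smooth

theorem FeedbackAssumption.exists_valueGrad_lip (hP : P.FeedbackAssumption Y₀ M) :
    ∃ L, 0 ≤ L ∧ ∀ t ∈ Icc 0 P.T, ∀ x x' : E n, ‖x‖ ≤ P.radius M → ‖x'‖ ≤ P.radius M →
      ‖P.valueGrad M t x - P.valueGrad M t x'‖ ≤ L * ‖x - x'‖ := by
  obtain ⟨L, hL⟩ := hP.value_lipschitz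
  refine ⟨L, L.2, fun t ht x x' hx hx' => ?_⟩
  have := (hL t ht).1.dist_le_mul x (by simpa using hx) x' (by simpa using hx')
  rwa [dist_eq_norm, dist_eq_norm] at this

theorem FeedbackAssumption.exists_valueGrad_bound (hP : P.FeedbackAssumption Y₀ M) :
    ∃ C, 0 ≤ C ∧ ∀ t ∈ Icc 0 P.T, ∀ x : E n, ‖x‖ ≤ P.radius M → ‖P.valueGrad M t x‖ ≤ C := by
  obtain ⟨C, hC⟩ := (isCompact_Icc.prod (isCompact_closedBall _ _)).exists_bound_of_continuousOn
    hP.continuousOn_valueGrad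
  exact ⟨max 0 C, le_max_left _ _, fun t ht x hx =>
    (hC (t, x) ⟨ht, by simpa using hx⟩).trans (le_max_right _ _)⟩

theorem FeedbackAssumption.differentiableOn_value (hP : P.FeedbackAssumption Y₀ M) {t : ℝ}
    (ht : t ∈ Icc 0 P.T) :
    DifferentiableOn ℝ (P.valueFunction t) (Metric.closedBall 0 (P.radius M)) := fun _ hy =>
  (hasFDerivWithinAt_slice hP.value_smooth ht hy).differentiableWithinAt

theorem FeedbackAssumption.exists_value_lip (hP : P.FeedbackAssumption Y₀ M) :
    ∃ L, 0 ≤ L ∧ ∀ t ∈ Icc 0 P.T, ∀ x x' : E n, ‖x‖ ≤ P.radius M → ‖x'‖ ≤ P.radius M →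
      ‖P.valueFunction t x - P.valueFunction t x'‖ ≤ L * ‖x - x'‖ := by
  obtain ⟨C, hC, hb⟩ := hP.exists_valueGrad_bound
  refine ⟨C, hC, fun t ht x x' hx hx' => ?_⟩
  exact (convex_closedBall (0 : E n) (P.radius M)).norm_image_sub_le_of_norm_fderivWithin_le
    (𝕜 := ℝ) (hP.differentiableOn_value ht) (fun z hz => hb t ht z (by simpa using hz))
    (by simpa using hx') (by simpa using hx)

/-- Points of the half ball are interior when the radius is positive, so the derivative within the
ball is an ordinary derivative there. Optimal trajectories run in the half ball, and `feedback` is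
defined by the ordinary gradient. -/
theorem FeedbackAssumption.hasFDerivAt_value (hP : P.FeedbackAssumption Y₀ M) {t : ℝ}
    (ht : t ∈ Icc 0 P.T) {y : E n} (hy : ‖y‖ ≤ P.radius M / 2) :
    HasFDerivAt (P.valueFunction t) (P.valueGrad M t y) y := by
  rcases hP.subsingleton_or_radius_pos with h | h
  · exact hasFDerivAt_of_subsingleton _ _ |>.congr_fderiv (Subsingleton.elim _ _)
  · have hmem : Metric.closedBall 0 (P.radius M) ∈ 𝓝 y :=
      Filter.mem_of_superset (Metric.isOpen_ball.mem_nhds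
        (by rw [mem_ball_zero_iff]; linarith)) Metric.ball_subset_closedBall
    exact ((hP.differentiableOn_value ht) y (mem_of_mem_nhds hmem)).hasFDerivWithinAt.hasFDerivAt
      hmem

/-- The approximation assumption speaks of the derivative of a difference within the ball; this form
separates the ordinary derivative of the smooth approximation from the gradient of the value
function. -/
theorem FeedbackAssumption.ballGrad_sub (hP : P.FeedbackAssumption Y₀ M) {t : ℝ}
    (ht : t ∈ Icc 0 P.T) {w : E n → ℝ} (hw : Differentiable ℝ w) {y : E n}
    (hy : ‖y‖ ≤ P.radius M) :
    ballGrad (P.radius M) (fun z => w z - P.valueFunction t z) y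
      = fderiv ℝ w y - P.valueGrad M t y := by
  rcases hP.subsingleton_or_radius_pos with h | h
  · exact Subsingleton.elim _ _
  · have hmem : y ∈ Metric.closedBall 0 (P.radius M) := by simpa using hy
    exact ((hw y).hasFDerivAt.hasFDerivWithinAt.sub
      ((hP.differentiableOn_value ht) y hmem).hasFDerivWithinAt).fderivWithin
        (uniqueDiffOn_closedBall h y hmem)

/-! ### The feedback law as a function of the gradient -/

/-- The feedback control at `(t,x)` for the gradient `ℓ`, a linear form. -/
def law (P : ControlProblem n m) (t : ℝ) (x : E n) (ℓ : E n →L[ℝ] ℝ) : E m :=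
  -(1 / P.β) • (P.g t x).adjoint ((InnerProductSpace.toDual ℝ (E n)).symm ℓ)

theorem feedback_eq_law (v : ℝ → E n → ℝ) (y : ℝ → E n) (t : ℝ) :
    P.feedback v y t = P.law t (y t) (fderiv ℝ (v t) (y t)) := rfl

theorem norm_law_sub_le (t : ℝ) (x x' : E n) (ℓ ℓ' : E n →L[ℝ] ℝ) :
    ‖P.law t x ℓ - P.law t x' ℓ'‖
      ≤ 1 / P.β * (‖P.g t x‖ * ‖ℓ - ℓ'‖ + ‖P.g t x - P.g t x'‖ * ‖ℓ'‖) := by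
  have hβ := P.β_pos
  have e : P.law t x ℓ - P.law t x' ℓ' = -(1 / P.β) •
      ((P.g t x).adjoint ((InnerProductSpace.toDual ℝ (E n)).symm (ℓ - ℓ'))
        + (P.g t x - P.g t x').adjoint ((InnerProductSpace.toDual ℝ (E n)).symm ℓ')) := by
    simp only [law, map_sub, sub_apply]
    module
  rw [e, norm_smul, norm_neg, Real.norm_of_nonneg (by positivity)]
  gcongr
  refine (norm_add_le _ _).trans (add_le_add ?_ ?_)
  · refine (ContinuousLinearMap.le_opNorm _ _).trans_eq ?_
    rw [LinearIsometryEquiv.norm_map, LinearIsometryEquiv.norm_map]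
  · refine (ContinuousLinearMap.le_opNorm _ _).trans_eq ?_
    rw [LinearIsometryEquiv.norm_map, LinearIsometryEquiv.norm_map]

theorem norm_law_le (t : ℝ) (x : E n) (ℓ : E n →L[ℝ] ℝ) :
    ‖P.law t x ℓ‖ ≤ 1 / P.β * (‖P.g t x‖ * ‖ℓ‖) := by
  have h0 : P.law t x 0 = 0 := by simp [law]
  simpa [h0] using P.norm_law_sub_le t x x ℓ 0

theorem continuousOn_law (hP : P.FeedbackAssumption Y₀ M) {X : Type*} [TopologicalSpace X]
    {S : Set X} {τ : X → ℝ} {x : X → E n} {ℓ : X → E n →L[ℝ] ℝ} (hτ : ContinuousOn τ S)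
    (hτm : MapsTo τ S (Icc 0 P.T)) (hx : ContinuousOn x S) (hℓ : ContinuousOn ℓ S) :
    ContinuousOn (fun s => P.law (τ s) (x s) (ℓ s)) S := by
  have hadj : Continuous (ContinuousLinearMap.adjoint (𝕜 := ℝ) (E := E m) (F := E n)) :=
    LinearIsometryEquiv.continuous _
  have hd : Continuous (InnerProductSpace.toDual ℝ (E n)).symm := LinearIsometryEquiv.continuous _
  have hg : ContinuousOn (fun s => P.g (τ s) (x s)) S :=
    hP.g_smooth.continuousOn.comp (hτ.prodMk hx) fun s hs => ⟨hτm hs, mem_univ _⟩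
  have h1 : ContinuousOn (fun s => (P.g (τ s) (x s)).adjoint
      ((InnerProductSpace.toDual ℝ (E n)).symm (ℓ s))) S :=
    (hadj.comp_continuousOn hg).clm_apply (hd.comp_continuousOn hℓ)
  exact h1.const_smul (-(1 / P.β))

end ControlProblem

/-! ### Estimates in `L²` -/

section LpEstimates

variable {a b : ℝ} {F G : Type*} [NormedAddCommGroup F] [NormedAddCommGroup G]

theorem aestronglyMeasurable_clm_apply [NormedSpace ℝ F] [NormedSpace ℝ G] {μ : Measure ℝ}
    {A : ℝ → F →L[ℝ] G} {u : ℝ → F} (hA : AEStronglyMeasurable A μ)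
    (hu : AEStronglyMeasurable u μ) : AEStronglyMeasurable (fun s => A s (u s)) μ :=
  isBoundedBilinearMap_apply.continuous.comp_aestronglyMeasurable (hA.prodMk hu)

theorem aestronglyMeasurable_of_continuousOn_Icc [SecondCountableTopology F] {Y : ℝ → F}
    (hY : ContinuousOn Y (Icc a b)) : AEStronglyMeasurable Y (intervalMeasure a b) :=
  (memLp_of_continuousOn_Icc (p := 2) hY).1

theorem memLp_clm_apply [NormedSpace ℝ F] [NormedSpace ℝ G] [SecondCountableTopology (F →L[ℝ] G)]
    {A : ℝ → F →L[ℝ] G} (hA : ContinuousOn A (Icc a b)) {u : ℝ → F}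
    (hu : MemLp u 2 (intervalMeasure a b)) : MemLp (fun s => A s (u s)) 2 (intervalMeasure a b) := by
  obtain ⟨C, hC⟩ := isCompact_Icc.exists_bound_of_continuousOn hA
  refine hu.of_le_mul (c := C)
    (aestronglyMeasurable_clm_apply (aestronglyMeasurable_of_continuousOn_Icc hA) hu.1) ?_
  filter_upwards [ae_restrict_mem measurableSet_Ioo] with t ht
  exact (ContinuousLinearMap.le_opNorm _ _).trans
    (mul_le_mul_of_nonneg_right (hC t (Ioo_subset_Icc_self ht)) (norm_nonneg _))

theorem norm_Lp_le_of_affine_bound {F₁ F₂ : Type*} [NormedAddCommGroup F₁] [NormedAddCommGroup F₂]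
    (hab : a ≤ b) (v : Lp F 2 (intervalMeasure a b)) (u : Lp F₁ 2 (intervalMeasure a b))
    (w : Lp F₂ 2 (intervalMeasure a b)) {α β γ : ℝ} (hα : 0 ≤ α) (hβ : 0 ≤ β) (hγ : 0 ≤ γ)
    (h : ∀ᵐ t ∂(intervalMeasure a b), ‖v t‖ ≤ α + β * ‖u t‖ + γ * ‖w t‖) :
    ‖v‖ ≤ √(b - a) * α + β * ‖u‖ + γ * ‖w‖ := by
  have hu : MemLp (fun t => β * ‖u t‖) 2 (intervalMeasure a b) := (Lp.memLp u).norm.const_mul β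
  have hw : MemLp (fun t => γ * ‖w t‖) 2 (intervalMeasure a b) := (Lp.memLp w).norm.const_mul γ
  have hc : MemLp (fun _ : ℝ => α) 2 (intervalMeasure a b) := memLp_const α
  have e1 : ‖v‖ ≤ ‖(hc.toLp _ + hu.toLp _ + hw.toLp _ : Lp ℝ 2 (intervalMeasure a b))‖ := by
    refine Lp.norm_le_norm_of_ae_le ?_
    filter_upwards [h, hc.coeFn_toLp, hu.coeFn_toLp, hw.coeFn_toLp,
      Lp.coeFn_add (hc.toLp _ + hu.toLp _) (hw.toLp _), Lp.coeFn_add (hc.toLp _) (hu.toLp _)]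
      with t h1 h2 h3 h4 h5 h6
    rw [h5, Pi.add_apply, h6, Pi.add_apply, h2, h3, h4]
    exact h1.trans (le_abs_self _)
  have e2 : ‖hc.toLp _‖ ≤ √(b - a) * α := by
    refine norm_Lp_le_of_bound hab _ hα ?_
    filter_upwards [hc.coeFn_toLp] with t ht
    rw [ht, Real.norm_of_nonneg hα]
  have e3 : ‖hu.toLp _‖ ≤ β * ‖u‖ := by
    refine Lp.norm_le_mul_norm_of_ae_le_mul ?_
    filter_upwards [hu.coeFn_toLp] with t ht
    rw [ht, Real.norm_of_nonneg (by positivity)]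
  have e4 : ‖hw.toLp _‖ ≤ γ * ‖w‖ := by
    refine Lp.norm_le_mul_norm_of_ae_le_mul ?_
    filter_upwards [hw.coeFn_toLp] with t ht
    rw [ht, Real.norm_of_nonneg (by positivity)]
  have e5 := norm_add₃_le (a := hc.toLp _) (b := hu.toLp _) (c := hw.toLp _)
  linarith

end LpEstimates

namespace ControlProblem

variable {n m : ℕ} {P : ControlProblem n m} {Y₀ : Set (E n)} {M : ℝ}

/-! ### State equations as integral equations -/

/-- The right-hand side of the state equation along a curve. -/
def velocity (P : ControlProblem n m) (Y : ℝ → E n) (u : ℝ → E m) (s : ℝ) : E n :=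
  P.f s (Y s) + P.g s (Y s) (u s)

section Trajectories

variable {a b : ℝ}

theorem continuousOn_along {F : Type*} [TopologicalSpace F] {h : ℝ → E n → F}
    (hh : ContinuousOn (fun x : ℝ × E n => h x.1 x.2) (Icc 0 P.T ×ˢ univ))
    (ha : 0 ≤ a) (hb : b ≤ P.T) {Y : ℝ → E n} (hY : ContinuousOn Y (Icc a b)) :
    ContinuousOn (fun s => h s (Y s)) (Icc a b) :=
  hh.comp (continuousOn_id.prodMk hY) fun _ hs => ⟨⟨ha.trans hs.1, hs.2.trans hb⟩, mem_univ _⟩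

theorem memLp_velocity
    (hf : ContinuousOn (fun x : ℝ × E n => P.f x.1 x.2) (Icc 0 P.T ×ˢ univ))
    (hg : ContinuousOn (fun x : ℝ × E n => P.g x.1 x.2) (Icc 0 P.T ×ˢ univ))
    (ha : 0 ≤ a) (hb : b ≤ P.T) {Y : ℝ → E n} (hY : ContinuousOn Y (Icc a b))
    {u : ℝ → E m} (hu : MemLp u 2 (intervalMeasure a b)) :
    MemLp (P.velocity Y u) 2 (intervalMeasure a b) :=
  (memLp_of_continuousOn_Icc (continuousOn_along hf ha hb hY)).add
    (memLp_clm_apply (continuousOn_along hg ha hb hY) hu)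

theorem exists_stateEq
    (hf : ContinuousOn (fun x : ℝ × E n => P.f x.1 x.2) (Icc 0 P.T ×ˢ univ))
    (hg : ContinuousOn (fun x : ℝ × E n => P.g x.1 x.2) (Icc 0 P.T ×ˢ univ))
    (hab : a < b) (ha : 0 ≤ a) (hb : b ≤ P.T) {Y : ℝ → E n}
    (hY : ContinuousOn Y (Icc a b)) {u : ℝ → E m} (hu : MemLp u 2 (intervalMeasure a b))
    {x₀ : E n} (he : ∀ t ∈ Icc a b, Y t = x₀ + ∫ s in a..t, P.velocity Y u s) :
    ∃ y : W a b n, P.StateEq y u x₀ ∧ ∀ t ∈ Icc a b, rep y t = Y t := by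
  obtain ⟨y, hy1, hy2⟩ := exists_W hab x₀ (memLp_velocity hf hg ha hb hY hu)
  have hrep : ∀ t ∈ Icc a b, rep y t = Y t := fun t ht => (hy2 t ht).trans (he t ht).symm
  refine ⟨y, ⟨?_, ?_⟩, hrep⟩
  · filter_upwards [hy1, ae_restrict_mem measurableSet_Ioo] with t ht hmem
    rw [ht, hrep t (Ioo_subset_Icc_self hmem)]
    rfl
  · rw [hy2 a (left_mem_Icc.mpr hab.le)]
    simp

end Trajectories

theorem integral_congr_Ioo {a b : ℝ} {F : Type*} [NormedAddCommGroup F] [NormedSpace ℝ F]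
    {u v : ℝ → F} (h : u =ᵐ[intervalMeasure a b] v) {s t : ℝ} (hs : s ∈ Icc a b)
    (ht : t ∈ Icc a b) : ∫ r in s..t, u r = ∫ r in s..t, v r := by
  refine intervalIntegral.integral_congr_ae_restrict ?_
  refine ae_mono ?_ h
  rw [intervalMeasure, restrict_Ioo_eq_restrict_Ioc]
  refine Measure.restrict_mono ?_ le_rfl
  exact Ioc_subset_Ioc (le_min hs.1 ht.1) (max_le hs.2 ht.2)

theorem StateEq.rep_eq {a b : ℝ} (hab : a < b) {y : W a b n} {u : ℝ → E m} {x₀ : E n}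
    (h : P.StateEq y u x₀) {t : ℝ} (ht : t ∈ Icc a b) :
    rep y t = x₀ + ∫ s in a..t, P.velocity (rep y) u s := by
  rw [rep_eq_add_integral hab y ht, h.2, integral_congr_Ioo h.1 (left_mem_Icc.mpr hab.le) ht]
  rfl

theorem StateEq.congr {a b : ℝ} {y : W a b n} {u v : ℝ → E m} {x₀ : E n}
    (h : P.StateEq y u x₀) (huv : u =ᵐ[intervalMeasure a b] v) : P.StateEq y v x₀ := by
  refine ⟨?_, h.2⟩
  filter_upwards [h.1, huv] with t h1 h2
  rw [h1, h2]

/-! ### The cost -/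

theorem cost_nonneg (t : ℝ) (y : ℝ → E n) (u : ℝ → E m) : 0 ≤ P.cost t y u := by
  have := P.β_pos
  refine add_nonneg (mul_nonneg (by norm_num) (integral_nonneg fun s => ?_)) (by positivity)
  positivity

theorem cost_congr {t : ℝ} (ht : t ≤ P.T) {y y' : ℝ → E n} {u u' : ℝ → E m}
    (hy : ∀ s ∈ Icc t P.T, y s = y' s) (hu : u =ᵐ[intervalMeasure t P.T] u') :
    P.cost t y u = P.cost t y' u' := by
  unfold cost
  rw [hy P.T (right_mem_Icc.mpr ht)]
  congr 2
  apply integral_congr_ae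
  filter_upwards [hu, ae_restrict_mem measurableSet_Ioo] with s h1 h2
  rw [h1, hy s (Ioo_subset_Icc_self h2)]

theorem memLp_yd {t : ℝ} (ht : 0 ≤ t) : MemLp P.yd 2 (intervalMeasure t P.T) :=
  (Lp.memLp P.yd).mono_measure (Measure.restrict_mono (Ioo_subset_Ioo_left ht) le_rfl)

theorem integrable_cost {t : ℝ} (ht : 0 ≤ t) {y : ℝ → E n} {u : ℝ → E m}
    (hy : ContinuousOn y (Icc t P.T)) (hu : MemLp u 2 (intervalMeasure t P.T)) :
    IntegrableOn (fun s => ‖P.Q₁ (y s - P.yd s)‖ ^ 2 + P.β * ‖u s‖ ^ 2) (Ioo t P.T) := by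
  have h1 : MemLp (fun s => P.Q₁ (y s - P.yd s)) 2 (intervalMeasure t P.T) :=
    P.Q₁.comp_memLp' ((memLp_of_continuousOn_Icc hy).sub (memLp_yd ht))
  exact (h1.integrable_norm_pow (by norm_num)).add
    ((hu.integrable_norm_pow (by norm_num)).const_mul _)

theorem cost_split {t : ℝ} (ht : t ∈ Icc 0 P.T) {y : ℝ → E n} {u : ℝ → E m}
    (hy : ContinuousOn y (Icc 0 P.T)) (hu : MemLp u 2 (intervalMeasure 0 P.T)) :
    P.cost 0 y u = 1 / 2 * (∫ s in Ioo 0 t, (‖P.Q₁ (y s - P.yd s)‖ ^ 2 + P.β * ‖u s‖ ^ 2))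
      + P.cost t y u := by
  have h := integrable_cost le_rfl hy hu
  have hi := (intervalIntegrable_iff_integrableOn_Ioo_of_le P.T_pos.le).mpr h
  have h1 := intervalIntegral.integral_add_adjacent_intervals
    (intervalIntegrable_mono_Icc hi (left_mem_Icc.mpr P.T_pos.le) ht)
    (intervalIntegrable_mono_Icc hi ht (right_mem_Icc.mpr P.T_pos.le))
  rw [intervalIntegral.integral_of_le ht.1, intervalIntegral.integral_of_le ht.2,
    intervalIntegral.integral_of_le P.T_pos.le, integral_Ioc_eq_integral_Ioo,
    integral_Ioc_eq_integral_Ioo, integral_Ioc_eq_integral_Ioo] at h1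
  unfold cost
  rw [← h1]
  ring

/-! ### The value function -/

theorem bddBelow_costSet (t : ℝ) (x : E n) : BddBelow (P.costSet t x) := by
  refine ⟨0, ?_⟩
  rintro c ⟨y, u, -, rfl⟩
  exact cost_nonneg _ _ _

theorem FeedbackAssumption.value_le (hP : P.FeedbackAssumption Y₀ M) {t : ℝ} (ht : t ∈ Ico 0 P.T)
    {Y : ℝ → E n} (hY : ContinuousOn Y (Icc t P.T)) {u : ℝ → E m}
    (hu : MemLp u 2 (intervalMeasure t P.T)) {x₀ : E n}
    (he : ∀ s ∈ Icc t P.T, Y s = x₀ + ∫ r in t..s, P.velocity Y u r) :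
    P.valueFunction t x₀ ≤ P.cost t Y u := by
  obtain ⟨y, hy1, hy2⟩ := exists_stateEq hP.f_smooth.continuousOn hP.g_smooth.continuousOn ht.2
    ht.1 le_rfl hY hu he
  rw [valueFunction, if_pos ht.2]
  refine csInf_le (bddBelow_costSet t x₀) ⟨y, hu.toLp u, hy1.congr hu.coeFn_toLp.symm, ?_⟩
  exact cost_congr ht.2.le (fun s hs => (hy2 s hs).symm) hu.coeFn_toLp.symm

theorem MemLp_piecewise_Iio {F : Type*} [NormedAddCommGroup F] {t T : ℝ}
    {u v : ℝ → F} (hu : MemLp u 2 (intervalMeasure 0 t)) (hv : MemLp v 2 (intervalMeasure t T)) :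
    MemLp ((Iio t).piecewise u v) 2 (intervalMeasure 0 T) := by
  refine MemLp.piecewise measurableSet_Iio (hu.mono_measure ?_) (hv.mono_measure ?_)
  · rw [Measure.restrict_restrict measurableSet_Iio]
    refine Measure.restrict_mono ?_ le_rfl
    exact fun x hx => ⟨hx.2.1, hx.1⟩
  · rw [Measure.restrict_restrict measurableSet_Iio.compl, intervalMeasure,
      restrict_Ioo_eq_restrict_Ico (a := t)]
    refine Measure.restrict_mono ?_ le_rfl
    exact fun x hx => ⟨not_lt.mp hx.1, hx.2.2⟩

/-- The principle of optimality: tails of minimizing pairs are minimizing. -/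
theorem FeedbackAssumption.value_eq_cost (hP : P.FeedbackAssumption Y₀ M) {y₀ : E n}
    {y : W 0 P.T n} {u : L2 0 P.T m} (hopt : P.IsOptimalPair y₀ y u) {t : ℝ}
    (ht : t ∈ Ico 0 P.T) : P.valueFunction t (rep y t) = P.cost t (rep y) u := by
  have hf := hP.f_smooth.continuousOn
  have hg := hP.g_smooth.continuousOn
  have htc : t ∈ Icc 0 P.T := Ico_subset_Icc_self ht
  have h0 : (0 : ℝ) ∈ Icc 0 P.T := left_mem_Icc.mpr P.T_pos.le
  have hvel := memLp_velocity hf hg le_rfl le_rfl (continuous_rep y).continuousOn (Lp.memLp u)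
  have hveli := intervalIntegrable_of_memLp P.T_pos.le hvel
  have hut : MemLp u 2 (intervalMeasure t P.T) :=
    (Lp.memLp u).mono_measure (Measure.restrict_mono (Ioo_subset_Ioo_left ht.1) le_rfl)
  have hself : ∀ s ∈ Icc t P.T,
      rep y s = rep y t + ∫ r in t..s, P.velocity (rep y) u r := by
    intro s hs
    have hs' : s ∈ Icc 0 P.T := ⟨ht.1.trans hs.1, hs.2⟩
    rw [hopt.1.rep_eq P.T_pos hs', hopt.1.rep_eq P.T_pos htc, add_assoc,
      intervalIntegral.integral_add_adjacent_intervals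
      (intervalIntegrable_mono_Icc hveli h0 htc) (intervalIntegrable_mono_Icc hveli htc hs')]
  refine le_antisymm (hP.value_le ht (continuous_rep y).continuousOn hut hself) ?_
  -- The tail itself shows that the set of costs is nonempty, which the lower bound for the infimum
  -- requires.
  have hne : (P.costSet t (rep y t)).Nonempty := by
    obtain ⟨y', h1, h2⟩ := exists_stateEq hf hg ht.2 ht.1 le_rfl (continuous_rep y).continuousOn
      hut hself
    exact ⟨_, y', hut.toLp u, h1.congr hut.coeFn_toLp.symm, rfl⟩
  rw [valueFunction, if_pos ht.2]
  refine le_csInf hne ?_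
  rintro c ⟨z, v, hz, rfl⟩
  have hvelz := memLp_velocity hf hg ht.1 le_rfl (continuous_rep z).continuousOn (Lp.memLp v)
  have hvelt := hvel.mono_measure (ν := intervalMeasure 0 t)
    (Measure.restrict_mono (Ioo_subset_Ioo_right ht.2.le) le_rfl)
  -- A competitor on `[t,T]` is glued to the optimal pair on `[0,t]`. The velocities are
  -- concatenated rather than the states, since a primitive of an `L²` function lies in `W`
  -- automatically.
  set w := (Iio t).piecewise (P.velocity (rep y) u) (P.velocity (rep z) v) with hw
  have hwL : MemLp w 2 (intervalMeasure 0 P.T) := MemLp_piecewise_Iio hvelt hvelz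
  have hwi := intervalIntegrable_of_memLp P.T_pos.le hwL
  have hU : MemLp ((Iio t).piecewise u v) 2 (intervalMeasure 0 P.T) :=
    MemLp_piecewise_Iio ((Lp.memLp u).mono_measure
      (Measure.restrict_mono (Ioo_subset_Ioo_right ht.2.le) le_rfl)) (Lp.memLp v)
  obtain ⟨Z, hZ1, hZ2⟩ := exists_W P.T_pos y₀ hwL
  have hwlt : ∀ r, r < t → w r = P.velocity (rep y) u r := fun r hr =>
    piecewise_eq_of_mem _ _ _ hr
  have hwge : ∀ r, t ≤ r → w r = P.velocity (rep z) v r := fun r hr =>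
    piecewise_eq_of_notMem _ _ _ (not_lt.mpr hr)
  have hZl : ∀ s ∈ Icc 0 t, rep Z s = rep y s := by
    intro s hs
    have hs' : s ∈ Icc 0 P.T := ⟨hs.1, hs.2.trans ht.2.le⟩
    rw [hZ2 s hs', hopt.1.rep_eq P.T_pos hs']
    congr 1
    refine intervalIntegral.integral_congr_ae ?_
    filter_upwards [compl_mem_ae_iff.mpr (measure_singleton (μ := volume) t)] with r hr hr'
    rw [uIoc_of_le hs.1] at hr'
    exact hwlt r (lt_of_le_of_ne (hr'.2.trans hs.2) hr)
  have hZr : ∀ s ∈ Icc t P.T, rep Z s = rep z s := by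
    intro s hs
    have hs' : s ∈ Icc 0 P.T := ⟨ht.1.trans hs.1, hs.2⟩
    have e1 : rep Z s = rep Z t + ∫ r in t..s, w r := by
      rw [hZ2 s hs', hZ2 t htc, add_assoc, intervalIntegral.integral_add_adjacent_intervals
        (intervalIntegrable_mono_Icc hwi h0 htc) (intervalIntegrable_mono_Icc hwi htc hs')]
    rw [e1, hZl t ⟨ht.1, le_rfl⟩, hz.rep_eq ht.2 hs]
    congr 1
    refine intervalIntegral.integral_congr fun r hr => ?_
    rw [uIcc_of_le hs.1] at hr
    exact hwge r hr.1
  have hZs : P.StateEq Z (hU.toLp _) y₀ := by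
    refine StateEq.congr ⟨?_, ?_⟩ hU.coeFn_toLp.symm
    · filter_upwards [hZ1, ae_restrict_mem measurableSet_Ioo] with r hr hmem
      rw [hr]
      rcases lt_or_ge r t with hrt | hrt
      · rw [hwlt r hrt, hZl r ⟨hmem.1.le, hrt.le⟩, piecewise_eq_of_mem _ _ _ (mem_Iio.mpr hrt)]
        rfl
      · rw [hwge r hrt, hZr r ⟨hrt, hmem.2.le⟩,
          piecewise_eq_of_notMem _ _ _ (notMem_Iio.mpr hrt)]
        rfl
    · rw [hZ2 0 h0]
      simp
  -- The glued pair and the optimal pair have the same cost on `[0,t]`; subtracting it from the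
  -- optimality inequality leaves the inequality for the tails.
  have hmin := hopt.2 Z _ hZs
  rw [cost_congr (u' := (Iio t).piecewise u v) P.T_pos.le (fun _ _ => rfl) hU.coeFn_toLp,
    cost_split htc (continuous_rep Z).continuousOn hU,
    cost_split htc (continuous_rep y).continuousOn (Lp.memLp u)] at hmin
  have e1 : ∫ s in Ioo 0 t, (‖P.Q₁ (rep Z s - P.yd s)‖ ^ 2
        + P.β * ‖(Iio t).piecewise u v s‖ ^ 2)
      = ∫ s in Ioo 0 t, (‖P.Q₁ (rep y s - P.yd s)‖ ^ 2 + P.β * ‖u s‖ ^ 2) := by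
    refine setIntegral_congr_fun measurableSet_Ioo fun s hs => ?_
    simp only [hZl s (Ioo_subset_Icc_self hs), piecewise_eq_of_mem _ _ _ (mem_Iio.mpr hs.2)]
  have e2 : P.cost t (rep Z) ((Iio t).piecewise u v) = P.cost t (rep z) v := by
    refine cost_congr ht.2.le hZr ?_
    filter_upwards [ae_restrict_mem measurableSet_Ioo] with s hs
    exact piecewise_eq_of_notMem _ _ _ (notMem_Iio.mpr hs.1.le)
  rw [e1, e2] at hmin
  linarith

end ControlProblem

/-- Gronwall's inequality, backward in time, with an integrable forcing term. -/
theorem gronwall_backward_of_forcing {a b c₀ c₁ κ : ℝ} {k φ h : ℝ → ℝ}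
    (hk : ContinuousOn k (Icc a b)) (hφ : ContinuousOn φ (Icc a b))
    (hk0 : ∀ t ∈ Icc a b, 0 ≤ k t) (hh : IntervalIntegrable h volume a b)
    (hh0 : ∀ t, 0 ≤ h t) (hc₀ : 0 ≤ c₀) (hc₁ : ∫ s in a..b, h s ≤ c₁)
    (hκ : ∫ s in a..b, k s ≤ κ)
    (hle : ∀ t ∈ Icc a b, φ t ≤ c₀ + ∫ s in t..b, (k s * φ s + h s)) {t : ℝ}
    (ht : t ∈ Icc a b) : φ t ≤ (c₀ + c₁) * Real.exp κ := by
  have hab : a ≤ b := ht.1.trans ht.2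
  have hb := right_mem_Icc.mpr hab
  have ha := left_mem_Icc.mpr hab
  have hkφ : IntervalIntegrable (fun s => k s * φ s) volume a b :=
    (hk.mul hφ).intervalIntegrable_of_Icc hab
  have htail : ∀ {z : ℝ → ℝ}, IntervalIntegrable z volume a b → (∀ t ∈ Icc a b, 0 ≤ z t) →
      ∀ t ∈ Icc a b, ∫ s in t..b, z s ≤ ∫ s in a..b, z s := by
    intro z hz hz0 t ht
    have h1 := intervalIntegral.integral_add_adjacent_intervals
      (intervalIntegrable_mono_Icc hz ha ht) (intervalIntegrable_mono_Icc hz ht hb)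
    have h2 : 0 ≤ ∫ s in a..t, z s := intervalIntegral.integral_nonneg ht.1 fun s hs =>
      hz0 s ⟨hs.1, hs.2.trans ht.2⟩
    linarith
  have hc₁0 : 0 ≤ c₁ := (intervalIntegral.integral_nonneg hab fun s _ => hh0 s).trans hc₁
  have h1 : ∀ t ∈ Icc a b, φ t ≤ (c₀ + c₁) + ∫ s in t..b, k s * φ s := by
    intro t ht
    have e := hle t ht
    rw [intervalIntegral.integral_add (intervalIntegrable_mono_Icc hkφ ht hb)
      (intervalIntegrable_mono_Icc hh ht hb)] at e
    have := htail hh (fun s _ => hh0 s) t ht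
    linarith
  refine (gronwall_integral_backward hk hφ hk0 h1 ht).trans ?_
  refine mul_le_mul_of_nonneg_left (Real.exp_le_exp.mpr ?_) (by linarith)
  exact (htail (hk.intervalIntegrable_of_Icc hab) hk0 t ht).trans hκ

theorem integral_norm_le_of_ae_eq {F : Type*} [NormedAddCommGroup F] {a b : ℝ} (hab : a ≤ b)
    {u : ℝ → F} {U : Lp F 2 (intervalMeasure a b)} (h : U =ᵐ[intervalMeasure a b] u) :
    ∫ s in a..b, ‖u s‖ ≤ √(b - a) * ‖U‖ := by
  refine le_trans (le_of_eq ?_) (integral_norm_le_sqrt_mul hab U)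
  refine ControlProblem.integral_congr_Ioo ?_ (left_mem_Icc.mpr hab) (right_mem_Icc.mpr hab)
  filter_upwards [h] with t ht
  rw [ht]

namespace ControlProblem

variable {n m : ℕ} {P : ControlProblem n m} {Y₀ : Set (E n)} {M : ℝ}

/-! ### The adjoint equation -/

/-- The right-hand side of the adjoint equation. -/
def adjointRhs (P : ControlProblem n m) (t : ℝ) (y : E n) (u : E m) (p yd : E n) : E n :=
  (fderiv ℝ (P.f t) y).adjoint p + ((fderiv ℝ (P.g t) y).flip u).adjoint p
    + P.Q₁.adjoint (P.Q₁ (y - yd))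

/-- The norm of `Q₁ᵀ` times the norm of `Q₁`. -/
def runWeight (P : ControlProblem n m) : ℝ := ‖P.Q₁.adjoint‖ * ‖P.Q₁‖

/-- The norm of `Q₂ᵀ` times the norm of `Q₂`. -/
def endWeight (P : ControlProblem n m) : ℝ := ‖P.Q₂.adjoint‖ * ‖P.Q₂‖

theorem runWeight_nonneg : 0 ≤ P.runWeight := by unfold runWeight; positivity

theorem endWeight_nonneg : 0 ≤ P.endWeight := by unfold endWeight; positivity

theorem norm_adjoint_comp_le {F : Type*} [NormedAddCommGroup F] [NormedSpace ℝ F]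
    (A B : E n →L[ℝ] E n) (x : E n) : ‖A (B x)‖ ≤ ‖A‖ * ‖B‖ * ‖x‖ := by
  refine (A.le_opNorm _).trans ?_
  rw [mul_assoc]
  exact mul_le_mul_of_nonneg_left (B.le_opNorm _) (norm_nonneg _)

theorem norm_adjoint_apply_le {k l : ℕ} (A : E k →L[ℝ] E l) (x : E l) :
    ‖A.adjoint x‖ ≤ ‖A‖ * ‖x‖ := by
  refine (A.adjoint.le_opNorm _).trans_eq ?_
  rw [LinearIsometryEquiv.norm_map]

theorem norm_flip_adjoint_apply_le (D : E n →L[ℝ] E m →L[ℝ] E n) (u : E m) (p : E n) :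
    ‖(D.flip u).adjoint p‖ ≤ ‖D‖ * ‖u‖ * ‖p‖ := by
  refine (norm_adjoint_apply_le _ _).trans ?_
  have := D.flip.le_opNorm u
  rw [ContinuousLinearMap.opNorm_flip] at this
  exact mul_le_mul_of_nonneg_right this (norm_nonneg _)

theorem norm_adjointRhs_le {R C t : ℝ} (hB : P.DynamicsBounds R C) (ht : t ∈ Icc 0 P.T)
    {y : E n} (hy : ‖y‖ ≤ R) (u : E m) (p yd : E n) :
    ‖P.adjointRhs t y u p yd‖ ≤ C * (1 + ‖u‖) * ‖p‖ + P.runWeight * (‖y‖ + ‖yd‖) := by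
  have hC := hB.nonneg
  have h1 := norm_adjoint_apply_le (fderiv ℝ (P.f t) y) p
  have h2 := norm_flip_adjoint_apply_le (fderiv ℝ (P.g t) y) u p
  have h3 := norm_adjoint_comp_le (F := E n) P.Q₁.adjoint P.Q₁ (y - yd)
  have h4 := mul_le_mul_of_nonneg_right (hB.f.norm_fderiv_le t ht y hy) (norm_nonneg p)
  have h5 : ‖fderiv ℝ (P.g t) y‖ * ‖u‖ * ‖p‖ ≤ C * ‖u‖ * ‖p‖ := by
    gcongr
    exact hB.g.norm_fderiv_le t ht y hy
  have h6 := mul_le_mul_of_nonneg_left (norm_sub_le y yd) P.runWeight_nonneg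
  have h7 := norm_add₃_le (a := (fderiv ℝ (P.f t) y).adjoint p)
    (b := ((fderiv ℝ (P.g t) y).flip u).adjoint p) (c := P.Q₁.adjoint (P.Q₁ (y - yd)))
  unfold adjointRhs
  unfold runWeight at *
  linarith

/-- The splitting is deliberately asymmetric: `p - p'` meets coefficients at `(y,u)`, while the
differences of state and control meet only `p'`. Thus Gronwall's inequality can act on `p - p'` once
`p'` has an a priori bound. -/
theorem norm_adjointRhs_sub_le {R C t : ℝ} (hB : P.DynamicsBounds R C) (ht : t ∈ Icc 0 P.T)
    {y y' : E n} (hy : ‖y‖ ≤ R) (hy' : ‖y'‖ ≤ R) (u u' : E m) (p p' yd : E n) :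
    ‖P.adjointRhs t y u p yd - P.adjointRhs t y' u' p' yd‖
      ≤ C * (1 + ‖u‖) * ‖p - p'‖ + (C * (1 + ‖u‖) * ‖p'‖ + P.runWeight) * ‖y - y'‖
        + C * ‖p'‖ * ‖u - u'‖ := by
  have hC := hB.nonneg
  set A := fderiv ℝ (P.f t) y
  set A' := fderiv ℝ (P.f t) y'
  set D := fderiv ℝ (P.g t) y
  set D' := fderiv ℝ (P.g t) y'
  have e : P.adjointRhs t y u p yd - P.adjointRhs t y' u' p' yd
      = (A.adjoint (p - p') + (D.flip u).adjoint (p - p'))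
        + ((A - A').adjoint p' + ((D - D').flip u).adjoint p' + P.Q₁.adjoint (P.Q₁ (y - y')))
        + (D'.flip (u - u')).adjoint p' := by
    have e1 : (D - D').flip = D.flip - D'.flip := rfl
    simp only [adjointRhs, e1, map_sub, sub_apply]
    abel
  have a1 := norm_adjoint_apply_le A (p - p')
  have a2 := norm_flip_adjoint_apply_le D u (p - p')
  have a3 := norm_adjoint_apply_le (A - A') p'
  have a4 := norm_flip_adjoint_apply_le (D - D') u p'
  have a5 := norm_adjoint_comp_le (F := E n) P.Q₁.adjoint P.Q₁ (y - y')
  have a6 := norm_flip_adjoint_apply_le D' (u - u') p'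
  have b1 : ‖A‖ * ‖p - p'‖ ≤ C * ‖p - p'‖ := by
    gcongr; exact hB.f.norm_fderiv_le t ht y hy
  have b2 : ‖D‖ * ‖u‖ * ‖p - p'‖ ≤ C * ‖u‖ * ‖p - p'‖ := by
    gcongr; exact hB.g.norm_fderiv_le t ht y hy
  have b3 : ‖A - A'‖ * ‖p'‖ ≤ C * ‖y - y'‖ * ‖p'‖ := by
    gcongr; exact hB.f.fderiv_lip t ht y y' hy hy'
  have b4 : ‖D - D'‖ * ‖u‖ * ‖p'‖ ≤ C * ‖y - y'‖ * ‖u‖ * ‖p'‖ := by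
    gcongr; exact hB.g.fderiv_lip t ht y y' hy hy'
  have b6 : ‖D'‖ * ‖u - u'‖ * ‖p'‖ ≤ C * ‖u - u'‖ * ‖p'‖ := by
    gcongr; exact hB.g.norm_fderiv_le t ht y' hy'
  rw [e]
  have c1 := norm_add₃_le (a := A.adjoint (p - p') + (D.flip u).adjoint (p - p'))
    (b := (A - A').adjoint p' + ((D - D').flip u).adjoint p' + P.Q₁.adjoint (P.Q₁ (y - y')))
    (c := (D'.flip (u - u')).adjoint p')
  have c2 := norm_add_le (A.adjoint (p - p')) ((D.flip u).adjoint (p - p'))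
  have c3 := norm_add₃_le (a := (A - A').adjoint p') (b := ((D - D').flip u).adjoint p')
    (c := P.Q₁.adjoint (P.Q₁ (y - y')))
  unfold runWeight
  linarith

theorem AdjointEq.rep_eq {y p : W 0 P.T n} {u : ℝ → E m} (h : P.AdjointEq y u p) {t : ℝ}
    (ht : t ∈ Icc 0 P.T) : rep p t = rep p P.T
      + ∫ s in t..P.T, P.adjointRhs s (rep y s) (u s) (rep p s) (P.yd s) := by
  have hT := right_mem_Icc.mpr P.T_pos.le
  have h0 := left_mem_Icc.mpr P.T_pos.le
  have hd : IntervalIntegrable (derivL2 p) volume 0 P.T :=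
    intervalIntegrable_of_memLp P.T_pos.le (Lp.memLp _)
  have e : ∫ s in t..P.T, P.adjointRhs s (rep y s) (u s) (rep p s) (P.yd s)
      = ∫ s in t..P.T, -(derivL2 p s) :=
    integral_congr_Ioo (by filter_upwards [h.1] with s hs using hs.symm) ht hT
  rw [e, intervalIntegral.integral_neg, rep_eq_add_integral P.T_pos p ht,
    rep_eq_add_integral P.T_pos p hT, ← intervalIntegral.integral_add_adjacent_intervals
      (intervalIntegrable_mono_Icc hd h0 ht) (intervalIntegrable_mono_Icc hd ht hT)]
  abel

/-- The equation is linear in `p` with a continuous coefficient, but `yd` makes the inhomogeneity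
merely `L²`. It is therefore solved backward as an integral equation. -/
theorem FeedbackAssumption.exists_adjoint (hP : P.FeedbackAssumption Y₀ M) (y : W 0 P.T n)
    {u : ℝ → E m} (hu : ContinuousOn u (Icc 0 P.T)) : ∃ p : W 0 P.T n, P.AdjointEq y u p := by
  have hT := right_mem_Icc.mpr P.T_pos.le
  have h0 := left_mem_Icc.mpr P.T_pos.le
  have hadj : ∀ k l : ℕ, Continuous (ContinuousLinearMap.adjoint (𝕜 := ℝ) (E := E k) (F := E l)) :=
    fun k l => LinearIsometryEquiv.continuous _
  have hA : ContinuousOn (fun s => (fderiv ℝ (P.f s) (rep y s)).adjoint) (Icc 0 P.T) :=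
    (hadj n n).comp_continuousOn (continuousOn_along (P := P)
      (continuousOn_fderiv_slice P.T_pos hP.f_smooth) le_rfl le_rfl (continuous_rep y).continuousOn)
  have hD : ContinuousOn (fun s => ((fderiv ℝ (P.g s) (rep y s)).flip (u s)).adjoint)
      (Icc 0 P.T) := by
    have h1 : ContinuousOn (fun s => fderiv ℝ (P.g s) (rep y s)) (Icc 0 P.T) :=
      continuousOn_along (P := P) (continuousOn_fderiv_slice P.T_pos hP.g_smooth) le_rfl le_rfl
        (continuous_rep y).continuousOn
    have h2 : Continuous (ContinuousLinearMap.flip (𝕜 := ℝ) (𝕜₂ := ℝ) (𝕜₃ := ℝ) (σ₁₃ := .id ℝ)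
        (σ₂₃ := .id ℝ) (E := E n) (F := E m) (G := E n)) :=
      (ContinuousLinearMap.flipₗᵢ ℝ (E n) (E m) (E n)).continuous
    exact (hadj n n).comp_continuousOn ((h2.comp_continuousOn h1).clm_apply hu)
  have hAD : ContinuousOn (fun s => (fderiv ℝ (P.f s) (rep y s)).adjoint
      + ((fderiv ℝ (P.g s) (rep y s)).flip (u s)).adjoint) (Icc 0 P.T) := hA.add hD
  obtain ⟨K, hK⟩ := isCompact_Icc.exists_bound_of_continuousOn hAD
  have hK0 : 0 ≤ K := (norm_nonneg _).trans (hK 0 h0)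
  have hb : MemLp (fun s => P.Q₁.adjoint (P.Q₁ (rep y s - P.yd s))) 2 (intervalMeasure 0 P.T) :=
    P.Q₁.adjoint.comp_memLp' (P.Q₁.comp_memLp'
      ((memLp_of_continuousOn_Icc (continuous_rep y).continuousOn).sub (memLp_yd le_rfl)))
  have hmem : ∀ q : ℝ → E n, Continuous q →
      MemLp (fun s => P.adjointRhs s (rep y s) (u s) (q s) (P.yd s)) 2 (intervalMeasure 0 P.T) :=
    fun q hq => (memLp_of_continuousOn_Icc (hAD.clm_apply hq.continuousOn)).add hb
  obtain ⟨q, hq, hqe⟩ := exists_integral_solution_backward P.T_pos.le (K := K)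
    (G := fun s x => P.adjointRhs s (rep y s) (u s) x (P.yd s)) hK0
    (fun t ht x x' => by
      refine le_trans (le_of_eq ?_) ((ContinuousLinearMap.le_opNorm _ _).trans
        (mul_le_mul_of_nonneg_right (hK t ht) (norm_nonneg _)))
      congr 1
      simp only [adjointRhs, add_apply, map_sub]
      abel)
    (fun Y hY => intervalIntegrable_of_memLp P.T_pos.le (hmem Y hY))
    (P.Q₂.adjoint (P.Q₂ (rep y P.T - P.ydT)))
  have hi := intervalIntegrable_of_memLp P.T_pos.le (hmem q hq)
  obtain ⟨p, hp1, hp2⟩ := exists_W P.T_pos (q 0) (hmem q hq).neg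
  have hrep : ∀ t ∈ Icc 0 P.T, rep p t = q t := by
    intro t ht
    rw [hp2 t ht, hqe t ht, hqe 0 h0, ← intervalIntegral.integral_add_adjacent_intervals
      (intervalIntegrable_mono_Icc hi h0 ht) (intervalIntegrable_mono_Icc hi ht hT)]
    simp only [Pi.neg_apply, intervalIntegral.integral_neg]
    abel
  refine ⟨p, ?_, ?_⟩
  · filter_upwards [hp1, ae_restrict_mem measurableSet_Ioo] with t ht hmem
    rw [ht, hrep t (Ioo_subset_Icc_self hmem), Pi.neg_apply, neg_neg]
    rfl
  · rw [hrep _ hT, hqe _ hT]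
    simp

/-- An a priori bound for adjoint states. -/
theorem exists_adjoint_bound {R C : ℝ} (hR : 0 ≤ R) (hB : P.DynamicsBounds R C) {ρ : ℝ} :
    ∃ B, 0 ≤ B ∧ ∀ (y p : W 0 P.T n) (u : ℝ → E m) (U : L2 0 P.T m),
      (∀ t ∈ Icc 0 P.T, ‖rep y t‖ ≤ R) → ContinuousOn u (Icc 0 P.T) →
      U =ᵐ[intervalMeasure 0 P.T] u → ‖U‖ ≤ ρ → P.AdjointEq y u p →
      ∀ t ∈ Icc 0 P.T, ‖rep p t‖ ≤ B := by
  have hT := right_mem_Icc.mpr P.T_pos.le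
  have hC := hB.nonneg
  have hq := P.runWeight_nonneg
  have hq2 := P.endWeight_nonneg
  have hTp := P.T_pos
  -- Gronwall's bound: the size of the terminal value plus the integrated forcing, times the
  -- exponential of the integrated coefficient. Only the `L²` bound `ρ` on the control enters,
  -- through Cauchy–Schwarz.
  refine ⟨(P.endWeight * (R + ‖P.ydT‖) + P.runWeight * (P.T * R + √(P.T - 0) * ‖P.yd‖))
      * Real.exp (C * (P.T + √(P.T - 0) * ρ)), by positivity, ?_⟩
  intro y p u U hy hu hU hUρ hp t ht
  have hydi : IntervalIntegrable (fun s => ‖P.yd s‖) volume 0 P.T :=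
    (intervalIntegrable_of_memLp P.T_pos.le (Lp.memLp P.yd)).norm
  have hunorm : IntervalIntegrable (fun s => ‖u s‖) volume 0 P.T :=
    hu.norm.intervalIntegrable_of_Icc P.T_pos.le
  have hkc : ContinuousOn (fun s => C * (1 + ‖u s‖)) (Icc 0 P.T) :=
    continuousOn_const.mul (continuousOn_const.add hu.norm)
  have hφc : ContinuousOn (fun s => ‖rep p s‖) (Icc 0 P.T) := (continuous_rep p).norm.continuousOn
  have hhi : IntervalIntegrable (fun s => P.runWeight * (R + ‖P.yd s‖)) volume 0 P.T :=
    (intervalIntegrable_const.add hydi).const_mul _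
  refine gronwall_backward_of_forcing hkc hφc (fun s _ => by positivity) hhi
    (fun s => by positivity) (by positivity) ?_ ?_ ?_ ht
  · rw [intervalIntegral.integral_const_mul, intervalIntegral.integral_add (by simp) hydi,
      intervalIntegral.integral_const, smul_eq_mul, sub_zero]
    have := integral_norm_le_sqrt_mul P.T_pos.le P.yd
    rw [sub_zero] at this
    gcongr
  · rw [intervalIntegral.integral_const_mul, intervalIntegral.integral_add (by simp) hunorm,
      intervalIntegral.integral_const, smul_eq_mul, mul_one, sub_zero]
    have := integral_norm_le_of_ae_eq P.T_pos.le hU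
    rw [sub_zero] at this
    gcongr
    exact this.trans (mul_le_mul_of_nonneg_left hUρ (Real.sqrt_nonneg _))
  · intro t ht
    rw [hp.rep_eq ht]
    refine (norm_add_le _ _).trans (add_le_add ?_ ?_)
    · rw [hp.2]
      refine (norm_adjoint_comp_le (F := E n) _ _ _).trans ?_
      refine mul_le_mul_of_nonneg_left ?_ hq2
      exact (norm_sub_le _ _).trans (add_le_add (hy _ hT) le_rfl)
    · refine intervalIntegral.norm_integral_le_of_norm_le ht.2 ?_
        (intervalIntegrable_mono_Icc
          (((hkc.mul hφc).intervalIntegrable_of_Icc P.T_pos.le).add hhi) ht hT)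
      refine Eventually.of_forall fun s hs => ?_
      have hs' : s ∈ Icc 0 P.T := ⟨ht.1.trans hs.1.le, hs.2⟩
      refine (norm_adjointRhs_le hB hs' (hy s hs') _ _ _).trans ?_
      have := hy s hs'
      gcongr

theorem norm_adjointRhs_along_sub_le {R C B d : ℝ} (hB : P.DynamicsBounds R C)
    {y y' p p' : W 0 P.T n} {s : ℝ} (hs : s ∈ Icc 0 P.T) (hy : ‖rep y s‖ ≤ R)
    (hy' : ‖rep y' s‖ ≤ R) (hp' : ‖rep p' s‖ ≤ B) (hd : ‖rep y s - rep y' s‖ ≤ d)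
    (u u' : E m) (yd : E n) :
    ‖P.adjointRhs s (rep y s) u (rep p s) yd - P.adjointRhs s (rep y' s) u' (rep p' s) yd‖
      ≤ C * (1 + ‖u‖) * ‖rep p s - rep p' s‖
        + ((C * (1 + ‖u‖) * B + P.runWeight) * d + C * B * ‖u - u'‖) := by
  have hC := hB.nonneg
  have hq := P.runWeight_nonneg
  have hB0 := (norm_nonneg _).trans hp'
  refine (norm_adjointRhs_sub_le hB hs hy hy' _ _ _ _ _).trans ?_
  rw [add_assoc]
  gcongr

theorem AdjointEq.intervalIntegrable {y p : W 0 P.T n} {u : ℝ → E m} (h : P.AdjointEq y u p) :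
    IntervalIntegrable (fun s => P.adjointRhs s (rep y s) (u s) (rep p s) (P.yd s))
      volume 0 P.T := by
  refine ((intervalIntegrable_of_memLp P.T_pos.le (Lp.memLp (derivL2 p))).neg).congr_ae ?_
  rw [uIoc_of_le P.T_pos.le, ← restrict_Ioo_eq_restrict_Ioc]
  exact h.1

/-- Adjoint states depend Lipschitz continuously on the state and the control, in the maximum
norm. -/
theorem exists_adjoint_sup_stability {R C : ℝ} (hR : 0 ≤ R) (hB : P.DynamicsBounds R C) {ρ : ℝ}
    (hρ : 0 ≤ ρ) :
    ∃ K, 0 ≤ K ∧ ∀ (y y' p p' : W 0 P.T n) (u u' : ℝ → E m) (U U' : L2 0 P.T m) (d : ℝ),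
      (∀ t ∈ Icc 0 P.T, ‖rep y t‖ ≤ R) → (∀ t ∈ Icc 0 P.T, ‖rep y' t‖ ≤ R) →
      ContinuousOn u (Icc 0 P.T) → ContinuousOn u' (Icc 0 P.T) →
      U =ᵐ[intervalMeasure 0 P.T] u → U' =ᵐ[intervalMeasure 0 P.T] u' → ‖U‖ ≤ ρ → ‖U'‖ ≤ ρ →
      P.AdjointEq y u p → P.AdjointEq y' u' p' →
      (∀ t ∈ Icc 0 P.T, ‖rep y t - rep y' t‖ ≤ d) →
      ∀ t ∈ Icc 0 P.T, ‖rep p t - rep p' t‖ ≤ K * (d + ‖U - U'‖) := by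
  have hT := right_mem_Icc.mpr P.T_pos.le
  have h0 := left_mem_Icc.mpr P.T_pos.le
  have hC := hB.nonneg
  have hq := P.runWeight_nonneg
  have hq2 := P.endWeight_nonneg
  have hTp := P.T_pos
  obtain ⟨B, hB0, hBb⟩ := exists_adjoint_bound hR hB (ρ := ρ)
  obtain ⟨σ, hσ, hσ0⟩ : ∃ σ, σ = √(P.T - 0) ∧ 0 ≤ σ := ⟨_, rfl, Real.sqrt_nonneg _⟩
  -- The summands account for the terminal values, for the forcing caused by the state difference
  -- `d`, and for the forcing caused by the control difference. All depend on the controls only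
  -- through `ρ`.
  refine ⟨(P.endWeight + (C * B * (P.T + σ * ρ) + P.runWeight * P.T + C * B * σ))
    * Real.exp (C * (P.T + σ * ρ)), by positivity, ?_⟩
  intro y y' p p' u u' U U' d hy hy' hu hu' hU hU' hUρ hUρ' hp hp' hd t ht
  have hpb := hBb y' p' u' U' hy' hu' hU' hUρ' hp'
  have hd0 : 0 ≤ d := (norm_nonneg _).trans (hd 0 h0)
  have hUU : (U - U' : L2 0 P.T m) =ᵐ[intervalMeasure 0 P.T] fun s => u s - u' s := by
    filter_upwards [Lp.coeFn_sub U U', hU, hU'] with s h1 h2 h3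
    rw [h1, Pi.sub_apply, h2, h3]
  have hpt : ∀ s ∈ Icc 0 P.T,
      ‖P.adjointRhs s (rep y s) (u s) (rep p s) (P.yd s)
        - P.adjointRhs s (rep y' s) (u' s) (rep p' s) (P.yd s)‖
      ≤ C * (1 + ‖u s‖) * ‖rep p s - rep p' s‖
        + ((C * (1 + ‖u s‖) * B + P.runWeight) * d + C * B * ‖u s - u' s‖) := fun s hs =>
    norm_adjointRhs_along_sub_le hB hs (hy s hs) (hy' s hs) (hpb s hs) (hd s hs) _ _ _
  have hunorm : IntervalIntegrable (fun s => ‖u s‖) volume 0 P.T :=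
    hu.norm.intervalIntegrable_of_Icc P.T_pos.le
  have hudnorm : IntervalIntegrable (fun s => ‖u s - u' s‖) volume 0 P.T :=
    (hu.sub hu').norm.intervalIntegrable_of_Icc P.T_pos.le
  have hkc : ContinuousOn (fun s => C * (1 + ‖u s‖)) (Icc 0 P.T) :=
    continuousOn_const.mul (continuousOn_const.add hu.norm)
  have hki := hkc.intervalIntegrable_of_Icc (μ := volume) P.T_pos.le
  have hφc : ContinuousOn (fun s => ‖rep p s - rep p' s‖) (Icc 0 P.T) :=
    ((continuous_rep p).sub (continuous_rep p')).norm.continuousOn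
  have hkint : ∫ s in (0 : ℝ)..P.T, C * (1 + ‖u s‖) ≤ C * (P.T + σ * ρ) := by
    rw [intervalIntegral.integral_const_mul, intervalIntegral.integral_add (by simp) hunorm,
      intervalIntegral.integral_const, smul_eq_mul, mul_one, sub_zero]
    have := integral_norm_le_of_ae_eq P.T_pos.le hU
    rw [← hσ] at this
    gcongr
    exact this.trans (mul_le_mul_of_nonneg_left hUρ hσ0)
  have hhi : IntervalIntegrable (fun s => (C * (1 + ‖u s‖) * B + P.runWeight) * d
      + C * B * ‖u s - u' s‖) volume 0 P.T :=
    (((hki.mul_const B).add intervalIntegrable_const).mul_const d).add (hudnorm.const_mul _)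
  have hforce : ∫ s in (0 : ℝ)..P.T, ((C * (1 + ‖u s‖) * B + P.runWeight) * d
      + C * B * ‖u s - u' s‖)
      ≤ (C * B * (P.T + σ * ρ) + P.runWeight * P.T) * d + C * B * σ * ‖U - U'‖ := by
    have hcb : ∫ s in (0 : ℝ)..P.T, C * B * ‖u s - u' s‖
        = C * B * ∫ s in (0 : ℝ)..P.T, ‖u s - u' s‖ := intervalIntegral.integral_const_mul _ _
    rw [intervalIntegral.integral_add
      (((hki.mul_const B).add intervalIntegrable_const).mul_const d) (hudnorm.const_mul _),
      intervalIntegral.integral_mul_const, intervalIntegral.integral_add (hki.mul_const B)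
      intervalIntegrable_const, intervalIntegral.integral_mul_const,
      intervalIntegral.integral_const, hcb, smul_eq_mul, sub_zero]
    have h2 := integral_norm_le_of_ae_eq P.T_pos.le hUU
    have h3 := mul_le_mul_of_nonneg_right hkint hB0
    have h4 : (∫ s in (0 : ℝ)..P.T, C * (1 + ‖u s‖)) * B + P.T * P.runWeight
        ≤ C * B * (P.T + σ * ρ) + P.runWeight * P.T := by linarith
    have h5 := mul_le_mul_of_nonneg_right h4 hd0
    have h6 := mul_le_mul_of_nonneg_left h2 (mul_nonneg hC hB0)
    rw [← hσ] at h6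
    linarith
  have hgr : ‖rep p t - rep p' t‖ ≤ (P.endWeight * d + ((C * B * (P.T + σ * ρ)
      + P.runWeight * P.T) * d + C * B * σ * ‖U - U'‖)) * Real.exp (C * (P.T + σ * ρ)) := by
    refine gronwall_backward_of_forcing hkc hφc (fun s _ => by positivity) hhi
      (fun s => by positivity) (by positivity) hforce hkint ?_ ht
    intro t ht
    have e1 : rep p t - rep p' t = (rep p P.T - rep p' P.T)
        + ∫ s in t..P.T, (P.adjointRhs s (rep y s) (u s) (rep p s) (P.yd s)
          - P.adjointRhs s (rep y' s) (u' s) (rep p' s) (P.yd s)) := by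
      rw [intervalIntegral.integral_sub (intervalIntegrable_mono_Icc hp.intervalIntegrable ht hT)
        (intervalIntegrable_mono_Icc hp'.intervalIntegrable ht hT), hp.rep_eq ht, hp'.rep_eq ht]
      abel
    rw [e1]
    refine (norm_add_le _ _).trans (add_le_add ?_ ?_)
    · rw [hp.2, hp'.2, ← map_sub, ← map_sub, sub_sub_sub_cancel_right]
      exact (norm_adjoint_comp_le (F := E n) _ _ _).trans
        (mul_le_mul_of_nonneg_left (hd _ hT) hq2)
    · refine intervalIntegral.norm_integral_le_of_norm_le ht.2 ?_
        (intervalIntegrable_mono_Icc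
          (((hkc.mul hφc).intervalIntegrable_of_Icc P.T_pos.le).add hhi) ht hT)
      exact Eventually.of_forall fun s hs => hpt s ⟨ht.1.trans hs.1.le, hs.2⟩
  refine hgr.trans ?_
  rw [mul_right_comm _ (Real.exp _) (d + _)]
  refine mul_le_mul_of_nonneg_right ?_ (Real.exp_pos _).le
  have he0 := norm_nonneg (U - U')
  have h1 := mul_nonneg hq2 he0
  have h2 : 0 ≤ (C * B * (P.T + σ * ρ) + P.runWeight * P.T) * ‖U - U'‖ := by positivity
  have h3 : 0 ≤ C * B * σ * d := by positivity
  linarith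

/-- Adjoint states depend Lipschitz continuously on the state and the control. -/
theorem exists_adjoint_stability {R C : ℝ} (hR : 0 ≤ R) (hB : P.DynamicsBounds R C) {ρ : ℝ}
    (hρ : 0 ≤ ρ) :
    ∃ K, 0 ≤ K ∧ ∀ (y y' p p' : W 0 P.T n) (u u' : ℝ → E m) (U U' : L2 0 P.T m) (d : ℝ),
      (∀ t ∈ Icc 0 P.T, ‖rep y t‖ ≤ R) → (∀ t ∈ Icc 0 P.T, ‖rep y' t‖ ≤ R) →
      ContinuousOn u (Icc 0 P.T) → ContinuousOn u' (Icc 0 P.T) →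
      U =ᵐ[intervalMeasure 0 P.T] u → U' =ᵐ[intervalMeasure 0 P.T] u' → ‖U‖ ≤ ρ → ‖U'‖ ≤ ρ →
      P.AdjointEq y u p → P.AdjointEq y' u' p' →
      (∀ t ∈ Icc 0 P.T, ‖rep y t - rep y' t‖ ≤ d) → ‖p - p'‖ ≤ K * (d + ‖U - U'‖) := by
  have h0 := left_mem_Icc.mpr P.T_pos.le
  have hC := hB.nonneg
  have hq := P.runWeight_nonneg
  have hTp := P.T_pos
  obtain ⟨B, hB0, hBb⟩ := exists_adjoint_bound hR hB (ρ := ρ)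
  obtain ⟨K₁, hK₁, hK⟩ := exists_adjoint_sup_stability hR hB hρ
  obtain ⟨σ, hσ, hσ0⟩ : ∃ σ, σ = √(P.T - 0) ∧ 0 ≤ σ := ⟨_, rfl, Real.sqrt_nonneg _⟩
  refine ⟨σ * K₁ + (P.T - 0 + 1) * (σ * (C * K₁ + C * B + P.runWeight)
    + (C * K₁ + C * B) * ρ + C * B), by rw [sub_zero]; positivity, ?_⟩
  intro y y' p p' u u' U U' d hy hy' hu hu' hU hU' hUρ hUρ' hp hp' hd
  have hpb := hBb y' p' u' U' hy' hu' hU' hUρ' hp'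
  have hsup := hK y y' p p' u u' U U' d hy hy' hu hu' hU hU' hUρ hUρ' hp hp' hd
  have hd0 : 0 ≤ d := (norm_nonneg _).trans (hd 0 h0)
  have hUU : (U - U' : L2 0 P.T m) =ᵐ[intervalMeasure 0 P.T] fun s => u s - u' s := by
    filter_upwards [Lp.coeFn_sub U U', hU, hU'] with s h1 h2 h3
    rw [h1, Pi.sub_apply, h2, h3]
  obtain ⟨e, he, he0⟩ : ∃ e, e = ‖U - U'‖ ∧ 0 ≤ e := ⟨_, rfl, norm_nonneg _⟩
  rw [← he] at hsup ⊢
  -- Inserting the maximum norm estimate into the two equations bounds the derivative pointwise by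
  -- an affine function of `‖u‖` and `‖u - u'‖`, to which Minkowski's inequality applies.
  have hderiv : ‖derivL2 (p - p')‖ ≤ σ * (C * (K₁ * (d + e)) + (C * B + P.runWeight) * d)
      + (C * (K₁ * (d + e)) + C * B * d) * ‖U‖ + C * B * e := by
    rw [hσ, he]
    rw [he] at hsup
    refine norm_Lp_le_of_affine_bound P.T_pos.le _ U (U - U') (by positivity) (by positivity)
      (by positivity) ?_
    filter_upwards [hp.1, hp'.1, Lp.coeFn_sub (derivL2 p) (derivL2 p'), hU, hUU,
      ae_restrict_mem measurableSet_Ioo] with s h1 h2 h3 h4 h5 hs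
    have hs' := Ioo_subset_Icc_self hs
    have h1' : P.adjointRhs s (rep y s) (u s) (rep p s) (P.yd s) = -(derivL2 p s) := h1.symm
    have h2' : P.adjointRhs s (rep y' s) (u' s) (rep p' s) (P.yd s) = -(derivL2 p' s) := h2.symm
    have e1 : derivL2 (p - p') s
        = -(P.adjointRhs s (rep y s) (u s) (rep p s) (P.yd s)
          - P.adjointRhs s (rep y' s) (u' s) (rep p' s) (P.yd s)) := by
      rw [derivL2_sub, h3, Pi.sub_apply, h1', h2']
      abel
    rw [e1, norm_neg, h4, h5]
    refine (norm_adjointRhs_along_sub_le hB hs' (hy s hs') (hy' s hs') (hpb s hs') (hd s hs')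
      _ _ _).trans ?_
    have h6 := mul_le_mul_of_nonneg_left (hsup s hs')
      (by positivity : 0 ≤ C * (1 + ‖u s‖))
    linarith
  have hfin := norm_W_le_of_rep P.T_pos (p - p') h0
  rw [rep_sub P.T_pos p p' h0, ← hσ] at hfin
  have h1 := mul_le_mul_of_nonneg_left (hsup 0 h0) hσ0
  have a1 : (C * (K₁ * (d + e)) + C * B * d) * ‖U‖
      ≤ (C * (K₁ * (d + e)) + C * B * (d + e)) * ρ := by
    gcongr
    linarith
  have a2 : (C * B + P.runWeight) * d ≤ (C * B + P.runWeight) * (d + e) := by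
    gcongr
    linarith
  have a3 : C * B * e ≤ C * B * (d + e) := by
    gcongr
    linarith
  have a4 := mul_le_mul_of_nonneg_left a2 hσ0
  have h2 : ‖derivL2 (p - p')‖
      ≤ (σ * (C * K₁ + C * B + P.runWeight) + (C * K₁ + C * B) * ρ + C * B) * (d + e) := by
    linarith
  have h3 := mul_le_mul_of_nonneg_left h2 (by linarith : 0 ≤ P.T - 0 + 1)
  linarith

end ControlProblem

namespace ControlProblem

variable {n m : ℕ} {P : ControlProblem n m} {Y₀ : Set (E n)} {M : ℝ}

/-! ### The adjoint state is the gradient of the value function -/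

theorem half_norm_sq_sub {k : ℕ} (Q : E n →L[ℝ] E k) (Y y z : E n) :
    1 / 2 * ‖Q (Y - z)‖ ^ 2 - 1 / 2 * ‖Q (y - z)‖ ^ 2
      = inner ℝ (Q.adjoint (Q (y - z))) (Y - y) + 1 / 2 * ‖Q (Y - y)‖ ^ 2 := by
  have e : Q (Y - z) = Q (y - z) + Q (Y - y) := by
    rw [← map_add]; congr 1; abel
  rw [e, norm_add_sq_real, ContinuousLinearMap.adjoint_inner_left]
  ring

/-- The adjoint equation is made so that all first order terms in `Y - y` cancel. What is left is a
quadratic term and the Taylor remainders of `f` and `g`, for one and the same control. -/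
theorem running_cost_expansion (t : ℝ) (Y y p yd : E n) (u : E m) :
    1 / 2 * ‖P.Q₁ (Y - yd)‖ ^ 2 - 1 / 2 * ‖P.Q₁ (y - yd)‖ ^ 2
      + (inner ℝ (-P.adjointRhs t y u p yd) (Y - y)
        + inner ℝ p (P.f t Y + P.g t Y u - (P.f t y + P.g t y u)))
      = 1 / 2 * ‖P.Q₁ (Y - y)‖ ^ 2
        + inner ℝ p ((P.f t Y - P.f t y - fderiv ℝ (P.f t) y (Y - y))
          + (P.g t Y - P.g t y - fderiv ℝ (P.g t) y (Y - y)) u) := by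
  rw [half_norm_sq_sub]
  simp only [adjointRhs, inner_neg_left, inner_add_left, ContinuousLinearMap.adjoint_inner_left,
    ContinuousLinearMap.flip_apply, inner_add_right, inner_sub_right, sub_apply, map_sub]
  ring

theorem running_cost_expansion_le {R C B ν t : ℝ} (hB : P.DynamicsBounds R C)
    (ht : t ∈ Icc 0 P.T) {Y y p : E n} (hY : ‖Y‖ ≤ R) (hy : ‖y‖ ≤ R) (hp : ‖p‖ ≤ B) {u : E m}
    (hu : ‖u‖ ≤ ν) (yd : E n) :
    ‖1 / 2 * ‖P.Q₁ (Y - yd)‖ ^ 2 - 1 / 2 * ‖P.Q₁ (y - yd)‖ ^ 2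
      + (inner ℝ (-P.adjointRhs t y u p yd) (Y - y)
        + inner ℝ p (P.f t Y + P.g t Y u - (P.f t y + P.g t y u)))‖
      ≤ (1 / 2 * ‖P.Q₁‖ ^ 2 + B * (C * (1 + ν))) * ‖Y - y‖ ^ 2 := by
  have hC := hB.nonneg
  have hB0 := (norm_nonneg _).trans hp
  rw [running_cost_expansion]
  have h1 : ‖P.Q₁ (Y - y)‖ ^ 2 ≤ ‖P.Q₁‖ ^ 2 * ‖Y - y‖ ^ 2 := by
    rw [← mul_pow]
    exact pow_le_pow_left₀ (norm_nonneg _) (P.Q₁.le_opNorm _) 2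
  have h2 := hB.f.taylor t ht Y y hY hy
  have h3 := hB.g.taylor t ht Y y hY hy
  have h4 : ‖(P.f t Y - P.f t y - fderiv ℝ (P.f t) y (Y - y))
      + (P.g t Y - P.g t y - fderiv ℝ (P.g t) y (Y - y)) u‖ ≤ C * (1 + ν) * ‖Y - y‖ ^ 2 := by
    refine (norm_add_le _ _).trans ?_
    have h5 := ContinuousLinearMap.le_opNorm
      (P.g t Y - P.g t y - fderiv ℝ (P.g t) y (Y - y)) u
    have h6 := mul_le_mul h3 hu (norm_nonneg _) (by positivity)
    linarith
  refine (norm_add_le _ _).trans ?_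
  have h7 := (norm_inner_le_norm (𝕜 := ℝ) p _).trans (mul_le_mul hp h4 (norm_nonneg _) hB0)
  rw [Real.norm_of_nonneg (by positivity : 0 ≤ 1 / 2 * ‖P.Q₁ (Y - y)‖ ^ 2)]
  linarith

/-- First order expansion of the cost in the initial state, with the control fixed. -/
theorem FeedbackAssumption.exists_cost_expansion (hP : P.FeedbackAssumption Y₀ M) {R : ℝ}
    (y p : W 0 P.T n) {u : ℝ → E m} (hu : ContinuousOn u (Icc 0 P.T))
    (hy : ∀ t ∈ Icc 0 P.T, ‖rep y t‖ ≤ R) (hp : P.AdjointEq y u p) {t₀ : ℝ}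
    (ht₀ : t₀ ∈ Ico 0 P.T) (Λ : ℝ) :
    ∃ c, ∀ (Y : ℝ → E n) (h : E n), Continuous Y →
      (∀ s ∈ Icc t₀ P.T, ‖Y s‖ ≤ R ∧ ‖Y s - rep y s‖ ≤ Λ * ‖h‖) →
      (∀ s ∈ Icc t₀ P.T, Y s = (rep y t₀ + h) + ∫ r in t₀..s, P.velocity Y u r) →
      (∀ s ∈ Icc t₀ P.T, rep y s = rep y t₀ + ∫ r in t₀..s, P.velocity (rep y) u r) →
      P.cost t₀ Y u ≤ P.cost t₀ (rep y) u + inner ℝ (rep p t₀) h + c * ‖h‖ ^ 2 := by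
  obtain ⟨C, hB⟩ := hP.exists_dynamicsBounds R
  obtain ⟨ν, hν⟩ := isCompact_Icc.exists_bound_of_continuousOn hu
  obtain ⟨B, hBp⟩ := isCompact_Icc.exists_bound_of_continuousOn
    (continuous_rep p).continuousOn (s := Icc 0 P.T)
  have hsub : Icc t₀ P.T ⊆ Icc 0 P.T := Icc_subset_Icc_left ht₀.1
  have hTt : P.T ∈ Icc t₀ P.T := right_mem_Icc.mpr ht₀.2.le
  have htt : t₀ ∈ Icc t₀ P.T := left_mem_Icc.mpr ht₀.2.le
  have h0t := Ico_subset_Icc_self ht₀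
  have hT : P.T ∈ Icc 0 P.T := right_mem_Icc.mpr P.T_pos.le
  have hC := hB.nonneg
  have hB0 : 0 ≤ B := (norm_nonneg _).trans (hBp _ hT)
  have hν0 : 0 ≤ ν := (norm_nonneg _).trans (hν _ hT)
  -- Quadratic error density of the running cost, after `‖Y - y‖ ≤ Λ * ‖h‖` has been inserted; it
  -- does not depend on `h` or `Y`.
  set c₁ := (1 / 2 * ‖P.Q₁‖ ^ 2 + B * (C * (1 + ν))) * Λ ^ 2 with hc₁
  refine ⟨c₁ * (P.T - t₀) + 1 / 2 * (‖P.Q₂‖ ^ 2 * Λ ^ 2), ?_⟩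
  intro Y h hY hYb hYe hye
  have hf := hP.f_smooth.continuousOn
  have hg := hP.g_smooth.continuousOn
  have hu' : MemLp u 2 (intervalMeasure t₀ P.T) := memLp_of_continuousOn_Icc (hu.mono hsub)
  have hv1 := intervalIntegrable_of_memLp ht₀.2.le
    (memLp_velocity hf hg ht₀.1 le_rfl hY.continuousOn hu')
  have hv2 := intervalIntegrable_of_memLp ht₀.2.le
    (memLp_velocity hf hg ht₀.1 le_rfl (continuous_rep y).continuousOn hu')
  have hw : IntervalIntegrable (fun s => -P.adjointRhs s (rep y s) (u s) (rep p s) (P.yd s))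
      volume t₀ P.T := (intervalIntegrable_mono_Icc hp.intervalIntegrable h0t hT).neg
  have hδ : ∀ s ∈ Icc t₀ P.T, Y s - rep y s = (Y t₀ - rep y t₀)
      + ∫ r in t₀..s, (P.velocity Y u r - P.velocity (rep y) u r) := by
    intro s hs
    rw [intervalIntegral.integral_sub (intervalIntegrable_mono_Icc hv1 htt hs)
      (intervalIntegrable_mono_Icc hv2 htt hs), hYe s hs, hye s hs, hYe t₀ htt]
    simp only [intervalIntegral.integral_same]
    abel
  have hpe : ∀ s ∈ Icc t₀ P.T, rep p s = rep p t₀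
      + ∫ r in t₀..s, -P.adjointRhs r (rep y r) (u r) (rep p r) (P.yd r) := by
    intro s hs
    rw [hp.rep_eq (hsub hs), hp.rep_eq h0t, intervalIntegral.integral_neg,
      ← intervalIntegral.integral_add_adjacent_intervals
      (intervalIntegrable_mono_Icc hp.intervalIntegrable h0t (hsub hs))
      (intervalIntegrable_mono_Icc hp.intervalIntegrable (hsub hs) hT)]
    abel
  have hip := inner_sub_inner_eq_integral ht₀.2.le hw (hv1.sub hv2) hpe hδ
  have hYt : Y t₀ - rep y t₀ = h := by rw [hYe t₀ htt]; simp
  rw [hYt] at hip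
  have i1 := (intervalIntegrable_iff_integrableOn_Ioo_of_le ht₀.2.le).mpr
    (integrable_cost ht₀.1 hY.continuousOn hu')
  have i2 := (intervalIntegrable_iff_integrableOn_Ioo_of_le ht₀.2.le).mpr
    (integrable_cost ht₀.1 (continuous_rep y).continuousOn hu')
  have i3 : IntervalIntegrable (fun s =>
      inner ℝ (-P.adjointRhs s (rep y s) (u s) (rep p s) (P.yd s)) (Y s - rep y s)
        + inner ℝ (rep p s) (P.velocity Y u s - P.velocity (rep y) u s)) volume t₀ P.T := by
    have hin : ∀ {q z : ℝ → E n}, Continuous q → IntervalIntegrable z volume t₀ P.T →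
        IntervalIntegrable (fun s => inner ℝ (q s) (z s)) volume t₀ P.T := by
      intro q z hq hz
      obtain ⟨D, hD⟩ := isCompact_Icc.exists_bound_of_continuousOn hq.continuousOn
        (s := Icc t₀ P.T)
      rw [intervalIntegrable_iff_integrableOn_Ioo_of_le ht₀.2.le] at hz ⊢
      refine (hz.norm.const_mul D).mono' (hq.aestronglyMeasurable.inner hz.1) ?_
      filter_upwards [ae_restrict_mem measurableSet_Ioo] with s hs
      exact (norm_inner_le_norm _ _).trans
        (mul_le_mul_of_nonneg_right (hD s (Ioo_subset_Icc_self hs)) (norm_nonneg _))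
    refine IntervalIntegrable.add ?_ (hin (continuous_rep p) (hv1.sub hv2))
    have e : (fun s => inner ℝ (-P.adjointRhs s (rep y s) (u s) (rep p s) (P.yd s))
        (Y s - rep y s)) = fun s => inner ℝ (Y s - rep y s)
        (-P.adjointRhs s (rep y s) (u s) (rep p s) (P.yd s)) :=
      funext fun s => real_inner_comm _ _
    rw [e]
    exact hin (hY.sub (continuous_rep y)) hw
  -- Integration by parts trades `⟨p(t₀), h⟩` for a boundary term at `T`, which the terminal
  -- condition of `p` matches with the first order part of the terminal cost. Only second order
  -- quantities remain on the right.
  have hmain : P.cost t₀ Y u - P.cost t₀ (rep y) u - inner ℝ (rep p t₀) h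
      = (∫ s in t₀..P.T, (1 / 2 * ‖P.Q₁ (Y s - P.yd s)‖ ^ 2
          - 1 / 2 * ‖P.Q₁ (rep y s - P.yd s)‖ ^ 2
        + (inner ℝ (-P.adjointRhs s (rep y s) (u s) (rep p s) (P.yd s)) (Y s - rep y s)
          + inner ℝ (rep p s) (P.velocity Y u s - P.velocity (rep y) u s))))
        + 1 / 2 * ‖P.Q₂ (Y P.T - rep y P.T)‖ ^ 2 := by
    have e1 : ∀ s, 1 / 2 * ‖P.Q₁ (Y s - P.yd s)‖ ^ 2 - 1 / 2 * ‖P.Q₁ (rep y s - P.yd s)‖ ^ 2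
        = 1 / 2 * ((‖P.Q₁ (Y s - P.yd s)‖ ^ 2 + P.β * ‖u s‖ ^ 2)
          - (‖P.Q₁ (rep y s - P.yd s)‖ ^ 2 + P.β * ‖u s‖ ^ 2)) := fun s => by ring
    simp only [e1]
    rw [intervalIntegral.integral_add ((i1.sub i2).const_mul _) i3,
      intervalIntegral.integral_const_mul, intervalIntegral.integral_sub i1 i2, ← hip, hp.2,
      intervalIntegral.integral_of_le ht₀.2.le, intervalIntegral.integral_of_le ht₀.2.le,
      integral_Ioc_eq_integral_Ioo, integral_Ioc_eq_integral_Ioo]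
    have e2 := half_norm_sq_sub P.Q₂ (Y P.T) (rep y P.T) P.ydT
    unfold cost
    linarith
  have hint : ‖∫ s in t₀..P.T, (1 / 2 * ‖P.Q₁ (Y s - P.yd s)‖ ^ 2
          - 1 / 2 * ‖P.Q₁ (rep y s - P.yd s)‖ ^ 2
        + (inner ℝ (-P.adjointRhs s (rep y s) (u s) (rep p s) (P.yd s)) (Y s - rep y s)
          + inner ℝ (rep p s) (P.velocity Y u s - P.velocity (rep y) u s)))‖
      ≤ c₁ * ‖h‖ ^ 2 * |P.T - t₀| := by
    refine intervalIntegral.norm_integral_le_of_norm_le_const fun s hs => ?_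
    rw [uIoc_of_le ht₀.2.le] at hs
    have hs' : s ∈ Icc t₀ P.T := Ioc_subset_Icc_self hs
    refine (running_cost_expansion_le hB (hsub hs') (hYb s hs').1 (hy s (hsub hs'))
      (hBp s (hsub hs')) (hν s (hsub hs')) _).trans ?_
    rw [hc₁, mul_assoc, ← mul_pow]
    refine mul_le_mul_of_nonneg_left ?_ (by positivity)
    exact pow_le_pow_left₀ (norm_nonneg _) (hYb s hs').2 2
  have hend : ‖P.Q₂ (Y P.T - rep y P.T)‖ ^ 2 ≤ ‖P.Q₂‖ ^ 2 * Λ ^ 2 * ‖h‖ ^ 2 := by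
    rw [mul_assoc, ← mul_pow, ← mul_pow]
    refine pow_le_pow_left₀ (norm_nonneg _) ((P.Q₂.le_opNorm _).trans ?_) 2
    exact mul_le_mul_of_nonneg_left (hYb _ hTt).2 (norm_nonneg _)
  rw [abs_of_nonneg (by linarith [ht₀.2])] at hint
  have := (le_abs_self _).trans hint
  linarith

/-- Along a minimizing pair with continuous control, the adjoint state is the gradient of the value
function. -/
theorem FeedbackAssumption.valueGrad_eq_adjoint (hP : P.FeedbackAssumption Y₀ M) {y₀ : E n}
    {y p : W 0 P.T n} {U : L2 0 P.T m} (hopt : P.IsOptimalPair y₀ y U) {u : ℝ → E m}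
    (hu : ContinuousOn u (Icc 0 P.T)) (hU : U =ᵐ[intervalMeasure 0 P.T] u)
    (hy : ∀ t ∈ Icc 0 P.T, ‖rep y t‖ ≤ P.radius M / 2) (hp : P.AdjointEq y u p) {t₀ : ℝ}
    (ht₀ : t₀ ∈ Ico 0 P.T) : P.valueGrad M t₀ (rep y t₀) = innerSL ℝ (rep p t₀) := by
  have hr := hP.radius_nonneg
  set r := P.radius M with hrdef
  obtain ⟨C, hB⟩ := hP.exists_dynamicsBounds r
  obtain ⟨ν, hν⟩ := isCompact_Icc.exists_bound_of_continuousOn hu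
  have hf := hP.f_smooth.continuousOn
  have hg := hP.g_smooth.continuousOn
  have hsub : Icc t₀ P.T ⊆ Icc 0 P.T := Icc_subset_Icc_left ht₀.1
  have h0t := Ico_subset_Icc_self ht₀
  have h0 : (0 : ℝ) ∈ Icc 0 P.T := left_mem_Icc.mpr P.T_pos.le
  have hC := hB.nonneg
  have hν0 : 0 ≤ ν := (norm_nonneg _).trans (hν _ h0)
  have hyr : ∀ t ∈ Icc 0 P.T, ‖rep y t‖ ≤ r := fun t ht => (hy t ht).trans (by linarith)
  set K := C * (1 + ν) with hK
  have hK0 : 0 ≤ K := by positivity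
  set Λ := Real.exp (2 * K * (P.T - t₀)) with hΛ
  have hΛ0 : 0 < Λ := Real.exp_pos _
  have hu' : MemLp u 2 (intervalMeasure t₀ P.T) := memLp_of_continuousOn_Icc (hu.mono hsub)
  have hst : P.StateEq y u y₀ := hopt.1.congr hU
  have hvel := intervalIntegrable_of_memLp P.T_pos.le
    (memLp_velocity hf hg le_rfl le_rfl (continuous_rep y).continuousOn
      (memLp_of_continuousOn_Icc hu))
  have hye : ∀ s ∈ Icc t₀ P.T, rep y s = rep y t₀ + ∫ r in t₀..s, P.velocity (rep y) u r := by
    intro s hs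
    rw [hst.rep_eq P.T_pos (hsub hs), hst.rep_eq P.T_pos h0t, add_assoc,
      intervalIntegral.integral_add_adjacent_intervals
      (intervalIntegrable_mono_Icc hvel h0 h0t) (intervalIntegrable_mono_Icc hvel h0t (hsub hs))]
  obtain ⟨c, hc⟩ := hP.exists_cost_expansion y p hu hyr hp ht₀ Λ
  have hval : P.valueFunction t₀ (rep y t₀) = P.cost t₀ (rep y) u := by
    rw [hP.value_eq_cost hopt ht₀]
    exact cost_congr ht₀.2.le (fun _ _ => rfl)
      (ae_mono (Measure.restrict_mono (Ioo_subset_Ioo_left ht₀.1) le_rfl) hU)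
  have hHL : ∀ t ∈ Icc 0 P.T, ∀ x x' : E n, ‖x‖ ≤ r → ‖x'‖ ≤ r →
      ‖(P.f t x + P.g t x (u t)) - (P.f t x' + P.g t x' (u t))‖ ≤ K * ‖x - x'‖ := by
    intro t ht x x' hx hx'
    have e : (P.f t x + P.g t x (u t)) - (P.f t x' + P.g t x' (u t))
        = (P.f t x - P.f t x') + (P.g t x - P.g t x') (u t) := by
      rw [sub_apply]; abel
    have h1 := hB.f.lip t ht x x' hx hx'
    have h2 := (P.g t x - P.g t x').le_opNorm (u t)
    have h3 := mul_le_mul (hB.g.lip t ht x x' hx hx') (hν t ht) (norm_nonneg _) (by positivity)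
    rw [e]
    refine (norm_add_le _ _).trans ?_
    rw [hK]
    linarith
  -- The optimal control is kept and only the state at `t₀` is moved by `h`. For small `h` the
  -- trajectory stays in the ball, because the unperturbed one lies in the half ball, and its cost
  -- is an upper bound for the value.
  have hloc : ∀ᶠ h in 𝓝 (0 : E n), P.valueFunction t₀ (rep y t₀ + h)
      ≤ P.valueFunction t₀ (rep y t₀) + inner ℝ (rep p t₀) h + c * ‖h‖ ^ 2 := by
    have hsm : ∀ᶠ h in 𝓝 (0 : E n), Subsingleton (E n) ∨ ‖h‖ * Λ ≤ r / 2 := by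
      rcases hP.subsingleton_or_radius_pos with hs | hs
      · exact Eventually.of_forall fun _ => Or.inl hs
      · have h1 : Tendsto (fun h : E n => ‖h‖ * Λ) (𝓝 0) (𝓝 0) := by
          have : Continuous fun h : E n => ‖h‖ * Λ := by fun_prop
          simpa using this.tendsto 0
        filter_upwards [h1.eventually_le_const (by positivity : 0 < r / 2)] with h hh
        exact Or.inr hh
    filter_upwards [hsm] with h hh
    -- Here the right-hand sides coincide, so `η = 0`, and the distance to the original trajectory
    -- is at most `‖h‖ * Λ`.
    obtain ⟨Y, hY, hYp⟩ := exists_tracking_solution ht₀.2.le hr le_rfl hK0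
      (H := fun s x => P.f s x + P.g s x (u s)) (η := 0) (η' := ‖h‖) (K' := K)
      (Y₀ := rep y) (H₀ := P.velocity (rep y) u) (x₀ := rep y t₀ + h)
      (by
        have h1 : ContinuousOn (fun x : ℝ × E n => u x.1) (Icc t₀ P.T ×ˢ Metric.closedBall 0 r) :=
          hu.comp continuousOn_fst fun x hx => hsub hx.1
        have h2 : Icc t₀ P.T ×ˢ Metric.closedBall (0 : E n) r ⊆ Icc 0 P.T ×ˢ univ :=
          prod_mono hsub (subset_univ _)
        exact (hf.mono h2).add ((hg.mono h2).clm_apply h1))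
      (fun t ht x hx x' hx' => hHL t (hsub ht) x x' (by simpa using hx) (by simpa using hx'))
      (continuous_rep y).continuousOn
      (intervalIntegrable_mono_Icc hvel h0t (right_mem_Icc.mpr P.T_pos.le)) hye
      (fun t ht => hyr t (hsub ht))
      (fun t ht x hx => by
        rw [zero_add]
        exact hHL t (hsub ht) x _ (by simpa using hx) (hyr t (hsub ht)))
      (by simp)
      (fun t ht x hx => by
        rcases hh with hh | hh
        · rw [Subsingleton.elim x 0, norm_zero]; exact hr
        · have h1 := hy t (hsub ht)
          have h2 := norm_le_norm_add_norm_sub' x (rep y t)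
          rw [zero_mul, add_zero] at hx
          linarith)
    simp only [zero_mul, add_zero] at hYp
    have hYe : ∀ s ∈ Icc t₀ P.T, Y s = (rep y t₀ + h) + ∫ r in t₀..s, P.velocity Y u r :=
      fun s hs => (hYp s hs).2.2
    have h1 := hc Y h hY (fun s hs => ⟨(hYp s hs).1, by
      rw [mul_comm]; exact (hYp s hs).2.1⟩) hYe hye
    rw [hval]
    exact (hP.value_le ht₀ hY.continuousOn hu' hYe).trans h1
  -- The upper bound is an equality at `h = 0`. Fermat's rule identifies the two linear forms, the
  -- quadratic term having derivative zero at the origin.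
  have hmax : IsLocalMax (fun h : E n => P.valueFunction t₀ (rep y t₀ + h)
      - innerSL ℝ (rep p t₀) h - c * ‖h‖ ^ 2) 0 := by
    filter_upwards [hloc] with h hh
    simp only [add_zero, map_zero, norm_zero, innerSL_apply_apply]
    have e0 : c * (0 : ℝ) ^ 2 = 0 := by ring
    rw [e0]
    linarith
  have hd1 : HasFDerivAt (fun h : E n => P.valueFunction t₀ (rep y t₀ + h))
      (P.valueGrad M t₀ (rep y t₀)) 0 := by
    have h1 := hP.hasFDerivAt_value h0t (hy t₀ h0t)
    have h2 : HasFDerivAt (fun h : E n => rep y t₀ + h) (ContinuousLinearMap.id ℝ (E n)) 0 :=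
      (hasFDerivAt_id 0).const_add _
    rw [← add_zero (rep y t₀)] at h1
    have h3 := HasFDerivAt.comp (0 : E n) h1 h2
    rw [add_zero, ContinuousLinearMap.comp_id] at h3
    exact h3
  have hd2 : HasFDerivAt (fun h : E n => c * ‖h‖ ^ 2) (0 : E n →L[ℝ] ℝ) 0 := by
    have h1 := ((hasStrictFDerivAt_norm_sq (0 : E n)).hasFDerivAt).const_mul c
    refine h1.congr_fderiv ?_
    simp
  have hd := (hd1.sub (innerSL ℝ (rep p t₀)).hasFDerivAt).sub hd2
  have := hmax.hasFDerivAt_eq_zero hd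
  rw [sub_zero, sub_eq_zero] at this
  exact this

end ControlProblem

namespace ControlProblem

variable {n m : ℕ} {P : ControlProblem n m} {Y₀ : Set (E n)} {M : ℝ}

/-! ### The optimal trajectory of the exact feedback law -/

/-- A minimizing pair `(y,U)` generated by the feedback law of the value function, with the
continuous representative `u` of its control and its adjoint state `p`. -/
structure OptimalTrajectory (P : ControlProblem n m) (M : ℝ) (y₀ : E n) (y p : W 0 P.T n)
    (u : ℝ → E m) (U : L2 0 P.T m) : Prop where
  continuousOn : ContinuousOn u (Icc 0 P.T)
  eq_law : ∀ t ∈ Icc 0 P.T, u t = P.law t (rep y t) (P.valueGrad M t (rep y t))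
  ae_eq : U =ᵐ[intervalMeasure 0 P.T] u
  optimal : P.IsOptimalPair y₀ y U
  norm_le : ∀ t ∈ Icc 0 P.T, ‖rep y t‖ ≤ P.radius M / 2
  adjoint : P.AdjointEq y u p

/-- The bound `‖y‖ ≤ M` and the embedding constant put the trajectory into the half ball. There the
feedback of the value function is given by `valueGrad`, which is continuous; hence the optimal
control has a continuous representative. -/
theorem FeedbackAssumption.exists_optimalTrajectory (hP : P.FeedbackAssumption Y₀ M) {y₀ : E n}
    (hy₀ : y₀ ∈ Y₀) : ∃ y p u U, P.OptimalTrajectory M y₀ y p u U := by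
  obtain ⟨y, ⟨hcl, hyM⟩, -⟩ := hP.closedLoop y₀ hy₀
  have hy : ∀ t ∈ Icc 0 P.T, ‖rep y t‖ ≤ P.radius M / 2 := by
    intro t ht
    have h1 := norm_rep_le P.T_pos y ht
    have h2 := mul_le_mul_of_nonneg_left hyM (embeddingNorm_nonneg 0 P.T n)
    unfold radius
    linarith
  have hr := hP.radius_nonneg
  set u : ℝ → E m := fun t => P.law t (rep y t) (P.valueGrad M t (rep y t)) with hu
  have hG : ContinuousOn (fun t => P.valueGrad M t (rep y t)) (Icc 0 P.T) :=
    hP.continuousOn_valueGrad.comp (continuousOn_id.prodMk (continuous_rep y).continuousOn)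
      fun t ht => ⟨ht, by
        rw [mem_closedBall_zero_iff]
        exact (hy t ht).trans (by linarith)⟩
  have huc : ContinuousOn u (Icc 0 P.T) :=
    continuousOn_law hP continuousOn_id (mapsTo_id _) (continuous_rep y).continuousOn hG
  have hfb : ∀ t ∈ Icc 0 P.T, P.feedback P.valueFunction (rep y) t = u t := by
    intro t ht
    rw [feedback_eq_law, (hP.hasFDerivAt_value ht (hy t ht)).fderiv]
  have hmem : MemLp (P.feedback P.valueFunction (rep y)) 2 (intervalMeasure 0 P.T) :=
    memLp_of_continuousOn_Icc (huc.congr hfb)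
  have hU : P.feedbackL2 P.valueFunction y =ᵐ[intervalMeasure 0 P.T] u := by
    rw [feedbackL2, dif_pos hmem]
    filter_upwards [hmem.coeFn_toLp, ae_restrict_mem measurableSet_Ioo] with t ht hm
    rw [ht, hfb t (Ioo_subset_Icc_self hm)]
  obtain ⟨p, hp⟩ := hP.exists_adjoint y huc
  exact ⟨y, p, u, _, huc, fun _ _ => rfl, hU, hP.optimal y₀ hy₀ y hcl hyM, hy, hp⟩

/-! ### Approximate feedback laws -/

section Approximation

variable {v : ℝ → E n → ℝ}

theorem hasFDerivAt_slice (hv : ContDiff ℝ 4 (fun x : ℝ × E n => v x.1 x.2)) (t : ℝ) (y : E n) :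
    HasFDerivAt (v t) ((fderiv ℝ (fun x : ℝ × E n => v x.1 x.2) (t, y)).comp
      (ContinuousLinearMap.inr ℝ ℝ (E n))) y := by
  have h1 := ((hv.differentiable (by norm_num)) (t, y)).hasFDerivAt
  have h2 : HasFDerivAt (fun z : E n => (t, z)) (ContinuousLinearMap.inr ℝ ℝ (E n)) y :=
    hasFDerivAt_prodMk_right t y
  exact h1.comp y h2

theorem contDiff_fderiv_slice (hv : ContDiff ℝ 4 (fun x : ℝ × E n => v x.1 x.2)) :
    ContDiff ℝ 1 (fun x : ℝ × E n => fderiv ℝ (v x.1) x.2) := by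
  have h1 : ContDiff ℝ 1 (fderiv ℝ (fun x : ℝ × E n => v x.1 x.2)) :=
    hv.fderiv_right (by norm_num)
  have h2 := h1.clm_comp (contDiff_const (c := ContinuousLinearMap.inr ℝ ℝ (E n)))
  have e : (fun x : ℝ × E n => fderiv ℝ (v x.1) x.2) = fun x =>
      (fderiv ℝ (fun x : ℝ × E n => v x.1 x.2) x).comp (ContinuousLinearMap.inr ℝ ℝ (E n)) :=
    funext fun x => (hasFDerivAt_slice hv x.1 x.2).fderiv
  rw [e]
  exact h2

/-- The constant depends on `v` and is not uniform in `ε`. It only secures existence for the closed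
loop system and must not enter the `O(ε)` estimates. -/
theorem exists_fderiv_slice_bounds (hv : ContDiff ℝ 4 (fun x : ℝ × E n => v x.1 x.2)) (T R : ℝ) :
    ∃ C, 0 ≤ C ∧ ∀ t ∈ Icc 0 T, ∀ x x' : E n, ‖x‖ ≤ R → ‖x'‖ ≤ R →
      ‖fderiv ℝ (v t) x‖ ≤ C ∧ ‖fderiv ℝ (v t) x - fderiv ℝ (v t) x'‖ ≤ C * ‖x - x'‖ := by
  have hc := contDiff_fderiv_slice hv
  have hcpt : IsCompact (Icc 0 T ×ˢ Metric.closedBall (0 : E n) R) :=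
    isCompact_Icc.prod (isCompact_closedBall _ _)
  obtain ⟨C₁, h₁⟩ := hcpt.exists_bound_of_continuousOn hc.continuous.continuousOn
  obtain ⟨C₂, h₂⟩ := hcpt.exists_bound_of_continuousOn
    (hc.continuous_fderiv (by norm_num)).continuousOn
  refine ⟨max 0 (max C₁ C₂), le_max_left _ _, fun t ht x x' hx hx' => ⟨?_, ?_⟩⟩
  · exact (h₁ (t, x) ⟨ht, by simpa using hx⟩).trans
      ((le_max_left _ _).trans (le_max_right _ _))
  · have h3 := ((convex_Icc 0 T).prod (convex_closedBall (0 : E n) R)).norm_image_sub_le_of_norm_fderiv_le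
      (𝕜 := ℝ) (fun z _ => hc.differentiable (by norm_num) z) (fun z hz => h₂ z hz)
      (x := (t, x')) (y := (t, x)) ⟨ht, by simpa using hx'⟩ ⟨ht, by simpa using hx⟩
    have e : ‖((t, x) : ℝ × E n) - (t, x')‖ = ‖x - x'‖ := by
      simp [Prod.norm_def]
    rw [e] at h3
    refine h3.trans ?_
    gcongr
    exact (le_max_right _ _).trans (le_max_right _ _)

theorem FeedbackAssumption.continuousOn_feedback (hP : P.FeedbackAssumption Y₀ M)
    (hv : ContDiff ℝ 4 (fun x : ℝ × E n => v x.1 x.2)) {y : ℝ → E n}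
    (hy : ContinuousOn y (Icc 0 P.T)) : ContinuousOn (P.feedback v y) (Icc 0 P.T) :=
  continuousOn_law hP continuousOn_id (mapsTo_id _) hy
    ((contDiff_fderiv_slice hv).continuous.comp_continuousOn (continuousOn_id.prodMk hy))

theorem FeedbackAssumption.coeFn_feedbackL2 (hP : P.FeedbackAssumption Y₀ M)
    (hv : ContDiff ℝ 4 (fun x : ℝ × E n => v x.1 x.2)) (y : W 0 P.T n) :
    P.feedbackL2 v y =ᵐ[intervalMeasure 0 P.T] P.feedback v (rep y) := by
  have h := P.memLp_feedback hP.g_smooth.continuousOn (hv.of_le (by norm_num)) y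
  rw [feedbackL2, dif_pos h]
  exact h.coeFn_toLp

end Approximation

theorem norm_velocity_sub_le {R C ν t : ℝ} (hB : P.DynamicsBounds R C) (ht : t ∈ Icc 0 P.T)
    {x x' : E n} (hx : ‖x‖ ≤ R) (hx' : ‖x'‖ ≤ R) (w : E m) {w' : E m} (hw' : ‖w'‖ ≤ ν) :
    ‖(P.f t x + P.g t x w) - (P.f t x' + P.g t x' w')‖
      ≤ C * (1 + ν) * ‖x - x'‖ + C * ‖w - w'‖ := by
  have hC := hB.nonneg
  have e : (P.f t x + P.g t x w) - (P.f t x' + P.g t x' w')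
      = (P.f t x - P.f t x') + P.g t x (w - w') + (P.g t x - P.g t x') w' := by
    rw [sub_apply, map_sub]; abel
  have h1 := hB.f.lip t ht x x' hx hx'
  have h2 := (P.g t x - P.g t x').le_opNorm w'
  have h3 := mul_le_mul (hB.g.lip t ht x x' hx hx') hw' (norm_nonneg _) (by positivity)
  have h4 := (P.g t x).le_opNorm (w - w')
  have h5 := mul_le_mul_of_nonneg_right (hB.g.norm_le t ht x hx) (norm_nonneg (w - w'))
  rw [e]
  refine norm_add₃_le.trans ?_
  linarith

theorem norm_law_sub_le_of_bounds {R C t : ℝ} (hB : P.DynamicsBounds R C) (ht : t ∈ Icc 0 P.T)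
    {x x' : E n} (hx : ‖x‖ ≤ R) (hx' : ‖x'‖ ≤ R) (ℓ : E n →L[ℝ] ℝ) {ℓ' : E n →L[ℝ] ℝ} {D : ℝ}
    (hℓ' : ‖ℓ'‖ ≤ D) :
    ‖P.law t x ℓ - P.law t x' ℓ'‖ ≤ 1 / P.β * C * (‖ℓ - ℓ'‖ + D * ‖x - x'‖) := by
  have hC := hB.nonneg
  have hβ := P.β_pos
  refine (norm_law_sub_le t x x' ℓ ℓ').trans ?_
  rw [mul_assoc]
  refine mul_le_mul_of_nonneg_left ?_ (by positivity)
  have h1 := mul_le_mul_of_nonneg_right (hB.g.norm_le t ht x hx) (norm_nonneg (ℓ - ℓ'))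
  have h2 := mul_le_mul (hB.g.lip t ht x x' hx hx') hℓ' (norm_nonneg _) (by positivity)
  linarith

/-- If the gradient of `v` is `c ε`-close to that of the value function, then the closed loop system
of the feedback law induced by `v` has a solution that is `O(ε)`-close to the optimal trajectory. -/
theorem FeedbackAssumption.exists_closedLoop_near (hP : P.FeedbackAssumption Y₀ M) {y₀ : E n}
    {y p : W 0 P.T n} {u : ℝ → E m} {U : L2 0 P.T m} (hO : P.OptimalTrajectory M y₀ y p u U)
    {c : ℝ} (hc : 0 ≤ c) :
    ∃ Λ, 0 ≤ Λ ∧ ∀ ε, 0 < ε → (Subsingleton (E n) ∨ Λ * ε ≤ P.radius M / 2) →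
      ∀ v : ℝ → E n → ℝ, ContDiff ℝ 4 (fun x : ℝ × E n => v x.1 x.2) →
      (∀ t ∈ Icc 0 P.T, ∀ x : E n, ‖x‖ ≤ P.radius M →
        ‖fderiv ℝ (v t) x - P.valueGrad M t x‖ ≤ c * ε) →
      ∃ z : W 0 P.T n, P.ClosedLoop v z y₀ ∧ ∀ t ∈ Icc 0 P.T, ‖rep z t‖ ≤ P.radius M ∧
        ‖rep z t - rep y t‖ ≤ Λ * ε ∧ ‖P.feedback v (rep z) t - u t‖ ≤ Λ * ε := by
  have hr := hP.radius_nonneg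
  set r := P.radius M with hrdef
  obtain ⟨C, hB⟩ := hP.exists_dynamicsBounds r
  obtain ⟨ν, hν⟩ := isCompact_Icc.exists_bound_of_continuousOn hO.continuousOn
  obtain ⟨D, hD0, hD⟩ := hP.exists_valueGrad_bound
  obtain ⟨L, hL0, hL⟩ := hP.exists_valueGrad_lip
  have hf := hP.f_smooth.continuousOn
  have hg := hP.g_smooth.continuousOn
  have hβ := P.β_pos
  have hC := hB.nonneg
  have h0 : (0 : ℝ) ∈ Icc 0 P.T := left_mem_Icc.mpr P.T_pos.le
  have hν0 : 0 ≤ ν := (norm_nonneg _).trans (hν _ h0)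
  have hyr : ∀ t ∈ Icc 0 P.T, ‖rep y t‖ ≤ r := fun t ht => (hO.norm_le t ht).trans (by linarith)
  obtain ⟨b, hb, hb0⟩ : ∃ b, b = 1 / P.β * C ∧ 0 ≤ b := ⟨_, rfl, by positivity⟩
  obtain ⟨K, hK, hK0⟩ : ∃ K, K = C * (1 + ν) + C * (b * (L + D)) ∧ 0 ≤ K :=
    ⟨_, rfl, by positivity⟩
  obtain ⟨Λ₁, hΛ₁, hΛ₁0⟩ : ∃ Λ₁, Λ₁ = C * (b * c) * P.T * Real.exp (2 * K * (P.T - 0)) ∧ 0 ≤ Λ₁ :=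
    ⟨_, rfl, mul_nonneg (mul_nonneg (by positivity) P.T_pos.le) (Real.exp_pos _).le⟩
  refine ⟨Λ₁ + b * (c + (L + D) * Λ₁), by positivity, ?_⟩
  intro ε hε hsm v hv hvc
  -- The constant was fixed before `ε` and `v`: `Λ₁` is the Gronwall constant for the states, and
  -- the second summand covers the resulting error of the controls.
  have hcε : 0 ≤ c * ε := by positivity
  have hle : Λ₁ * ε ≤ (Λ₁ + b * (c + (L + D) * Λ₁)) * ε := by
    refine mul_le_mul_of_nonneg_right ?_ hε.le
    have : 0 ≤ b * (c + (L + D) * Λ₁) := by positivity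
    linarith
  -- The gradient error contributes `c * ε`; moving from `x` to the optimal state costs `L` through
  -- the gradient of the value function and `D` through `g`.
  have hlaw : ∀ t ∈ Icc 0 P.T, ∀ x : E n, ‖x‖ ≤ r →
      ‖P.law t x (fderiv ℝ (v t) x) - u t‖ ≤ b * (c * ε + (L + D) * ‖x - rep y t‖) := by
    intro t ht x hx
    rw [hO.eq_law t ht]
    refine (norm_law_sub_le_of_bounds hB ht hx (hyr t ht) _ (hD t ht _ (hyr t ht))).trans ?_
    rw [← hb]
    refine mul_le_mul_of_nonneg_left ?_ hb0
    have h1 := norm_sub_le_norm_sub_add_norm_sub (fderiv ℝ (v t) x) (P.valueGrad M t x)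
      (P.valueGrad M t (rep y t))
    have h2 := hvc t ht x hx
    have h3 := hL t ht x _ hx (hyr t ht)
    linarith
  have hst : P.StateEq y u y₀ := hO.optimal.1.congr hO.ae_eq
  have hvel := intervalIntegrable_of_memLp P.T_pos.le
    (memLp_velocity hf hg le_rfl le_rfl (continuous_rep y).continuousOn
      (memLp_of_continuousOn_Icc hO.continuousOn))
  obtain ⟨C', hC'0, hC'⟩ := exists_fderiv_slice_bounds hv P.T r
  have hexp : (0 + C * (b * c) * ε * (P.T - 0)) * Real.exp (2 * K * (P.T - 0)) = Λ₁ * ε := by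
    rw [hΛ₁, sub_zero]; ring
  -- The velocity defect `η` is the control defect `b * c * ε` times the bound `C` on `g`. The
  -- initial values agree, so `η' = 0`.
  obtain ⟨Y, hY, hYp⟩ := exists_tracking_solution P.T_pos.le hr (η := C * (b * c) * ε) (η' := 0)
      (by positivity) hK0 (H := fun s x => P.f s x + P.g s x (P.law s x (fderiv ℝ (v s) x)))
      (K' := C * (1 + b * C') + C * (b * (C' + C')))
      (Y₀ := rep y) (H₀ := P.velocity (rep y) u) (x₀ := y₀)
      (by
        have h1 : ContinuousOn (fun x : ℝ × E n => P.law x.1 x.2 (fderiv ℝ (v x.1) x.2))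
            (Icc 0 P.T ×ˢ Metric.closedBall 0 r) :=
          continuousOn_law hP continuousOn_fst (fun x hx => hx.1) continuousOn_snd
            (contDiff_fderiv_slice hv).continuous.continuousOn
        have h2 : Icc 0 P.T ×ˢ Metric.closedBall (0 : E n) r ⊆ Icc 0 P.T ×ˢ univ :=
          prod_mono subset_rfl (subset_univ _)
        exact (hf.mono h2).add ((hg.mono h2).clm_apply h1))
      (fun t ht x hx x' hx' => by
        rw [mem_closedBall_zero_iff] at hx hx'
        have h1 : ‖P.law t x' (fderiv ℝ (v t) x')‖ ≤ b * C' := by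
          refine (norm_law_le t x' _).trans ?_
          rw [hb, mul_assoc]
          refine mul_le_mul_of_nonneg_left ?_ (by positivity)
          exact mul_le_mul (hB.g.norm_le t ht x' hx') (hC' t ht x' x' hx' hx').1
            (norm_nonneg _) hC
        refine (norm_velocity_sub_le hB ht hx hx' _ h1).trans ?_
        have h2 := norm_law_sub_le_of_bounds hB ht hx hx' (fderiv ℝ (v t) x)
          (hC' t ht x' x' hx' hx').1
        have h3 := (hC' t ht x x' hx hx').2
        have h4 : ‖P.law t x (fderiv ℝ (v t) x) - P.law t x' (fderiv ℝ (v t) x')‖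
            ≤ b * (C' + C') * ‖x - x'‖ := by
          refine h2.trans ?_
          rw [← hb, mul_assoc]
          refine mul_le_mul_of_nonneg_left ?_ hb0
          linarith
        have h5 := mul_le_mul_of_nonneg_left h4 hC
        linarith)
      (continuous_rep y).continuousOn hvel
      (fun t ht => by
        rw [hst.rep_eq P.T_pos ht, hst.2])
      hyr
      (fun t ht x hx => by
        rw [mem_closedBall_zero_iff] at hx
        refine (norm_velocity_sub_le hB ht hx (hyr t ht) _ (hν t ht)).trans ?_
        have h1 := mul_le_mul_of_nonneg_left (hlaw t ht x hx) hC
        rw [hK]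
        linarith)
      (by rw [hst.2]; simp)
      (fun t ht x hx => by
        rcases hsm with hs | hs
        · rw [Subsingleton.elim x 0, norm_zero]; exact hr
        · rw [hexp] at hx
          have h1 := hO.norm_le t ht
          have h2 := norm_le_norm_add_norm_sub' x (rep y t)
          linarith)
  rw [hexp] at hYp
  have hYc : ContinuousOn (P.feedback v Y) (Icc 0 P.T) :=
    hP.continuousOn_feedback hv hY.continuousOn
  obtain ⟨z, hz1, hz2⟩ := exists_stateEq hf hg P.T_pos le_rfl le_rfl hY.continuousOn
    (memLp_of_continuousOn_Icc hYc) (x₀ := y₀) (fun t ht => (hYp t ht).2.2)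
  have hfb : ∀ t ∈ Icc 0 P.T, P.feedback v (rep z) t = P.feedback v Y t := fun t ht => by
    rw [feedback_eq_law, feedback_eq_law, hz2 t ht]
  refine ⟨z, hz1.congr ?_, fun t ht => ⟨?_, ?_, ?_⟩⟩
  · filter_upwards [ae_restrict_mem measurableSet_Ioo] with t ht
    exact (hfb t (Ioo_subset_Icc_self ht)).symm
  · rw [hz2 t ht]; exact (hYp t ht).1
  · rw [hz2 t ht]; exact (hYp t ht).2.1.trans hle
  · rw [hfb t ht, feedback_eq_law]
    refine (hlaw t ht _ (hYp t ht).1).trans ?_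
    have h1 := mul_le_mul_of_nonneg_left (hYp t ht).2.1 (by positivity : 0 ≤ L + D)
    have h2 : b * (c * ε + (L + D) * ‖Y t - rep y t‖) ≤ b * (c * ε + (L + D) * (Λ₁ * ε)) := by
      gcongr
    have h3 : 0 ≤ Λ₁ * ε := by positivity
    linarith

end ControlProblem

/-! ### The augmented cost of a nearly optimal feedback law -/

namespace ControlProblem

variable {n m : ℕ} {P : ControlProblem n m} {Y₀ : Set (E n)} {M : ℝ}

theorem abs_norm_sq_sub_le {F : Type*} [NormedAddCommGroup F] {a b : F} {d B : ℝ}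
    (h : ‖a - b‖ ≤ d) (hd1 : d ≤ 1) (hb : ‖b‖ ≤ B) :
    |‖a‖ ^ 2 - ‖b‖ ^ 2| ≤ d * (1 + 2 * B) := by
  have h1 : ‖a‖ ^ 2 - ‖b‖ ^ 2 = (‖a‖ - ‖b‖) * (‖a‖ + ‖b‖) := by ring
  have h2 := (abs_norm_sub_norm_le a b).trans h
  have h3 : ‖a‖ + ‖b‖ ≤ 1 + 2 * B := by
    have := norm_le_norm_add_norm_sub' a b
    linarith
  rw [h1, abs_mul, abs_of_nonneg (by positivity : 0 ≤ ‖a‖ + ‖b‖)]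
  exact mul_le_mul h2 h3 (by positivity) ((abs_nonneg _).trans h2)

/-- The costs on all intervals `[t,T]` depend Lipschitz continuously on state and control. -/
theorem exists_cost_lip {y : ℝ → E n} (hy : Continuous y) {u : ℝ → E m}
    (hu : ContinuousOn u (Icc 0 P.T)) :
    ∃ K, 0 ≤ K ∧ ∀ (z : ℝ → E n) (w : ℝ → E m) (d : ℝ), Continuous z →
      ContinuousOn w (Icc 0 P.T) → 0 ≤ d → d ≤ 1 → (∀ t ∈ Icc 0 P.T, ‖z t - y t‖ ≤ d) →
      (∀ t ∈ Icc 0 P.T, ‖w t - u t‖ ≤ d) →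
      ∀ t ∈ Icc 0 P.T, |P.cost t z w - P.cost t y u| ≤ K * d := by
  obtain ⟨R, hR⟩ := isCompact_Icc.exists_bound_of_continuousOn hy.continuousOn (s := Icc 0 P.T)
  obtain ⟨ν, hν⟩ := isCompact_Icc.exists_bound_of_continuousOn hu
  have hT := right_mem_Icc.mpr P.T_pos.le
  have hR0 : 0 ≤ R := (norm_nonneg _).trans (hR _ hT)
  have hν0 : 0 ≤ ν := (norm_nonneg _).trans (hν _ hT)
  have hβ := P.β_pos
  have hydi : IntervalIntegrable (fun s => ‖P.yd s‖) volume 0 P.T :=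
    (intervalIntegrable_of_memLp P.T_pos.le (Lp.memLp P.yd)).norm
  -- An integrable density for the Lipschitz constant of the running cost. It depends on time
  -- because `yd` is only square integrable.
  set φ : ℝ → ℝ := fun s => ‖P.Q₁‖ * (1 + 2 * (‖P.Q₁‖ * (R + ‖P.yd s‖))) * (1 + ‖P.Q₁‖)
    + P.β * (1 + 2 * ν) with hφ
  have hφ0 : ∀ s, 0 ≤ φ s := fun s => by positivity
  have hφi : IntervalIntegrable φ volume 0 P.T :=
    (((intervalIntegrable_const.add (((intervalIntegrable_const.add hydi).const_mul
      ‖P.Q₁‖).const_mul 2)).const_mul ‖P.Q₁‖).mul_const _).add intervalIntegrable_const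
  set I := ∫ s in (0 : ℝ)..P.T, φ s with hI
  have hI0 : 0 ≤ I := intervalIntegral.integral_nonneg P.T_pos.le fun s _ => hφ0 s
  set κ := ‖P.Q₂‖ * (1 + 2 * (‖P.Q₂‖ * (R + ‖P.ydT‖))) * (1 + ‖P.Q₂‖) with hκ
  -- A difference of squares is the difference of the norms times their sum; `d ≤ 1` bounds the sum,
  -- so the estimate stays linear in `d`.
  have hquad : ∀ (Q : E n →L[ℝ] E n) (a b c : E n) (d B : ℝ), 0 ≤ d → d ≤ 1 → ‖a - b‖ ≤ d →
      ‖b‖ ≤ R → ‖c‖ ≤ B → |‖Q (a - c)‖ ^ 2 - ‖Q (b - c)‖ ^ 2|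
        ≤ ‖Q‖ * (1 + 2 * (‖Q‖ * (R + B))) * (1 + ‖Q‖) * d := by
    intro Q a b c d B hd hd1 hab hb hcB
    have hB0 := (norm_nonneg _).trans hcB
    have e : ‖Q (a - c)‖ ^ 2 - ‖Q (b - c)‖ ^ 2
        = (‖Q (a - c)‖ - ‖Q (b - c)‖) * (‖Q (a - c)‖ + ‖Q (b - c)‖) := by ring
    have h1 : |‖Q (a - c)‖ - ‖Q (b - c)‖| ≤ ‖Q‖ * d := by
      refine (abs_norm_sub_norm_le _ _).trans ?_
      rw [← map_sub, sub_sub_sub_cancel_right]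
      exact (Q.le_opNorm _).trans (mul_le_mul_of_nonneg_left hab (norm_nonneg _))
    have h2 : ‖Q (b - c)‖ ≤ ‖Q‖ * (R + B) := (Q.le_opNorm _).trans
      (mul_le_mul_of_nonneg_left ((norm_sub_le _ _).trans (add_le_add hb hcB)) (norm_nonneg _))
    have h3 : ‖Q (a - c)‖ + ‖Q (b - c)‖ ≤ (1 + 2 * (‖Q‖ * (R + B))) * (1 + ‖Q‖) := by
      have h4 := (le_abs_self _).trans h1
      have h5 : ‖Q‖ * d ≤ ‖Q‖ := mul_le_of_le_one_right (norm_nonneg _) hd1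
      have h6 : 0 ≤ ‖Q‖ * (R + B) * ‖Q‖ := by positivity
      linarith [norm_nonneg Q]
    rw [e, abs_mul, abs_of_nonneg (by positivity : 0 ≤ ‖Q (a - c)‖ + ‖Q (b - c)‖)]
    refine (mul_le_mul h1 h3 (by positivity) (by positivity)).trans_eq ?_
    ring
  refine ⟨1 / 2 * I + 1 / 2 * κ, by positivity, ?_⟩
  intro z w d hz hw hd hd1 hzd hwd t ht
  have hsub : Icc t P.T ⊆ Icc 0 P.T := Icc_subset_Icc_left ht.1
  have i1 := integrable_cost ht.1 hz.continuousOn (memLp_of_continuousOn_Icc (hw.mono hsub))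
  have i2 := integrable_cost ht.1 hy.continuousOn (memLp_of_continuousOn_Icc (hu.mono hsub))
  have hφt := (intervalIntegrable_iff_integrableOn_Ioo_of_le ht.2).mp
    (intervalIntegrable_mono_Icc hφi ht hT)
  have h1 : |(∫ s in Ioo t P.T, (‖P.Q₁ (z s - P.yd s)‖ ^ 2 + P.β * ‖w s‖ ^ 2))
      - ∫ s in Ioo t P.T, (‖P.Q₁ (y s - P.yd s)‖ ^ 2 + P.β * ‖u s‖ ^ 2)| ≤ I * d := by
    rw [← integral_sub i1 i2, ← Real.norm_eq_abs]
    refine (norm_integral_le_of_norm_le (hφt.mul_const d) ?_).trans ?_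
    · filter_upwards [ae_restrict_mem measurableSet_Ioo] with s hs
      have hs' := hsub (Ioo_subset_Icc_self hs)
      have a1 := hquad P.Q₁ (z s) (y s) (P.yd s) d _ hd hd1 (hzd s hs') (hR s hs') le_rfl
      have a2 := mul_le_mul_of_nonneg_left
        (abs_norm_sq_sub_le (hwd s hs') hd1 (hν s hs')) hβ.le
      have e : ‖P.Q₁ (z s - P.yd s)‖ ^ 2 + P.β * ‖w s‖ ^ 2
          - (‖P.Q₁ (y s - P.yd s)‖ ^ 2 + P.β * ‖u s‖ ^ 2)
          = (‖P.Q₁ (z s - P.yd s)‖ ^ 2 - ‖P.Q₁ (y s - P.yd s)‖ ^ 2)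
            + P.β * (‖w s‖ ^ 2 - ‖u s‖ ^ 2) := by ring
      rw [e]
      refine (norm_add_le _ _).trans ?_
      rw [Real.norm_eq_abs, Real.norm_eq_abs, abs_mul, abs_of_pos hβ, hφ]
      linarith
    · rw [integral_mul_const, ← integral_Ioc_eq_integral_Ioo,
        ← intervalIntegral.integral_of_le ht.2]
      refine mul_le_mul_of_nonneg_right ?_ hd
      have e := intervalIntegral.integral_add_adjacent_intervals
        (intervalIntegrable_mono_Icc hφi (left_mem_Icc.mpr P.T_pos.le) ht)
        (intervalIntegrable_mono_Icc hφi ht hT)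
      have := intervalIntegral.integral_nonneg (μ := volume) ht.1 fun s _ => hφ0 s
      linarith
  have h2 := hquad P.Q₂ (z P.T) (y P.T) P.ydT d _ hd hd1 (hzd _ hT) (hR _ hT) le_rfl
  have e : P.cost t z w - P.cost t y u
      = 1 / 2 * ((∫ s in Ioo t P.T, (‖P.Q₁ (z s - P.yd s)‖ ^ 2 + P.β * ‖w s‖ ^ 2))
      - ∫ s in Ioo t P.T, (‖P.Q₁ (y s - P.yd s)‖ ^ 2 + P.β * ‖u s‖ ^ 2))
      + 1 / 2 * (‖P.Q₂ (z P.T - P.ydT)‖ ^ 2 - ‖P.Q₂ (y P.T - P.ydT)‖ ^ 2) := by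
    unfold cost; ring
  rw [e]
  refine (abs_add_le _ _).trans ?_
  rw [abs_mul, abs_mul, abs_of_pos (by norm_num : (0 : ℝ) < 1 / 2)]
  rw [← hκ] at h2
  linarith

/-- If `v` and its gradient are `c ε`-close to the value function and its gradient, then the
feedback law induced by `v` admits a closed loop state and an adjoint state with augmented cost at
most `O(ε)` above the optimal cost. -/
theorem FeedbackAssumption.exists_competitor (hP : P.FeedbackAssumption Y₀ M) {y₀ : E n}
    {y p : W 0 P.T n} {u : ℝ → E m} {U : L2 0 P.T m} (hO : P.OptimalTrajectory M y₀ y p u U)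
    {c γ₁ γ₂ : ℝ} (hc : 0 ≤ c) (hγ₁ : 0 ≤ γ₁) (hγ₂ : 0 ≤ γ₂) :
    ∃ Λ D, 0 ≤ Λ ∧ ∀ ε, 0 < ε → ε ≤ 1 → Λ * ε ≤ 1 →
      (Subsingleton (E n) ∨ Λ * ε ≤ P.radius M / 2) →
      ∀ v : ℝ → E n → ℝ, ContDiff ℝ 4 (fun x : ℝ × E n => v x.1 x.2) →
      (∀ t ∈ Icc 0 P.T, ∀ x : E n, ‖x‖ ≤ P.radius M →
        |v t x - P.valueFunction t x| ≤ c * ε ∧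
        ‖fderiv ℝ (v t) x - P.valueGrad M t x‖ ≤ c * ε) →
      ∃ z q : W 0 P.T n, P.ClosedLoop v z y₀ ∧ P.AdjointEq z (P.feedback v (rep z)) q ∧
        P.augmentedCost γ₁ γ₂ v z q ≤ P.cost 0 (rep y) U + D * ε := by
  have hr := hP.radius_nonneg
  obtain ⟨Λ, hΛ0, hΛ⟩ := hP.exists_closedLoop_near hO hc
  obtain ⟨C, hB⟩ := hP.exists_dynamicsBounds (P.radius M)
  obtain ⟨ν, hν⟩ := isCompact_Icc.exists_bound_of_continuousOn hO.continuousOn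
  obtain ⟨Kc, hKc0, hKc⟩ := exists_cost_lip (P := P) (continuous_rep y) hO.continuousOn
  obtain ⟨L, hL0, hL⟩ := hP.exists_value_lip
  obtain ⟨L', hL'0, hL'⟩ := hP.exists_valueGrad_lip
  have hT := right_mem_Icc.mpr P.T_pos.le
  have hTp := P.T_pos
  have hν0 : 0 ≤ ν := (norm_nonneg _).trans (hν _ hT)
  have hyr : ∀ t ∈ Icc 0 P.T, ‖rep y t‖ ≤ P.radius M := fun t ht =>
    (hO.norm_le t ht).trans (by linarith)
  obtain ⟨σ, hσ, hσ0⟩ : ∃ σ, σ = √(P.T - 0) ∧ 0 ≤ σ := ⟨_, rfl, Real.sqrt_nonneg _⟩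
  obtain ⟨Ka, hKa0, hKa⟩ := exists_adjoint_stability hr hB
    (ρ := σ * (ν + 1)) (by positivity)
  obtain ⟨ι, hι, hι0⟩ : ∃ ι, ι = embeddingNorm 0 P.T n ∧ 0 ≤ ι :=
    ⟨_, rfl, embeddingNorm_nonneg _ _ _⟩
  -- Constants for the two defects under the penalty. For `A₁`: approximation of the value, its
  -- Lipschitz constant, and the change of the cost. For `A₂`: approximation of the gradient, its
  -- Lipschitz constant, and stability of the adjoint state with the embedding norm `ι`.
  obtain ⟨A₁, hA₁, hA₁0⟩ : ∃ A, A = c + L * Λ + Kc * Λ ∧ 0 ≤ A := ⟨_, rfl, by positivity⟩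
  obtain ⟨A₂, hA₂, hA₂0⟩ : ∃ A, A = c + L' * Λ + ι * (Ka * (Λ + σ * Λ)) ∧ 0 ≤ A :=
    ⟨_, rfl, by positivity⟩
  -- The cost itself changes by order `ε`. The penalties are of order `ε ^ 2`, which is at most `ε`
  -- because `ε ≤ 1`.
  refine ⟨Λ, Kc * Λ + (γ₁ / 2 * A₁ ^ 2 + γ₂ / 2 * A₂ ^ 2) * P.T, hΛ0, ?_⟩
  intro ε hε hε1 hΛε hsm v hv hvc
  obtain ⟨z, hz, hzp⟩ := hΛ ε hε hsm v hv fun t ht x hx => (hvc t ht x hx).2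
  have hw := hP.continuousOn_feedback hv (continuous_rep z).continuousOn
  obtain ⟨q, hq⟩ := hP.exists_adjoint z hw
  refine ⟨z, q, hz, hq, ?_⟩
  have hΛε0 : 0 ≤ Λ * ε := by positivity
  have hwL : MemLp (P.feedback v (rep z)) 2 (intervalMeasure 0 P.T) := memLp_of_continuousOn_Icc hw
  have hcost := hKc (rep z) _ (Λ * ε) (continuous_rep z) hw hΛε0 hΛε
    (fun t ht => (hzp t ht).2.1) (fun t ht => (hzp t ht).2.2)
  have hwU : ‖hwL.toLp _ - U‖ ≤ σ * (Λ * ε) := by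
    rw [hσ]
    refine norm_Lp_le_of_bound P.T_pos.le _ hΛε0 ?_
    filter_upwards [Lp.coeFn_sub (hwL.toLp _) U, hwL.coeFn_toLp, hO.ae_eq,
      ae_restrict_mem measurableSet_Ioo] with t h1 h2 h3 h4
    rw [h1, Pi.sub_apply, h2, h3]
    exact (hzp t (Ioo_subset_Icc_self h4)).2.2
  have hUn : ‖U‖ ≤ σ * (ν + 1) := by
    rw [hσ]
    refine norm_Lp_le_of_bound P.T_pos.le _ (by positivity) ?_
    filter_upwards [hO.ae_eq, ae_restrict_mem measurableSet_Ioo] with t h1 h2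
    rw [h1]
    exact (hν t (Ioo_subset_Icc_self h2)).trans (by linarith)
  have hwn : ‖hwL.toLp _‖ ≤ σ * (ν + 1) := by
    rw [hσ]
    refine norm_Lp_le_of_bound P.T_pos.le _ (by positivity) ?_
    filter_upwards [hwL.coeFn_toLp, ae_restrict_mem measurableSet_Ioo] with t h1 h2
    rw [h1]
    have h3 := hν t (Ioo_subset_Icc_self h2)
    have h4 := (hzp t (Ioo_subset_Icc_self h2)).2.2
    have h5 := norm_le_norm_add_norm_sub' (P.feedback v (rep z) t) (u t)
    linarith
  have hqp := hKa z y q p _ u _ U (Λ * ε) (fun t ht => (hzp t ht).1) hyr hw hO.continuousOn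
    hwL.coeFn_toLp hO.ae_eq hwn hUn hq hO.adjoint (fun t ht => (hzp t ht).2.1)
  have hqp' : ∀ t ∈ Icc 0 P.T, ‖rep q t - rep p t‖ ≤ ι * (Ka * (Λ + σ * Λ)) * ε := by
    intro t ht
    refine (norm_rep_sub_rep_le P.T_pos q p ht).trans ?_
    rw [← hι, mul_assoc]
    refine mul_le_mul_of_nonneg_left (hqp.trans ?_) hι0
    rw [mul_assoc]
    refine mul_le_mul_of_nonneg_left ?_ hKa0
    linarith
  have hUr : U =ᵐ[intervalMeasure 0 P.T] u := hO.ae_eq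
  have hJ : P.cost 0 (rep y) U = P.cost 0 (rep y) u :=
    cost_congr P.T_pos.le (fun _ _ => rfl) hUr
  -- Both defects vanish for the value function along the optimal trajectory, by `value_eq_cost` and
  -- `valueGrad_eq_adjoint`. For `v` along `z` they are therefore of order `ε`.
  have hpt : ∀ t ∈ Ioo 0 P.T,
      ‖γ₁ / 2 * |v t (rep z t) - P.cost t (rep z) (P.feedback v (rep z))| ^ 2
        + γ₂ / 2 * ‖gradient (v t) (rep z t) - rep q t‖ ^ 2‖
      ≤ (γ₁ / 2 * A₁ ^ 2 + γ₂ / 2 * A₂ ^ 2) * ε := by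
    intro t ht
    have ht' := Ioo_subset_Icc_self ht
    have hzr := (hzp t ht').1
    have hzy := (hzp t ht').2.1
    have hval : P.valueFunction t (rep y t) = P.cost t (rep y) u := by
      rw [hP.value_eq_cost hO.optimal ⟨ht.1.le, ht.2⟩]
      exact cost_congr ht.2.le (fun _ _ => rfl)
        (ae_mono (Measure.restrict_mono (Ioo_subset_Ioo_left ht.1.le) le_rfl) hUr)
    have b1 : |v t (rep z t) - P.cost t (rep z) (P.feedback v (rep z))| ≤ A₁ * ε := by
      have a1 := (hvc t ht' _ hzr).1
      have a2 := hL t ht' _ _ hzr (hyr t ht')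
      have a3 := hcost t ht'
      have a4 := mul_le_mul_of_nonneg_left hzy hL0
      rw [Real.norm_eq_abs] at a2
      rw [hval] at a2
      rw [hA₁]
      rw [abs_le] at *
      constructor <;> linarith [a1.1, a1.2, a2.1, a2.2, a3.1, a3.2]
    have b2 : ‖gradient (v t) (rep z t) - rep q t‖ ≤ A₂ * ε := by
      have e : gradient (v t) (rep z t) - rep q t = (InnerProductSpace.toDual ℝ (E n)).symm
          (fderiv ℝ (v t) (rep z t) - innerSL ℝ (rep q t)) := by
        rw [map_sub]
        congr 1
        exact ((InnerProductSpace.toDual ℝ (E n)).symm_apply_apply (rep q t)).symm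
      rw [e, LinearIsometryEquiv.norm_map]
      have a1 := (hvc t ht' _ hzr).2
      have a2 := hL' t ht' _ _ hzr (hyr t ht')
      have a3 := hP.valueGrad_eq_adjoint hO.optimal hO.continuousOn hO.ae_eq hO.norm_le hO.adjoint
        ⟨ht.1.le, ht.2⟩
      have a4 := mul_le_mul_of_nonneg_left hzy hL'0
      have a5 := hqp' t ht'
      have e2 : fderiv ℝ (v t) (rep z t) - innerSL ℝ (rep q t)
          = (fderiv ℝ (v t) (rep z t) - P.valueGrad M t (rep z t))
            + (P.valueGrad M t (rep z t) - P.valueGrad M t (rep y t))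
            + innerSL ℝ (rep p t - rep q t) := by
        rw [a3, map_sub]; abel
      have e3 : ‖innerSL ℝ (rep p t - rep q t)‖ = ‖rep q t - rep p t‖ := by
        rw [innerSL_apply_norm, norm_sub_rev]
      rw [e2]
      refine norm_add₃_le.trans ?_
      rw [e3, hA₂]
      linarith
    have hε2 : ε ^ 2 ≤ ε := by nlinarith
    have d1 : |v t (rep z t) - P.cost t (rep z) (P.feedback v (rep z))| ^ 2 ≤ A₁ ^ 2 * ε := by
      refine (pow_le_pow_left₀ (abs_nonneg _) b1 2).trans ?_
      rw [mul_pow]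
      exact mul_le_mul_of_nonneg_left hε2 (sq_nonneg _)
    have d2 : ‖gradient (v t) (rep z t) - rep q t‖ ^ 2 ≤ A₂ ^ 2 * ε := by
      refine (pow_le_pow_left₀ (norm_nonneg _) b2 2).trans ?_
      rw [mul_pow]
      exact mul_le_mul_of_nonneg_left hε2 (sq_nonneg _)
    rw [Real.norm_of_nonneg (by positivity)]
    have d3 := mul_le_mul_of_nonneg_left d1 (by positivity : 0 ≤ γ₁ / 2)
    have d4 := mul_le_mul_of_nonneg_left d2 (by positivity : 0 ≤ γ₂ / 2)
    linarith
  have hint := norm_setIntegral_le_of_norm_le_const (μ := volume) (s := Ioo 0 P.T)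
    (by simp) hpt
  have hvol : volume.real (Ioo 0 P.T) = P.T := by simp [P.T_pos.le]
  rw [hvol] at hint
  have hc0 := (le_abs_self _).trans (hcost 0 (left_mem_Icc.mpr P.T_pos.le))
  have hi0 := (le_abs_self _).trans hint
  unfold augmentedCost
  rw [hJ]
  linarith

end ControlProblem

/-! ### Convergence tools -/

/-- Sequential Banach–Alaoglu, transported by the Riesz isometry. -/
theorem exists_weak_subseq {H : Type*} [NormedAddCommGroup H] [InnerProductSpace ℝ H]
    [CompleteSpace H] [TopologicalSpace.SeparableSpace H] {x : ℕ → H} {C : ℝ}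
    (hx : ∀ k, ‖x k‖ ≤ C) : ∃ (a : H) (φ : ℕ → ℕ), StrictMono φ ∧
      ∀ z, Tendsto (fun k => inner ℝ (x (φ k)) z) atTop (𝓝 (inner ℝ a z)) := by
  let f : ℕ → WeakDual ℝ H := fun k =>
    StrongDual.toWeakDual (InnerProductSpace.toDual ℝ H (x k))
  have hf : ∀ k, f k ∈ WeakDual.toStrongDual ⁻¹' Metric.closedBall (0 : StrongDual ℝ H) C := by
    intro k
    change InnerProductSpace.toDual ℝ H (x k) ∈ Metric.closedBall 0 C
    rw [mem_closedBall_zero_iff, LinearIsometryEquiv.norm_map]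
    exact hx k
  obtain ⟨g, -, φ, hφ, hlim⟩ := WeakDual.isSeqCompact_closedBall (𝕜 := ℝ) (E := H) 0 C hf
  refine ⟨(InnerProductSpace.toDual ℝ H).symm (WeakDual.toStrongDual g), φ, hφ, fun z => ?_⟩
  rw [InnerProductSpace.toDual_symm_apply]
  have h1 : Continuous fun F : WeakDual ℝ H => F z := WeakDual.eval_continuous z
  exact (h1.tendsto g).comp hlim

/-- Subsequences are extracted for one index after the other. The hypothesis covers every
subsequence `ψ` so that each extraction can start from the preceding one. -/
theorem exists_common_subseq {N : ℕ} {X : Fin N → Type*} [∀ i, TopologicalSpace (X i)]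
    {x : ∀ i, ℕ → X i}
    (h : ∀ i (ψ : ℕ → ℕ), StrictMono ψ → ∃ (φ : ℕ → ℕ) (a : X i), StrictMono φ ∧
      Tendsto (fun k => x i (ψ (φ k))) atTop (𝓝 a)) :
    ∃ (φ : ℕ → ℕ) (a : ∀ i, X i), StrictMono φ ∧
      ∀ i, Tendsto (fun k => x i (φ k)) atTop (𝓝 (a i)) := by
  have key : ∀ s : Finset (Fin N), ∃ φ : ℕ → ℕ, StrictMono φ ∧
      ∀ i ∈ s, ∃ a, Tendsto (fun k => x i (φ k)) atTop (𝓝 a) := by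
    intro s
    induction s using Finset.induction_on with
    | empty => exact ⟨id, strictMono_id, by simp⟩
    | insert j s _ ih =>
      obtain ⟨ψ, hψ, hs⟩ := ih
      obtain ⟨φ, a, hφ, ha⟩ := h j ψ hψ
      refine ⟨ψ ∘ φ, hψ.comp hφ, fun i hi => ?_⟩
      rcases Finset.mem_insert.mp hi with rfl | hi
      · exact ⟨a, ha⟩
      · obtain ⟨b, hb⟩ := hs i hi
        exact ⟨b, hb.comp hφ.tendsto_atTop⟩
  obtain ⟨φ, hφ, hs⟩ := key Finset.univ
  choose a ha using fun i => hs i (Finset.mem_univ i)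
  exact ⟨φ, a, hφ, ha⟩

/-! ### Convergence in `L²` and in `W` -/

section

variable {a b : ℝ} {n : ℕ}

theorem L2.norm_sq_eq_integral (v : L2 a b n) : ‖v‖ ^ 2 = ∫ t in Ioo a b, ‖v t‖ ^ 2 := by
  rw [← real_inner_self_eq_norm_sq, MeasureTheory.L2.inner_def]
  simp only [real_inner_self_eq_norm_sq]

/-- Dominated convergence in `L²`. -/
theorem L2.tendsto_of_dominated {v : ℕ → L2 a b n} {w : L2 a b n} {h : ℝ → ℝ}
    (hh : MemLp h 2 (intervalMeasure a b))
    (hb : ∀ k, ∀ᵐ t ∂(intervalMeasure a b), ‖v k t - w t‖ ≤ h t)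
    (hlim : ∀ᵐ t ∂(intervalMeasure a b), Tendsto (fun k => v k t) atTop (𝓝 (w t))) :
    Tendsto v atTop (𝓝 w) := by
  have h1 : Tendsto (fun k => ‖v k - w‖ ^ 2) atTop (𝓝 0) := by
    have e : ∀ k, ‖v k - w‖ ^ 2 = ∫ t in Ioo a b, ‖v k t - w t‖ ^ 2 := by
      intro k
      rw [L2.norm_sq_eq_integral]
      apply integral_congr_ae
      filter_upwards [Lp.coeFn_sub (v k) w] with t ht
      rw [ht, Pi.sub_apply]
    simp only [e]
    have e0 : (0 : ℝ) = ∫ _ in Ioo a b, (0 : ℝ) := by simp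
    rw [e0]
    refine tendsto_integral_of_dominated_convergence (fun t => h t ^ 2) ?_ hh.integrable_sq ?_ ?_
    · intro k
      exact (((Lp.aestronglyMeasurable (v k)).sub (Lp.aestronglyMeasurable w)).norm.pow 2)
    · intro k
      filter_upwards [hb k] with t ht
      rw [Real.norm_of_nonneg (by positivity)]
      exact pow_le_pow_left₀ (norm_nonneg _) ht 2
    · filter_upwards [hlim] with t ht
      have := ((ht.sub_const (w t)).norm.pow 2)
      simpa using this
  rw [tendsto_iff_norm_sub_tendsto_zero]
  have h2 := h1.sqrt
  simpa using h2

/-- A Cauchy sequence in `W a b n` converges. -/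
theorem exists_tendsto_of_cauchySeq_W (hab : a < b) {y : ℕ → W a b n} (hy : CauchySeq y) :
    ∃ z, Tendsto y atTop (𝓝 z) := by
  have ha := left_mem_Icc.mpr hab.le
  have hd : CauchySeq fun k => derivL2 (y k) := by
    rw [Metric.cauchySeq_iff] at hy ⊢
    intro ε hε
    obtain ⟨N, hN⟩ := hy ε hε
    refine ⟨N, fun k hk l hl => lt_of_le_of_lt ?_ (hN k hk l hl)⟩
    rw [dist_eq_norm, dist_eq_norm, ← derivL2_sub]
    exact norm_derivL2_le _
  have hr : CauchySeq fun k => rep (y k) a := by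
    have hpos : 0 < embeddingNorm a b n + 1 := by
      have := embeddingNorm_nonneg a b n
      linarith
    rw [Metric.cauchySeq_iff] at hy ⊢
    intro ε hε
    obtain ⟨N, hN⟩ := hy (ε / (embeddingNorm a b n + 1)) (by positivity)
    refine ⟨N, fun k hk l hl => ?_⟩
    have h1 := norm_rep_sub_rep_le hab (y k) (y l) ha
    have h2 := hN k hk l hl
    rw [lt_div_iff₀ hpos, dist_eq_norm] at h2
    rw [dist_eq_norm]
    have := norm_nonneg (y k - y l)
    linarith
  obtain ⟨v, hv⟩ := cauchySeq_tendsto_of_complete hd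
  obtain ⟨c, hc⟩ := cauchySeq_tendsto_of_complete hr
  -- The limit is rebuilt from the limits of the initial values and of the derivatives, which
  -- together control the `W`-norm.
  obtain ⟨z, hz1, hz2⟩ := exists_W hab c (Lp.memLp v)
  have hzv : derivL2 z = v := Lp.ext hz1
  have hzc : rep z a = c := by rw [hz2 a ha]; simp
  refine ⟨z, ?_⟩
  rw [tendsto_iff_norm_sub_tendsto_zero]
  have hbound : ∀ k, ‖y k - z‖
      ≤ √(b - a) * ‖rep (y k) a - c‖ + (b - a + 1) * ‖derivL2 (y k) - v‖ := by
    intro k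
    have := norm_W_le_of_rep hab (y k - z) ha
    rwa [rep_sub hab _ _ ha, derivL2_sub, hzc, hzv] at this
  have h1 : Tendsto (fun k => √(b - a) * ‖rep (y k) a - c‖ + (b - a + 1) * ‖derivL2 (y k) - v‖)
      atTop (𝓝 (√(b - a) * 0 + (b - a + 1) * 0)) :=
    ((tendsto_iff_norm_sub_tendsto_zero.mp hc).const_mul _).add
      ((tendsto_iff_norm_sub_tendsto_zero.mp hv).const_mul _)
  rw [mul_zero, mul_zero, add_zero] at h1
  exact squeeze_zero (fun _ => norm_nonneg _) hbound h1

/-- Weak convergence of the derivatives gives pointwise convergence of the representatives. -/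
theorem tendsto_rep_of_weak (hab : a < b) {y : ℕ → W a b n} {z : W a b n}
    (h0 : ∀ k, rep (y k) a = rep z a)
    (hw : ∀ χ : L2 a b n, Tendsto (fun k => inner ℝ (derivL2 (y k)) χ) atTop
      (𝓝 (inner ℝ (derivL2 z) χ))) {t : ℝ} (ht : t ∈ Icc a b) :
    Tendsto (fun k => rep (y k) t) atTop (𝓝 (rep z t)) := by
  have hcoord : ∀ i, Tendsto (fun k => rep (y k) t i) atTop (𝓝 (rep z t i)) := by
    intro i
    have hfin : intervalMeasure a b (Ioc a t) ≠ (⊤ : ℝ≥0∞) := measure_ne_top _ _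
    -- With the initial value split off, evaluation of a coordinate at `t` is the inner product of
    -- the derivative with the indicator of `(a,t]` times a unit vector, hence a weakly continuous
    -- functional.
    have e : ∀ x : W a b n, rep x t i = rep x a i + inner ℝ (derivL2 x)
        (indicatorConstLp 2 (measurableSet_Ioc (a := a) (b := t)) hfin
          (EuclideanSpace.single i (1 : ℝ))) := by
      intro x
      rw [real_inner_comm, MeasureTheory.L2.inner_indicatorConstLp_eq_inner_setIntegral,
        rep_eq_add_integral hab x ht, intervalIntegral.integral_of_le ht.1, PiLp.add_apply]
      congr 1
      have e1 : (intervalMeasure a b).restrict (Ioc a t) = volume.restrict (Ioc a t) := by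
        rw [intervalMeasure, restrict_Ioo_eq_restrict_Ioc,
          Measure.restrict_restrict measurableSet_Ioc,
          inter_eq_left.mpr (Ioc_subset_Ioc_right ht.2)]
      rw [e1, EuclideanSpace.inner_single_left]
      simp
    simp only [e, h0]
    exact (hw _).const_add _
  have h1 : Tendsto (fun k => WithLp.ofLp (rep (y k) t)) atTop (𝓝 (WithLp.ofLp (rep z t))) :=
    tendsto_pi_nhds.mpr hcoord
  exact ((PiLp.continuous_toLp 2 _).tendsto _).comp h1

end

/-! ### Compactness of trajectories with bounded controls -/

theorem tendsto_inner_of_weak_of_strong {H : Type*} [NormedAddCommGroup H] [InnerProductSpace ℝ H]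
    {u x : ℕ → H} {u₀ x₀ : H} {C : ℝ} (hC : ∀ k, ‖u k‖ ≤ C)
    (hu : ∀ z, Tendsto (fun k => inner ℝ (u k) z) atTop (𝓝 (inner ℝ u₀ z)))
    (hx : Tendsto x atTop (𝓝 x₀)) :
    Tendsto (fun k => inner ℝ (u k) (x k)) atTop (𝓝 (inner ℝ u₀ x₀)) := by
  have h1 : Tendsto (fun k => inner ℝ (u k) (x k - x₀)) atTop (𝓝 0) := by
    refine squeeze_zero_norm (fun k => (norm_inner_le_norm _ _).trans
      (mul_le_mul_of_nonneg_right (hC k) (norm_nonneg _))) ?_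
    simpa using (tendsto_iff_norm_sub_tendsto_zero.mp hx).const_mul C
  have h2 := (hu x₀).add h1
  simp only [← inner_add_right, add_sub_cancel, add_zero] at h2
  exact h2

namespace ControlProblem

variable {n m : ℕ} {P : ControlProblem n m} {Y₀ : Set (E n)} {M : ℝ}

/-- The control enters the cost only through its squared norm. Convergence of costs and states thus
yields convergence of the norms of the controls. -/
theorem cost_eq_add_norm_sq {y : ℝ → E n} (hy : ContinuousOn y (Icc 0 P.T)) (U : L2 0 P.T m) :
    P.cost 0 y U = P.cost 0 y (fun _ => 0) + P.β / 2 * ‖U‖ ^ 2 := by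
  have h0 := integrable_cost (P := P) le_rfl hy (u := fun _ => (0 : E m)) MemLp.zero'
  have h1 : IntegrableOn (fun s => P.β * ‖U s‖ ^ 2) (Ioo 0 P.T) :=
    ((Lp.memLp U).norm.integrable_sq).const_mul _
  have h2 : ∫ s in Ioo 0 P.T, (‖P.Q₁ (y s - P.yd s)‖ ^ 2 + P.β * ‖U s‖ ^ 2)
      = (∫ s in Ioo 0 P.T, (‖P.Q₁ (y s - P.yd s)‖ ^ 2 + P.β * ‖(0 : E m)‖ ^ 2))
        + P.β * ‖U‖ ^ 2 := by
    rw [L2.norm_sq_eq_integral, ← integral_const_mul, ← integral_add h0 h1]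
    simp
  rw [cost, cost, h2]
  ring

theorem tendsto_cost_of_tendsto_rep {y : ℕ → W 0 P.T n} {z : W 0 P.T n} {R : ℝ}
    (hR : ∀ k, ∀ t ∈ Icc 0 P.T, ‖rep (y k) t‖ ≤ R)
    (hy : ∀ t ∈ Icc 0 P.T, Tendsto (fun k => rep (y k) t) atTop (𝓝 (rep z t))) :
    Tendsto (fun k => P.cost 0 (rep (y k)) (fun _ => 0)) atTop
      (𝓝 (P.cost 0 (rep z) (fun _ => 0))) := by
  have hT := right_mem_Icc.mpr P.T_pos.le
  have hR0 : 0 ≤ R := (norm_nonneg _).trans (hR 0 _ hT)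
  unfold cost
  refine Tendsto.add (Tendsto.const_mul _ ?_) (Tendsto.const_mul _ ?_)
  · refine tendsto_integral_of_dominated_convergence
      (fun s => (‖P.Q₁‖ * (R + ‖P.yd s‖)) ^ 2) ?_ ?_ ?_ ?_
    · intro k
      exact (integrable_cost (P := P) le_rfl (continuous_rep (y k)).continuousOn
        (u := fun _ => (0 : E m)) MemLp.zero').1
    · have h1 : MemLp (fun s => R + ‖P.yd s‖) 2 (intervalMeasure 0 P.T) :=
        (memLp_const R).add (Lp.memLp P.yd).norm
      exact (h1.const_mul ‖P.Q₁‖).integrable_sq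
    · intro k
      filter_upwards [ae_restrict_mem measurableSet_Ioo] with s hs
      rw [norm_zero, zero_pow two_ne_zero, mul_zero, add_zero, Real.norm_of_nonneg (by positivity)]
      refine pow_le_pow_left₀ (norm_nonneg _) ((P.Q₁.le_opNorm _).trans ?_) 2
      have h1 := hR k s (Ioo_subset_Icc_self hs)
      have h2 := norm_sub_le (rep (y k) s) (P.yd s)
      gcongr
      linarith
    · filter_upwards [ae_restrict_mem measurableSet_Ioo] with s hs
      have h1 := (P.Q₁.continuous.tendsto _).comp
        ((hy s (Ioo_subset_Icc_self hs)).sub_const (P.yd s))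
      exact (h1.norm.pow 2).add_const _
  · exact ((P.Q₂.continuous.tendsto _).comp ((hy _ hT).sub_const P.ydT)).norm.pow 2

theorem DynamicsBounds.tendsto_f {R C : ℝ} (hB : P.DynamicsBounds R C) {t : ℝ}
    (ht : t ∈ Icc 0 P.T) {x : ℕ → E n} {x₀ : E n} (hx : ∀ k, ‖x k‖ ≤ R) (hx₀ : ‖x₀‖ ≤ R)
    (h : Tendsto x atTop (𝓝 x₀)) : Tendsto (fun k => P.f t (x k)) atTop (𝓝 (P.f t x₀)) := by
  rw [tendsto_iff_norm_sub_tendsto_zero] at h ⊢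
  refine squeeze_zero (fun _ => norm_nonneg _) (fun k => hB.f.lip t ht _ _ (hx k) hx₀) ?_
  simpa using h.const_mul C

theorem DynamicsBounds.tendsto_g {R C : ℝ} (hB : P.DynamicsBounds R C) {t : ℝ}
    (ht : t ∈ Icc 0 P.T) {x : ℕ → E n} {x₀ : E n} (hx : ∀ k, ‖x k‖ ≤ R) (hx₀ : ‖x₀‖ ≤ R)
    (h : Tendsto x atTop (𝓝 x₀)) : Tendsto (fun k => P.g t (x k)) atTop (𝓝 (P.g t x₀)) := by
  rw [tendsto_iff_norm_sub_tendsto_zero] at h ⊢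
  refine squeeze_zero (fun _ => norm_nonneg _) (fun k => hB.g.lip t ht _ _ (hx k) hx₀) ?_
  simpa using h.const_mul C

theorem norm_rep_le_of_tendsto {y : ℕ → W 0 P.T n} {z : W 0 P.T n} {R : ℝ}
    (hR : ∀ k, ∀ t ∈ Icc 0 P.T, ‖rep (y k) t‖ ≤ R)
    (hy : ∀ t ∈ Icc 0 P.T, Tendsto (fun k => rep (y k) t) atTop (𝓝 (rep z t))) :
    ∀ t ∈ Icc 0 P.T, ‖rep z t‖ ≤ R := fun t ht =>
  le_of_tendsto (hy t ht).norm (Eventually.of_forall fun k => hR k t ht)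

/-- The state equation is stable under weak convergence. -/
theorem FeedbackAssumption.stateEq_of_weak (hP : P.FeedbackAssumption Y₀ M)
    {y : ℕ → W 0 P.T n} {z : W 0 P.T n} {u : ℕ → L2 0 P.T m} {w : L2 0 P.T m} {x₀ : E n}
    {R C : ℝ} (hs : ∀ k, P.StateEq (y k) (u k) x₀)
    (hR : ∀ k, ∀ t ∈ Icc 0 P.T, ‖rep (y k) t‖ ≤ R)
    (hy : ∀ t ∈ Icc 0 P.T, Tendsto (fun k => rep (y k) t) atTop (𝓝 (rep z t)))
    (hd : ∀ χ, Tendsto (fun k => inner ℝ (derivL2 (y k)) χ) atTop (𝓝 (inner ℝ (derivL2 z) χ)))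
    (hC : ∀ k, ‖u k‖ ≤ C)
    (hu : ∀ χ, Tendsto (fun k => inner ℝ (u k) χ) atTop (𝓝 (inner ℝ w χ))) :
    P.StateEq z w x₀ := by
  obtain ⟨B, hB⟩ := hP.exists_dynamicsBounds R
  have hRz := norm_rep_le_of_tendsto hR hy
  have h0 := left_mem_Icc.mpr P.T_pos.le
  have hadj : Continuous (ContinuousLinearMap.adjoint (𝕜 := ℝ) (E := E m) (F := E n)) :=
    LinearIsometryEquiv.continuous _
  have hfc : ∀ x : W 0 P.T n, MemLp (fun s => P.f s (rep x s)) 2 (intervalMeasure 0 P.T) :=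
    fun x => memLp_of_continuousOn_Icc
      (continuousOn_along hP.f_smooth.continuousOn le_rfl le_rfl (continuous_rep x).continuousOn)
  have hgc : ∀ (x : W 0 P.T n) (χ : L2 0 P.T n),
      MemLp (fun s => (P.g s (rep x s)).adjoint (χ s)) 2 (intervalMeasure 0 P.T) :=
    fun x χ => memLp_clm_apply (hadj.comp_continuousOn
      (continuousOn_along hP.g_smooth.continuousOn le_rfl le_rfl (continuous_rep x).continuousOn))
      (Lp.memLp χ)
  -- Tested with `χ`, the adjoint of `g` is moved onto `χ`. Then the controls, which converge
  -- weakly, are paired with functions that converge strongly.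
  have hpair : ∀ (x : W 0 P.T n) (v : L2 0 P.T m) (q χ : L2 0 P.T n),
      (∀ᵐ t ∂(intervalMeasure 0 P.T), q t = P.f t (rep x t) + P.g t (rep x t) (v t)) →
      inner ℝ q χ = inner ℝ (hfc x).toLp χ + inner ℝ v (hgc x χ).toLp := by
    intro x v q χ hq
    rw [MeasureTheory.L2.inner_def, MeasureTheory.L2.inner_def, MeasureTheory.L2.inner_def,
      ← integral_add (MeasureTheory.L2.integrable_inner _ _)
        (MeasureTheory.L2.integrable_inner _ _)]
    apply integral_congr_ae
    filter_upwards [hq, (hfc x).coeFn_toLp, (hgc x χ).coeFn_toLp] with t h1 h2 h3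
    rw [h1, h2, h3, inner_add_left, ContinuousLinearMap.adjoint_inner_right]
  have hvel := memLp_velocity (P := P) hP.f_smooth.continuousOn hP.g_smooth.continuousOn le_rfl
    le_rfl (continuous_rep z).continuousOn (Lp.memLp w)
  have hlimf : Tendsto (fun k => (hfc (y k)).toLp) atTop (𝓝 (hfc z).toLp) := by
    refine L2.tendsto_of_dominated (h := fun _ => B + B) (memLp_const _) (fun k => ?_) ?_
    · filter_upwards [(hfc (y k)).coeFn_toLp, (hfc z).coeFn_toLp,
        ae_restrict_mem measurableSet_Ioo] with t h1 h2 ht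
      have ht := Ioo_subset_Icc_self ht
      rw [h1, h2]
      exact (norm_sub_le _ _).trans (add_le_add (hB.f.norm_le t ht _ (hR k t ht))
        (hB.f.norm_le t ht _ (hRz t ht)))
    · filter_upwards [ae_all_iff.mpr fun k => (hfc (y k)).coeFn_toLp, (hfc z).coeFn_toLp,
        ae_restrict_mem measurableSet_Ioo] with t h1 h2 ht
      have ht := Ioo_subset_Icc_self ht
      simp only [h1, h2]
      exact hB.tendsto_f ht (fun k => hR k t ht) (hRz t ht) (hy t ht)
  have hlimg : ∀ χ : L2 0 P.T n,
      Tendsto (fun k => (hgc (y k) χ).toLp) atTop (𝓝 (hgc z χ).toLp) := by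
    intro χ
    refine L2.tendsto_of_dominated (h := fun t => (B + B) * ‖χ t‖)
      ((Lp.memLp χ).norm.const_mul _) (fun k => ?_) ?_
    · filter_upwards [(hgc (y k) χ).coeFn_toLp, (hgc z χ).coeFn_toLp,
        ae_restrict_mem measurableSet_Ioo] with t h1 h2 ht
      have ht := Ioo_subset_Icc_self ht
      rw [h1, h2, add_mul]
      refine (norm_sub_le _ _).trans (add_le_add ?_ ?_)
      · exact (norm_adjoint_apply_le _ _).trans
          (mul_le_mul_of_nonneg_right (hB.g.norm_le t ht _ (hR k t ht)) (norm_nonneg _))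
      · exact (norm_adjoint_apply_le _ _).trans
          (mul_le_mul_of_nonneg_right (hB.g.norm_le t ht _ (hRz t ht)) (norm_nonneg _))
    · filter_upwards [ae_all_iff.mpr fun k => (hgc (y k) χ).coeFn_toLp, (hgc z χ).coeFn_toLp,
        ae_restrict_mem measurableSet_Ioo] with t h1 h2 ht
      have ht := Ioo_subset_Icc_self ht
      simp only [h1, h2]
      have h3 := (hadj.tendsto _).comp (hB.tendsto_g ht (fun k => hR k t ht) (hRz t ht) (hy t ht))
      exact ((ContinuousLinearMap.apply ℝ (E m) (χ t)).continuous.tendsto _).comp h3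
  have heq : derivL2 z = hvel.toLp := by
    refine ext_inner_right ℝ fun χ => tendsto_nhds_unique (hd χ) ?_
    rw [hpair z w _ χ hvel.coeFn_toLp]
    simp only [fun k => hpair (y k) (u k) _ χ (hs k).1]
    exact (hlimf.inner tendsto_const_nhds).add
      (tendsto_inner_of_weak_of_strong hC hu (hlimg χ))
  refine ⟨?_, tendsto_nhds_unique (hy 0 h0) ?_⟩
  · rw [heq]
    exact hvel.coeFn_toLp
  · simp only [(hs _).2]
    exact tendsto_const_nhds

/-- Strong convergence of the controls gives strong convergence of the states. -/
theorem FeedbackAssumption.tendsto_state (hP : P.FeedbackAssumption Y₀ M)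
    {y : ℕ → W 0 P.T n} {z : W 0 P.T n} {u : ℕ → L2 0 P.T m} {w : L2 0 P.T m} {x₀ : E n}
    {R : ℝ} (hs : ∀ k, P.StateEq (y k) (u k) x₀) (hz : P.StateEq z w x₀)
    (hR : ∀ k, ∀ t ∈ Icc 0 P.T, ‖rep (y k) t‖ ≤ R)
    (hy : ∀ t ∈ Icc 0 P.T, Tendsto (fun k => rep (y k) t) atTop (𝓝 (rep z t)))
    (hu : Tendsto u atTop (𝓝 w)) : Tendsto y atTop (𝓝 z) := by
  obtain ⟨B, hB⟩ := hP.exists_dynamicsBounds R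
  have hRz := norm_rep_le_of_tendsto hR hy
  have h0 := left_mem_Icc.mpr P.T_pos.le
  have hR0 : 0 ≤ R := (norm_nonneg _).trans (hR 0 _ h0)
  have h1 : MemLp (fun t => 1 + ‖w t‖) 2 (intervalMeasure 0 P.T) :=
    (memLp_const (1 : ℝ)).add (Lp.memLp w).norm
  have hdom : ∀ k, ∀ t ∈ Icc 0 P.T, ‖(1 + ‖w t‖) • (rep (y k) t - rep z t)‖
      ≤ (R + R) * (1 + ‖w t‖) := by
    intro k t ht
    rw [norm_smul, Real.norm_of_nonneg (by positivity), mul_comm]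
    gcongr
    exact (norm_sub_le _ _).trans (add_le_add (hR k t ht) (hRz t ht))
  -- The derivative difference is bounded by `B * (1 + ‖w‖) * ‖y k - z‖ + B * ‖u k - w‖`. Pointwise
  -- convergence of the states and the dominating function `(R + R) * (1 + ‖w‖)` handle the first
  -- term, so Gronwall's inequality is not needed.
  have hZ : ∀ k, MemLp (fun t => (1 + ‖w t‖) • (rep (y k) t - rep z t)) 2
      (intervalMeasure 0 P.T) := by
    intro k
    refine (h1.const_mul (R + R)).mono' (h1.1.smul
      (((continuous_rep (y k)).sub (continuous_rep z)).aestronglyMeasurable)) ?_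
    filter_upwards [ae_restrict_mem measurableSet_Ioo] with t ht
    exact hdom k t (Ioo_subset_Icc_self ht)
  have hZlim : Tendsto (fun k => (hZ k).toLp) atTop (𝓝 0) := by
    refine L2.tendsto_of_dominated (h1.const_mul (R + R)) (fun k => ?_) ?_
    · filter_upwards [(hZ k).coeFn_toLp, Lp.coeFn_zero (E n) 2 (intervalMeasure 0 P.T),
        ae_restrict_mem measurableSet_Ioo] with t h2 h3 ht
      rw [h2, h3, Pi.zero_apply, sub_zero]
      exact hdom k t (Ioo_subset_Icc_self ht)
    · filter_upwards [ae_all_iff.mpr fun k => (hZ k).coeFn_toLp,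
        Lp.coeFn_zero (E n) 2 (intervalMeasure 0 P.T),
        ae_restrict_mem measurableSet_Ioo] with t h2 h3 ht
      simp only [h2, h3]
      have h4 := ((hy t (Ioo_subset_Icc_self ht)).sub_const (rep z t)).const_smul (1 + ‖w t‖)
      simpa using h4
  have hbound : ∀ k, ‖y k - z‖ ≤ (P.T - 0 + 1) * (B * ‖(hZ k).toLp‖ + B * ‖u k - w‖) := by
    intro k
    have h1 := norm_W_le_of_rep P.T_pos (y k - z) h0
    rw [rep_sub P.T_pos _ _ h0, (hs k).2, hz.2, sub_self, norm_zero, mul_zero, zero_add] at h1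
    refine h1.trans (mul_le_mul_of_nonneg_left ?_ (by linarith [P.T_pos]))
    have h2 := norm_Lp_le_of_affine_bound P.T_pos.le (derivL2 (y k - z)) (hZ k).toLp (u k - w)
      le_rfl hB.nonneg hB.nonneg ?_
    · simpa using h2
    · rw [derivL2_sub]
      filter_upwards [(hs k).1, hz.1, Lp.coeFn_sub (derivL2 (y k)) (derivL2 z),
        Lp.coeFn_sub (u k) w, (hZ k).coeFn_toLp, ae_restrict_mem measurableSet_Ioo]
        with t h2 h3 h4 h5 h6 ht
      have ht := Ioo_subset_Icc_self ht
      rw [h4, h5, h6, Pi.sub_apply, Pi.sub_apply, h2, h3]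
      have h7 := norm_velocity_sub_le hB ht (hR k t ht) (hRz t ht) (u k t) (le_refl ‖w t‖)
      rw [norm_smul, Real.norm_of_nonneg (by positivity)]
      linarith
  rw [tendsto_iff_norm_sub_tendsto_zero]
  refine squeeze_zero (fun _ => norm_nonneg _) hbound ?_
  have h3 := ((hZlim.norm.const_mul B).add
    ((tendsto_iff_norm_sub_tendsto_zero.mp hu).const_mul B)).const_mul (P.T - 0 + 1)
  simpa using h3

end ControlProblem

instance L2.separableSpace {a b : ℝ} {n : ℕ} : TopologicalSpace.SeparableSpace (L2 a b n) := by
  have : Fact ((2 : ℝ≥0∞) ≠ ⊤) := ⟨by norm_num⟩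
  exact TopologicalSpace.SecondCountableTopology.to_separableSpace

theorem L2.exists_subseq_tendsto_ae {a b : ℝ} {n : ℕ} {v : ℕ → L2 a b n} {w : L2 a b n}
    (h : Tendsto v atTop (𝓝 w)) : ∃ ψ : ℕ → ℕ, StrictMono ψ ∧
      ∀ᵐ t ∂(intervalMeasure a b), Tendsto (fun k => v (ψ k) t) atTop (𝓝 (w t)) :=
  (tendstoInMeasure_of_tendsto_Lp h).exists_seq_tendsto_ae

theorem tendsto_rep {a b : ℝ} (hab : a < b) {n : ℕ} {y : ℕ → W a b n} {z : W a b n}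
    (h : Tendsto y atTop (𝓝 z)) {t : ℝ} (ht : t ∈ Icc a b) :
    Tendsto (fun k => rep (y k) t) atTop (𝓝 (rep z t)) := by
  rw [tendsto_iff_norm_sub_tendsto_zero] at h ⊢
  refine squeeze_zero (fun _ => norm_nonneg _) (fun k => norm_rep_sub_rep_le hab _ _ ht) ?_
  simpa using h.const_mul (embeddingNorm a b n)

theorem tendsto_derivL2 {a b : ℝ} {n : ℕ} {y : ℕ → W a b n} {z : W a b n}
    (h : Tendsto y atTop (𝓝 z)) : Tendsto (fun k => derivL2 (y k)) atTop (𝓝 (derivL2 z)) := by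
  rw [tendsto_iff_norm_sub_tendsto_zero] at h ⊢
  refine squeeze_zero (fun _ => norm_nonneg _) (fun k => ?_) h
  rw [← derivL2_sub]
  exact norm_derivL2_le _

/-! ### Strong limits of minimizing sequences -/

namespace ControlProblem

variable {n m : ℕ} {P : ControlProblem n m} {Y₀ : Set (E n)} {M : ℝ}

theorem AdjointEq.congr {y p : W 0 P.T n} {u v : ℝ → E m} (h : P.AdjointEq y u p)
    (huv : u =ᵐ[intervalMeasure 0 P.T] v) : P.AdjointEq y v p := by
  refine ⟨?_, h.2⟩
  filter_upwards [h.1, huv] with t h1 h2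
  rw [← h2]
  exact h1

/-- Trajectories whose costs converge to a lower bound of the cost are relatively compact,
together with their controls and adjoint states. -/
theorem FeedbackAssumption.exists_strong_subseq (hP : P.FeedbackAssumption Y₀ M)
    {y p : ℕ → W 0 P.T n} {u : ℕ → ℝ → E m} {U : ℕ → L2 0 P.T m} {x₀ : E n} {R J : ℝ}
    (huc : ∀ k, ContinuousOn (u k) (Icc 0 P.T))
    (hU : ∀ k, U k =ᵐ[intervalMeasure 0 P.T] u k) (hs : ∀ k, P.StateEq (y k) (U k) x₀)
    (hadj : ∀ k, P.AdjointEq (y k) (u k) (p k))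
    (hR : ∀ k, ∀ t ∈ Icc 0 P.T, ‖rep (y k) t‖ ≤ R)
    (hJ : Tendsto (fun k => P.cost 0 (rep (y k)) (U k)) atTop (𝓝 J))
    (hopt : ∀ (z : W 0 P.T n) (v : L2 0 P.T m), P.StateEq z v x₀ → J ≤ P.cost 0 (rep z) v) :
    ∃ (φ : ℕ → ℕ) (x : W 0 P.T n × W 0 P.T n × L2 0 P.T m), StrictMono φ ∧
      Tendsto (fun k => (y (φ k), p (φ k), U (φ k))) atTop (𝓝 x) := by
  have hT := P.T_pos
  have h0 := left_mem_Icc.mpr hT.le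
  have hR0 : 0 ≤ R := (norm_nonneg _).trans (hR 0 _ h0)
  have hβ := P.β_pos
  obtain ⟨B, hB⟩ := hP.exists_dynamicsBounds R
  obtain ⟨K, hK⟩ := hJ.bddAbove_range
  have hρ : ∀ k, ‖U k‖ ≤ √(2 * K / P.β) := by
    intro k
    refine Real.le_sqrt_of_sq_le ?_
    rw [le_div_iff₀ hβ]
    have h1 : P.cost 0 (rep (y k)) (U k) ≤ K := hK (mem_range_self k)
    rw [cost_eq_add_norm_sq (continuous_rep (y k)).continuousOn] at h1
    have h2 := cost_nonneg (P := P) 0 (rep (y k)) (fun _ => (0 : E m))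
    nlinarith
  set ρ := √(2 * K / P.β)
  have hd : ∀ k, ‖derivL2 (y k)‖ ≤ √(P.T - 0) * B + B * ρ := by
    intro k
    have h1 := norm_Lp_le_of_affine_bound hT.le (derivL2 (y k)) (U k) (U k) hB.nonneg hB.nonneg
      le_rfl ?_
    · refine h1.trans ?_
      rw [zero_mul, add_zero]
      have := mul_le_mul_of_nonneg_left (hρ k) hB.nonneg
      linarith
    · filter_upwards [(hs k).1, ae_restrict_mem measurableSet_Ioo] with t h2 ht
      have ht := Ioo_subset_Icc_self ht
      rw [h2, zero_mul, add_zero]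
      exact (norm_add_le _ _).trans (add_le_add (hB.f.norm_le t ht _ (hR k t ht))
        (((P.g t _).le_opNorm _).trans
          (mul_le_mul_of_nonneg_right (hB.g.norm_le t ht _ (hR k t ht)) (norm_nonneg _))))
  obtain ⟨w, φ₁, hφ₁, hw⟩ := exists_weak_subseq hρ
  obtain ⟨v, φ₂, hφ₂, hv⟩ := exists_weak_subseq fun k => hd (φ₁ k)
  obtain ⟨z, hz1, hz2⟩ := exists_W hT x₀ (Lp.memLp v)
  have hzv : derivL2 z = v := Lp.ext hz1
  have hzx : rep z 0 = x₀ := by rw [hz2 0 h0]; simp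
  have hφ := hφ₁.comp hφ₂
  have hrep : ∀ t ∈ Icc 0 P.T,
      Tendsto (fun k => rep (y (φ₁ (φ₂ k))) t) atTop (𝓝 (rep z t)) := fun t ht =>
    tendsto_rep_of_weak hT (fun k => (hs _).2.trans hzx.symm) (hzv ▸ hv) ht
  have hw' : ∀ χ, Tendsto (fun k => inner ℝ (U (φ₁ (φ₂ k))) χ) atTop (𝓝 (inner ℝ w χ)) :=
    fun χ => (hw χ).comp hφ₂.tendsto_atTop
  have hstate := hP.stateEq_of_weak (fun k => hs (φ₁ (φ₂ k))) (fun k => hR _) hrep (hzv ▸ hv)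
    (fun k => hρ _) hw'
  -- The square `β / 2 * ‖U - w‖ ^ 2` is expanded by means of the cost. Its limit is `J` minus the
  -- cost of the weak limit `(z, w)`, which is nonpositive because that pair is admissible; being
  -- also a limit of squares, it is zero.
  have hUlim : Tendsto (fun k => U (φ₁ (φ₂ k))) atTop (𝓝 w) := by
    have h1 := (hJ.comp hφ.tendsto_atTop).sub (tendsto_cost_of_tendsto_rep
      (fun k => hR (φ₁ (φ₂ k))) hrep)
    have h2 := (h1.sub ((hw' w).const_mul P.β)).add_const (P.β / 2 * ‖w‖ ^ 2)
    have h3 : ∀ k, P.cost 0 (rep (y (φ₁ (φ₂ k)))) (U (φ₁ (φ₂ k)))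
        - P.cost 0 (rep (y (φ₁ (φ₂ k)))) (fun _ => 0)
        - P.β * inner ℝ (U (φ₁ (φ₂ k))) w + P.β / 2 * ‖w‖ ^ 2
        = P.β / 2 * ‖U (φ₁ (φ₂ k)) - w‖ ^ 2 := by
      intro k
      rw [cost_eq_add_norm_sq (continuous_rep _).continuousOn, norm_sub_sq_real]
      ring
    simp only [Function.comp_apply, h3, real_inner_self_eq_norm_sq] at h2
    have h4 := hopt z w hstate
    rw [cost_eq_add_norm_sq (continuous_rep z).continuousOn] at h4
    have h5 := ge_of_tendsto' h2 fun k => by positivity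
    have h6 := (h2.const_mul (2 / P.β)).sqrt
    rw [tendsto_iff_norm_sub_tendsto_zero]
    have h7 : ∀ k, √(2 / P.β * (P.β / 2 * ‖U (φ₁ (φ₂ k)) - w‖ ^ 2)) = ‖U (φ₁ (φ₂ k)) - w‖ := by
      intro k
      rw [← mul_assoc, div_mul_div_cancel₀ hβ.ne', div_self two_ne_zero, one_mul,
        Real.sqrt_sq (norm_nonneg _)]
    simp only [h7] at h6
    convert h6 using 2
    have h8 : J - P.cost 0 (rep z) (fun _ => 0) - P.β * ‖w‖ ^ 2 + P.β / 2 * ‖w‖ ^ 2 = 0 := by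
      refine le_antisymm ?_ h5
      linarith
    rw [h8, mul_zero, Real.sqrt_zero]
  have hylim := hP.tendsto_state (fun k => hs (φ₁ (φ₂ k))) hstate (fun k => hR _) hrep hUlim
  obtain ⟨L, hL, hstab⟩ := exists_adjoint_stability hR0 hB (Real.sqrt_nonneg _ : 0 ≤ ρ)
  -- Adjoint stability is stated for continuous controls, and `w` is only known to be in `L²`. It is
  -- therefore applied to pairs of members of the sequence, which gives a Cauchy sequence.
  have hpc : CauchySeq fun k => p (φ₁ (φ₂ k)) := by
    rw [cauchySeq_iff_tendsto_dist_atTop_0]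
    have h1 := cauchySeq_iff_tendsto_dist_atTop_0.mp hylim.cauchySeq
    have h2 := cauchySeq_iff_tendsto_dist_atTop_0.mp hUlim.cauchySeq
    have h3 := ((h1.const_mul (embeddingNorm 0 P.T n)).add h2).const_mul L
    rw [mul_zero, add_zero, mul_zero] at h3
    refine squeeze_zero (fun _ => dist_nonneg) (fun k => ?_) h3
    simp only [dist_eq_norm]
    exact hstab _ _ _ _ _ _ _ _ _ (hR _) (hR _) (huc _) (huc _) (hU _) (hU _) (hρ _) (hρ _)
      (hadj _) (hadj _) fun t ht => norm_rep_sub_rep_le hT _ _ ht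
  obtain ⟨q, hq⟩ := exists_tendsto_of_cauchySeq_W hT hpc
  exact ⟨φ₁ ∘ φ₂, (z, q, w), hφ, hylim.prodMk_nhds (hq.prodMk_nhds hUlim)⟩

/-- The adjoint equation is stable under strong convergence. -/
theorem FeedbackAssumption.adjointEq_of_tendsto (hP : P.FeedbackAssumption Y₀ M)
    {y p : ℕ → W 0 P.T n} {U : ℕ → L2 0 P.T m} {z q : W 0 P.T n} {w : L2 0 P.T m} {R : ℝ}
    (hadj : ∀ k, P.AdjointEq (y k) (U k) (p k))
    (hR : ∀ k, ∀ t ∈ Icc 0 P.T, ‖rep (y k) t‖ ≤ R)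
    (hy : Tendsto y atTop (𝓝 z)) (hp : Tendsto p atTop (𝓝 q)) (hU : Tendsto U atTop (𝓝 w)) :
    P.AdjointEq z w q := by
  have hT := right_mem_Icc.mpr P.T_pos.le
  obtain ⟨B, hB⟩ := hP.exists_dynamicsBounds R
  have hRz := norm_rep_le_of_tendsto hR fun t ht => tendsto_rep P.T_pos hy ht
  constructor
  -- The equation is compared pointwise: along a common subsequence both the controls and the
  -- derivatives of the adjoint states converge a.e.
  · obtain ⟨ψ₁, hψ₁, h1⟩ := L2.exists_subseq_tendsto_ae hU
    obtain ⟨ψ₂, hψ₂, h2⟩ := L2.exists_subseq_tendsto_ae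
      ((tendsto_derivL2 hp).comp hψ₁.tendsto_atTop)
    filter_upwards [h1, h2, ae_all_iff.mpr fun k => (hadj k).1,
      ae_restrict_mem measurableSet_Ioo] with t h1 h2 h3 ht
    have ht := Ioo_subset_Icc_self ht
    have hψ := (hψ₁.comp hψ₂).tendsto_atTop
    have h1 := h1.comp hψ₂.tendsto_atTop
    refine tendsto_nhds_unique h2.neg ?_
    simp only [Function.comp_apply, h3]
    have hyt := (tendsto_rep P.T_pos hy ht).comp hψ
    have hpt := (tendsto_rep P.T_pos hp ht).comp hψ
    change Tendsto (fun k => P.adjointRhs t (rep (y (ψ₁ (ψ₂ k))) t) (U (ψ₁ (ψ₂ k)) t)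
      (rep (p (ψ₁ (ψ₂ k))) t) (P.yd t)) atTop
      (𝓝 (P.adjointRhs t (rep z t) (w t) (rep q t) (P.yd t)))
    rw [tendsto_iff_norm_sub_tendsto_zero]
    refine squeeze_zero (fun _ => norm_nonneg _) (fun k => ?_) (?_ : Tendsto (fun k =>
      B * (1 + ‖w t‖) * ‖rep q t - rep (p (ψ₁ (ψ₂ k))) t‖
        + (B * (1 + ‖w t‖) * ‖rep (p (ψ₁ (ψ₂ k))) t‖ + P.runWeight)
          * ‖rep z t - rep (y (ψ₁ (ψ₂ k))) t‖
        + B * ‖rep (p (ψ₁ (ψ₂ k))) t‖ * ‖w t - U (ψ₁ (ψ₂ k)) t‖) atTop (𝓝 0))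
    · rw [norm_sub_rev]
      exact norm_adjointRhs_sub_le hB ht (hRz t ht) (hR _ t ht) _ _ _ _ _
    · have e1 := (hpt.const_sub (rep q t)).norm
      have e2 := (hyt.const_sub (rep z t)).norm
      have e3 := (h1.const_sub (w t)).norm
      have e4 := hpt.norm
      rw [sub_self, norm_zero] at e1 e2 e3
      have e5 := ((e1.const_mul (B * (1 + ‖w t‖))).add
        (((e4.const_mul (B * (1 + ‖w t‖))).add_const P.runWeight).mul e2)).add
        ((e4.const_mul B).mul e3)
      simpa only [mul_zero, add_zero, Function.comp_apply] using e5
  · refine tendsto_nhds_unique (tendsto_rep P.T_pos hp hT) ?_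
    simp only [(hadj _).2]
    exact ((P.Q₂.adjoint.continuous.comp P.Q₂.continuous).tendsto _).comp
      ((tendsto_rep P.T_pos hy hT).sub_const P.ydT)

/-- Strong limits of trajectories whose costs converge to a lower bound of the cost are optimal. -/
theorem FeedbackAssumption.optimal_of_tendsto (hP : P.FeedbackAssumption Y₀ M)
    {y : ℕ → W 0 P.T n} {U : ℕ → L2 0 P.T m} {z : W 0 P.T n} {w : L2 0 P.T m} {x₀ : E n} {R J : ℝ}
    (hs : ∀ k, P.StateEq (y k) (U k) x₀)
    (hR : ∀ k, ∀ t ∈ Icc 0 P.T, ‖rep (y k) t‖ ≤ R)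
    (hJ : Tendsto (fun k => P.cost 0 (rep (y k)) (U k)) atTop (𝓝 J))
    (hopt : ∀ (z : W 0 P.T n) (v : L2 0 P.T m), P.StateEq z v x₀ → J ≤ P.cost 0 (rep z) v)
    (hy : Tendsto y atTop (𝓝 z)) (hU : Tendsto U atTop (𝓝 w)) : P.IsOptimalPair x₀ z w := by
  have hrep := fun t ht => tendsto_rep P.T_pos hy (t := t) ht
  obtain ⟨C, hC⟩ := hU.norm.bddAbove_range
  refine ⟨hP.stateEq_of_weak hs hR hrep (fun χ => (tendsto_derivL2 hy).inner tendsto_const_nhds)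
    (fun k => hC (mem_range_self k)) (fun χ => hU.inner tendsto_const_nhds), fun x v hx => ?_⟩
  -- The cost is continuous under strong convergence, so the limit pair has cost exactly `J`.
  have h1 := (tendsto_cost_of_tendsto_rep (m := m) (P := P) hR hrep).add
    ((hU.norm.pow 2).const_mul (P.β / 2))
  simp only [← cost_eq_add_norm_sq (continuous_rep _).continuousOn] at h1
  rw [tendsto_nhds_unique h1 hJ]
  exact hopt x v hx

end ControlProblem

/-! ### Convergence of the optimal values of the learning problems -/

/-- All excesses `a k j - J j` are eventually nonnegative, so each weighted excess is at most their
weighted sum, hence at most `e k`. -/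
theorem tendsto_of_weighted_sum_le {N : ℕ} {w J : Fin N → ℝ} {a : ℕ → Fin N → ℝ} {e : ℕ → ℝ}
    (hw : ∀ i, 0 < w i) (hJ : ∀ᶠ k in atTop, ∀ i, J i ≤ a k i)
    (ha : ∀ᶠ k in atTop, ∑ i, w i * a k i ≤ ∑ i, w i * J i + e k) (he : Tendsto e atTop (𝓝 0))
    (i : Fin N) : Tendsto (fun k => a k i) atTop (𝓝 (J i)) := by
  have h1 : Tendsto (fun k => J i + e k / w i) atTop (𝓝 (J i)) := by
    simpa using (he.div_const (w i)).const_add (J i)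
  refine tendsto_of_tendsto_of_tendsto_of_le_of_le' tendsto_const_nhds h1
    (hJ.mono fun k hk => hk i) ?_
  filter_upwards [hJ, ha] with k hk hk'
  have h2 : w i * (a k i - J i) ≤ ∑ j, w j * (a k j - J j) :=
    Finset.single_le_sum (f := fun j => w j * (a k j - J j))
      (fun j _ => mul_nonneg (hw j).le (sub_nonneg.mpr (hk j))) (Finset.mem_univ i)
  simp only [mul_sub, Finset.sum_sub_distrib] at h2
  rw [← sub_le_iff_le_add', le_div_iff₀ (hw i)]
  linarith

theorem norm_rep_le_of_eLpNorm_le {a b : ℝ} (hab : a < b) {n : ℕ} {y : W a b n} {R : ℝ}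
    (hR : 0 ≤ R)
    (h : eLpNorm (valL2 y) (⊤ : ℝ≥0∞) (intervalMeasure a b) ≤ ENNReal.ofReal R) :
    ∀ t ∈ Icc a b, ‖rep y t‖ ≤ R := by
  -- Writing the bound as an equality of continuous functions extends it from almost every point to
  -- all of `[a,b]`.
  have h1 : (fun t => max ‖rep y t‖ R) =ᵐ[intervalMeasure a b] fun _ => R := by
    filter_upwards [ae_le_eLpNormEssSup (f := valL2 y) (μ := intervalMeasure a b),
      rep_ae_eq y] with t h2 h3
    rw [h3]
    rw [eLpNorm_exponent_top] at h
    have h4 := h2.trans h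
    rw [← ofReal_norm, ENNReal.ofReal_le_ofReal_iff hR] at h4
    exact max_eq_right h4
  intro t ht
  have h2 := eqOn_Icc_of_ae_eq_Ioo hab h1
    ((continuous_rep y).norm.max continuous_const).continuousOn continuousOn_const ht
  exact max_eq_right_iff.mp h2

namespace ControlProblem

variable {n m N : ℕ} {P : ControlProblem n m} {Y₀ : Set (E n)} {M : ℝ}

theorem cost_le_augmentedCost {γ₁ γ₂ : ℝ} (hγ₁ : 0 ≤ γ₁) (hγ₂ : 0 ≤ γ₂) (v : ℝ → E n → ℝ)
    (y p : W 0 P.T n) :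
    P.cost 0 (rep y) (P.feedback v (rep y)) ≤ P.augmentedCost γ₁ γ₂ v y p :=
  le_add_of_nonneg_right (integral_nonneg fun _ => by positivity)

theorem FeedbackAssumption.approx_bounds (hP : P.FeedbackAssumption Y₀ M) {v : ℝ → E n → ℝ}
    (hv : ContDiff ℝ 4 (fun x : ℝ × E n => v x.1 x.2)) {δ : ℝ}
    (h : ∀ t ∈ Icc 0 P.T, ∀ y ∈ Metric.closedBall (0 : E n) (P.radius M),
      |v t y - P.valueFunction t y|
        + ‖ballGrad (P.radius M) (fun z => v t z - P.valueFunction t z) y‖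
        + ‖ballHess (P.radius M) (fun z => v t z - P.valueFunction t z) y‖ ≤ δ) :
    ∀ t ∈ Icc 0 P.T, ∀ x : E n, ‖x‖ ≤ P.radius M →
      |v t x - P.valueFunction t x| ≤ δ ∧ ‖fderiv ℝ (v t) x - P.valueGrad M t x‖ ≤ δ := by
  intro t ht x hx
  have h1 := h t ht x (mem_closedBall_zero_iff.mpr hx)
  rw [hP.ballGrad_sub ht (fun y => (hasFDerivAt_slice hv t y).differentiableAt) hx] at h1
  have h2 := norm_nonneg (ballHess (P.radius M) (fun z => v t z - P.valueFunction t z) x)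
  have h3 := norm_nonneg (fderiv ℝ (v t) x - P.valueGrad M t x)
  have h4 := abs_nonneg (v t x - P.valueFunction t x)
  constructor <;> linarith

theorem ApproximationAssumption.contDiff {R : ℝ → Type*} [∀ ε, NormedAddCommGroup (R ε)]
    [∀ ε, InnerProductSpace ℝ (R ε)] {ε₀ : ℝ} {V : (ε : ℝ) → R ε → ℝ → E n → ℝ}
    {θ : (ε : ℝ) → R ε} (hV : P.ApproximationAssumption M ε₀ V θ) {ε : ℝ} (hε : ε ∈ Ioc 0 ε₀)
    (η : R ε) : ContDiff ℝ 4 (fun x : ℝ × E n => V ε η x.1 x.2) :=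
  (hV.smooth ε hε).comp (contDiff_const.prodMk contDiff_id)

/-- The number `J` is the optimal cost of the `i`-th open loop problem. Admissibility gives the
lower bound for each cost; comparison with the parameter `θ (ε k)` gives the upper bound for the
weighted sum. -/
theorem FeedbackAssumption.tendsto_cost_learningSolution (hP : P.FeedbackAssumption Y₀ M)
    {R : ℝ → Type*} [∀ ε, NormedAddCommGroup (R ε)] [∀ ε, InnerProductSpace ℝ (R ε)]
    {ε₀ : ℝ} {V : (ε : ℝ) → R ε → ℝ → E n → ℝ} {θ : (ε : ℝ) → R ε}
    (hV : P.ApproximationAssumption M ε₀ V θ) {y₀ : Fin N → E n} (hy₀ : ∀ i, y₀ i ∈ Y₀)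
    {w : Fin N → ℝ} (hw : ∀ i, 0 < w i) {γ₁ γ₂ : ℝ} (hγ₁ : 0 ≤ γ₁) (hγ₂ : 0 ≤ γ₂)
    {γ : ℝ → ℝ} (hγ : ∀ ε, 0 < ε → 0 < γ ε)
    (hγθ : (fun ε => γ ε * ‖θ ε‖ ^ 2) =O[𝓝[>] 0] (fun ε => ε))
    {ε : ℕ → ℝ} (hε : ∀ k, 0 < ε k) (hε0 : Tendsto ε atTop (𝓝 0))
    {y p : ℕ → Fin N → W 0 P.T n} {η : (k : ℕ) → R (ε k)}
    (hsol : ∀ k, P.IsLearningSolution y₀ w γ₁ γ₂ (γ (ε k)) (V (ε k)) (y k) (p k) (η k))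
    (i : Fin N) :
    ∃ J, Tendsto (fun k => P.cost 0 (rep (y k i)) (P.feedbackL2 (V (ε k) (η k)) (y k i)))
        atTop (𝓝 J) ∧
      ∀ (z : W 0 P.T n) (v : L2 0 P.T m), P.StateEq z v (y₀ i) → J ≤ P.cost 0 (rep z) v := by
  choose ys ps us Us hO using fun i => hP.exists_optimalTrajectory (hy₀ i)
  obtain ⟨c, hc, happ⟩ := hV.approx
  choose Λ D hΛ hcomp using fun i => hP.exists_competitor (hO i) hc.le hγ₁ hγ₂
  set J : Fin N → ℝ := fun i => P.cost 0 (rep (ys i)) (Us i) with hJdef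
  refine ⟨J i, ?_, (hO i).optimal.2⟩
  have hεr : Tendsto ε atTop (𝓝[>] 0) :=
    tendsto_nhdsWithin_iff.mpr ⟨hε0, Eventually.of_forall hε⟩
  have hγ0 : Tendsto (fun k => γ (ε k) * ‖θ (ε k)‖ ^ 2) atTop (𝓝 0) :=
    (hγθ.trans_tendsto (tendsto_id.mono_left nhdsWithin_le_nhds)).comp hεr
  have hε₀ : ∀ᶠ k in atTop, ε k ≤ ε₀ := hε0.eventually_le_const hV.ε₀_pos
  have hfb : ∀ k, ε k ≤ ε₀ → ∀ i, P.feedbackL2 (V (ε k) (η k)) (y k i)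
      =ᵐ[intervalMeasure 0 P.T] P.feedback (V (ε k) (η k)) (rep (y k i)) := fun k hk i =>
    hP.coeFn_feedbackL2 (hV.contDiff ⟨hε k, hk⟩ (η k)) (y k i)
  have he : Tendsto (fun k => (∑ i, w i * D i) * ε k + γ (ε k) * ‖θ (ε k)‖ ^ 2 / 2) atTop
      (𝓝 0) := by
    simpa using (hε0.const_mul (∑ i, w i * D i)).add (hγ0.div_const 2)
  refine tendsto_of_weighted_sum_le (a := fun k i => P.cost 0 (rep (y k i))
    (P.feedbackL2 (V (ε k) (η k)) (y k i))) hw ?_ ?_ he i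
  · filter_upwards [hε₀] with k hk i
    exact (hO i).optimal.2 _ _ (((hsol k).1 i).1.congr (hfb k hk i).symm)
  · have hsmall : ∀ᶠ k in atTop, ∀ i, Λ i * ε k ≤ 1 := by
      refine eventually_all.mpr fun i => ?_
      have h1 := hε0.const_mul (Λ i)
      rw [mul_zero] at h1
      exact h1.eventually_le_const one_pos
    have hsmall' : ∀ᶠ k in atTop, ∀ i, Subsingleton (E n) ∨ Λ i * ε k ≤ P.radius M / 2 := by
      rcases hP.subsingleton_or_radius_pos with h | h
      · exact Eventually.of_forall fun k i => Or.inl h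
      · refine eventually_all.mpr fun i => ?_
        have h1 := hε0.const_mul (Λ i)
        rw [mul_zero] at h1
        exact (h1.eventually_le_const (half_pos h)).mono fun k hk => Or.inr hk
    filter_upwards [hε₀, hε0.eventually_le_const one_pos, hsmall, hsmall'] with k h1 h2 h3 h4
    have hmem : ε k ∈ Ioc 0 ε₀ := ⟨hε k, h1⟩
    have hv := hV.contDiff hmem (θ (ε k))
    choose z q hz hq hzq using fun i => hcomp i (ε k) (hε k) h2 (h3 i) (h4 i) _ hv
      (hP.approx_bounds hv (happ _ hmem))
    -- The learning solution is compared with the competitors for `θ (ε k)`. On its own side the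
    -- penalties and the regularization are nonnegative and may be dropped.
    have h5 := (hsol k).2 z q (θ (ε k)) fun i => ⟨hz i, hq i⟩
    unfold learningObjective at h5
    have h6 : ∑ i, w i * P.cost 0 (rep (y k i)) (P.feedbackL2 (V (ε k) (η k)) (y k i))
        ≤ ∑ i, w i * P.augmentedCost γ₁ γ₂ (V (ε k) (η k)) (y k i) (p k i) := by
      refine Finset.sum_le_sum fun i _ => mul_le_mul_of_nonneg_left ?_ (hw i).le
      rw [cost_congr P.T_pos.le (fun _ _ => rfl) (hfb k h1 i)]
      exact cost_le_augmentedCost hγ₁ hγ₂ _ _ _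
    have h7 : ∑ i, w i * P.augmentedCost γ₁ γ₂ (V (ε k) (θ (ε k))) (z i) (q i)
        ≤ ∑ i, w i * (J i + D i * ε k) :=
      Finset.sum_le_sum fun i _ => mul_le_mul_of_nonneg_left (hzq i) (hw i).le
    have h8 : ∑ i, w i * (J i + D i * ε k) = ∑ i, w i * J i + (∑ i, w i * D i) * ε k := by
      rw [Finset.sum_mul, ← Finset.sum_add_distrib]
      exact Finset.sum_congr rfl fun i _ => by ring
    have h9 : 0 ≤ γ (ε k) / 2 * ‖η k‖ ^ 2 := by
      have := hγ _ (hε k)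
      positivity
    linarith

end ControlProblem

end FeedbackLearning

end

/-! ### Accumulation points of the learning solutions -/

theorem mainTheorem8 {n m N : ℕ} (P : ControlProblem n m)
    {R : ℝ → Type*} [∀ ε, NormedAddCommGroup (R ε)] [∀ ε, InnerProductSpace ℝ (R ε)]
    [∀ ε, FiniteDimensional ℝ (R ε)]
    (Y₀ : Set (E n)) (M ε₀ : ℝ) (V : (ε : ℝ) → R ε → ℝ → E n → ℝ) (θ : (ε : ℝ) → R ε)
    (hP : P.FeedbackAssumption Y₀ M) (hV : P.ApproximationAssumption M ε₀ V θ)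
    (y₀ : Fin N → E n) (hy₀ : ∀ i, y₀ i ∈ Y₀) (w : Fin N → ℝ) (hw : ∀ i, 0 < w i)
    (γ₁ γ₂ : ℝ) (hγ₁ : 0 ≤ γ₁) (hγ₂ : 0 ≤ γ₂)
    (γ : ℝ → ℝ) (hγ : ∀ ε, 0 < ε → 0 < γ ε)
    (hγθ : (fun ε => γ ε * ‖θ ε‖ ^ 2) =O[𝓝[>] 0] (fun ε => ε))
    (ε : ℕ → ℝ) (hε : ∀ k, 0 < ε k) (hε0 : Tendsto ε atTop (𝓝 0))
    (y p : ℕ → Fin N → W 0 P.T n) (η : (k : ℕ) → R (ε k))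
    (hsol : ∀ k, P.IsLearningSolution y₀ w γ₁ γ₂ (γ (ε k)) (V (ε k)) (y k) (p k) (η k))
    (Minf : ℝ) (hMinf : 0 < Minf)
    (hbound : ∀ k i, eLpNorm (valL2 (y k i)) ∞ (intervalMeasure 0 P.T) ≤ ENNReal.ofReal Minf) :
    (∃ x : (Fin N → W 0 P.T n) × (Fin N → W 0 P.T n) × (Fin N → L2 0 P.T m),
      MapClusterPt x atTop
        (fun k => (y k, p k, fun i => P.feedbackL2 (V (ε k) (η k)) (y k i)))) ∧
    ∀ (ybar pbar : Fin N → W 0 P.T n) (ubar : Fin N → L2 0 P.T m),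
      MapClusterPt (ybar, pbar, ubar) atTop
        (fun k => (y k, p k, fun i => P.feedbackL2 (V (ε k) (η k)) (y k i))) →
      ∀ i, P.IsOptimalPair (y₀ i) (ybar i) (ubar i) ∧
        P.StateEq (ybar i) (ubar i) (y₀ i) ∧
        P.AdjointEq (ybar i) (ubar i) (pbar i) := by
  -- The approximation assumption is available only for `ε k ≤ ε₀`. Accumulation points depend on
  -- the tail alone, so all arguments below run over indices from `k₀` on.
  obtain ⟨k₀, hk₀⟩ := eventually_atTop.mp (hε0.eventually_le_const hV.ε₀_pos)
  choose J hJ hJopt using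
    hP.tendsto_cost_learningSolution hV hy₀ hw hγ₁ hγ₂ hγ hγθ hε hε0 hsol
  have hv : ∀ k, k₀ ≤ k → ContDiff ℝ 4 (fun x : ℝ × E n => V (ε k) (η k) x.1 x.2) :=
    fun k hk => hV.contDiff ⟨hε k, hk₀ k hk⟩ (η k)
  have hR : ∀ k i, ∀ t ∈ Icc 0 P.T, ‖rep (y k i) t‖ ≤ Minf := fun k i =>
    norm_rep_le_of_eLpNorm_le P.T_pos hMinf.le (hbound k i)
  have hU : ∀ k, k₀ ≤ k → ∀ i, P.feedbackL2 (V (ε k) (η k)) (y k i)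
      =ᵐ[intervalMeasure 0 P.T] P.feedback (V (ε k) (η k)) (rep (y k i)) := fun k hk i =>
    hP.coeFn_feedbackL2 (hv k hk) (y k i)
  have hs : ∀ k, k₀ ≤ k → ∀ i,
      P.StateEq (y k i) (P.feedbackL2 (V (ε k) (η k)) (y k i)) (y₀ i) := fun k hk i =>
    ((hsol k).1 i).1.congr (hU k hk i).symm
  constructor
  · obtain ⟨φ, a, hφ, ha⟩ := exists_common_subseq
      (x := fun i k => (y (k + k₀) i, p (k + k₀) i,
        P.feedbackL2 (V (ε (k + k₀)) (η (k + k₀))) (y (k + k₀) i))) fun i ψ hψ => by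
      obtain ⟨φ, a, hφ, ha⟩ := hP.exists_strong_subseq
        (fun k => hP.continuousOn_feedback (hv (ψ k + k₀) (Nat.le_add_left _ _))
          (continuous_rep (y (ψ k + k₀) i)).continuousOn)
        (fun k => hU (ψ k + k₀) (Nat.le_add_left _ _) i)
        (fun k => hs (ψ k + k₀) (Nat.le_add_left _ _) i)
        (fun k => ((hsol (ψ k + k₀)).1 i).2) (fun k => hR (ψ k + k₀) i)
        ((hJ i).comp ((tendsto_add_atTop_nat k₀).comp hψ.tendsto_atTop)) (hJopt i)
      exact ⟨φ, a, hφ, ha⟩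
    refine ⟨(fun i => (a i).1, fun i => (a i).2.1, fun i => (a i).2.2), MapClusterPt.of_comp
      ((tendsto_add_atTop_nat k₀).comp hφ.tendsto_atTop) (Tendsto.mapClusterPt ?_)⟩
    exact (tendsto_pi_nhds.mpr fun i => (ha i).fst_nhds).prodMk_nhds
      ((tendsto_pi_nhds.mpr fun i => (ha i).snd_nhds.fst_nhds).prodMk_nhds
        (tendsto_pi_nhds.mpr fun i => (ha i).snd_nhds.snd_nhds))
  · intro ybar pbar ubar hcl i
    -- The product space is first countable, so an accumulation point is the limit of a subsequence.
    -- Along it the costs still converge to the optimal value, and the results for strong limits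
    -- apply.
    obtain ⟨ψ, hψ, hlim⟩ := hcl.tendsto_subseq
    have hψ' := hψ.tendsto_atTop.comp (tendsto_add_atTop_nat k₀)
    have hle : ∀ k, k₀ ≤ ψ (k + k₀) := fun k => (Nat.le_add_left _ _).trans (hψ.id_le _)
    have hlim := hlim.comp (tendsto_add_atTop_nat k₀)
    have hy := tendsto_pi_nhds.mp hlim.fst_nhds i
    have hp := tendsto_pi_nhds.mp hlim.snd_nhds.fst_nhds i
    have hu := tendsto_pi_nhds.mp hlim.snd_nhds.snd_nhds i
    have hopt := hP.optimal_of_tendsto (fun k => hs _ (hle k) i) (fun k => hR _ i)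
      ((hJ i).comp hψ') (hJopt i) hy hu
    exact ⟨hopt, hopt.1, hP.adjointEq_of_tendsto
      (fun k => ((hsol _).1 i).2.congr (hU _ (hle k) i).symm) (fun k => hR _ i) hy hp hu⟩
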